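/- Let $d\in\mathbb N$ and let $a=(a_1,\dots,a_d)$ be positive integers. For a real polynomial $P$ in $x_1,\dots,x_d$ let $\deg_a P$ be the maximum of $\sum_i a_ip_i$ over the monomials $x_1^{p_1}\cdots x_d^{p_d}$ of $P$, and let $\mathcal P_n$ be the space of polynomials with $\deg_a P\le n$ (including $0$). Let $\Omega\subset\mathbb R^d$ be a nonempty bounded connected open set with piecewise $C^1$ boundary: the regular boundary points (those near which $\Omega=\{\varphi<0\}$ for a $C^1$ function $\varphi$ with $d\varphi\neq0$) are dense in $\partial\Omega$, and the other boundary points form a set of $(d-1)$-dimensional Hausdorff measure zero. A *polynomial model* on $\Omega$ consists of an operator $\mathrm L=\sum_{ij}g^{ij}\partial^2_{ij}+\sum_i b^i\partial_i$ with coefficients smooth on $\Omega$ and $(g^{ij}(x))$ symmetric positive definite for every $x\in\Omega$, and a probability measure $\mu$ on $\Omega$ with smooth positive density on $\Omega$, such that polynomials are dense in $L^2(\mu)$, $\mathrm L$ is symmetric in $L^2(\mu)$ on smooth functions compactly supported in $\Omega$, and there is an orthonormal family in $L^2(\mu)$ of polynomial eigenvectors of $\mathrm L$, with real eigenvalues,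 such that for every $n$ its members lying in $\mathcal P_n$ span $\mathcal P_n$. We call $\mu$ an *admissible measure* on $\Omega$ if it belongs to some polynomial model on $\Omega$, and $\Omega$ *admissible* if it carries a polynomial model. A *reduced equation* of $\partial\Omega$ is a nonzero real polynomial $Q$ that generates the ideal of all real polynomials vanishing on $\partial\Omega$; it is unique up to a nonzero constant factor. 1. If $\Omega$ is admissible, there is a nonzero polynomial $P$ with $\deg_a P\le 2\sum_i a_i$ and $\partial\Omega\subset\{P=0\}$; moreover $\partial\Omega$ has a reduced equation. Let now $Q$ be a reduced equation of $\partial\Omega$. 2. $\Omega$ is admissible if and only if there are polynomials $g^{ij}=g^{ji}\in\mathcal P_{a_i+a_j}$ and $L_i\in\mathcal P_{a_i}$ such that $$\sum_j g^{ij}\,\partial_jQ=L_i\,Q\quad(1\le i\le d),\qquad (g^{ij}(x))\ \text{is positive definite for every } x\in\Omega. \tag{$*$}$$ For every solution of $(*)$, $Q$ divides $\det(g)$. 3. Let $Q=Q_1\cdots Q_m$ with $Q_k$ irreducible, and let $(g,L)$ be a solution of $(*)$. For all real $r_1,\dots,r_m$ such that $\rho=\prod_k|Q_k|^{r_k}$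 satisfies $\int_\Omega\rho\,dx<\infty$, the probability measure $\mu=\rho\,dx/\int_\Omega\rho\,dx$ on $\Omega$ is admissible. If moreover $Q=\det(g)$ up to a nonzero constant factor, then every probability measure $\mu$ on $\Omega$ that forms a polynomial model with an operator with second order coefficients $g^{ij}$ is of this form. 4. For every solution $(g,L)$ of $(*)$ and every $\rho$, $\mu$ as in the first part of 3, the operator determined by $g$ and $\rho$, $\mathrm L f=\frac1\rho\sum_i\partial_i\big(\rho\sum_jg^{ij}\partial_jf\big)$, forms together with $\mu$ a polynomial model on $\Omega$. -/

import Mathlib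

open MeasureTheory Topology
open scoped ContDiff

/-- The `i`-th partial derivative of a function on `ℝ^d`. -/
noncomputable def partialD {d : ℕ} (i : Fin d) (f : (Fin d → ℝ) → ℝ) (x : Fin d → ℝ) : ℝ :=
  fderiv ℝ f x (Pi.single i 1)

/-- The second order operator without zero-order term
`L f = ∑ g^{ij} ∂²_{ij} f + ∑ b^i ∂_i f`. -/
noncomputable def diffusionOp {d : ℕ} (g : (Fin d → ℝ) → Matrix (Fin d) (Fin d) ℝ)
    (b : (Fin d → ℝ) → Fin d → ℝ) (f : (Fin d → ℝ) → ℝ) (x : Fin d → ℝ) : ℝ :=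
  (∑ i, ∑ j, g x i j * partialD i (partialD j f) x) + ∑ i, b x i * partialD i f x

/-- The drift `b^i = ρ⁻¹ ∑_j ∂_j (ρ g^{ij})`, that is the drift of the operator
`L f = ρ⁻¹ ∑_i ∂_i (ρ ∑_j g^{ij} ∂_j f)` determined by the metric `g` and the density `ρ`. -/
noncomputable def symmetricDrift {d : ℕ} (g : (Fin d → ℝ) → Matrix (Fin d) (Fin d) ℝ)
    (ρ : (Fin d → ℝ) → ℝ) (x : Fin d → ℝ) (i : Fin d) : ℝ :=
  (ρ x)⁻¹ * ∑ j, partialD j (fun y => ρ y * g y i j) x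

/-- A regular boundary point: near `x` the set `Ω` is the side `φ < 0` of a `C¹` hypersurface
`φ = 0` with `dφ ≠ 0`. -/
def IsRegularBoundaryPoint {d : ℕ} (Ω : Set (Fin d → ℝ)) (x : Fin d → ℝ) : Prop :=
  x ∈ frontier Ω ∧ ∃ φ : (Fin d → ℝ) → ℝ, ContDiffAt ℝ 1 φ x ∧ fderiv ℝ φ x ≠ 0 ∧
    ∀ᶠ y in 𝓝 x, y ∈ Ω ↔ φ y < 0

/-- The boundary is piecewise `C¹`: it is the closure of its regular part, and its singular part
is negligible for the `(d-1)`-dimensional Hausdorff measure. -/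
structure HasPiecewiseC1Boundary {d : ℕ} (Ω : Set (Fin d → ℝ)) : Prop where
  frontier_subset : frontier Ω ⊆ closure {x | IsRegularBoundaryPoint Ω x}
  singular_null : Measure.hausdorffMeasure ((d : ℝ) - 1)
    {x | x ∈ frontier Ω ∧ ¬ IsRegularBoundaryPoint Ω x} = 0

/-- A bounded (nonempty) connected open set with piecewise `C¹` boundary. -/
structure IsPiecewiseC1Domain {d : ℕ} (Ω : Set (Fin d → ℝ)) : Prop where
  isOpen : IsOpen Ω
  isConnected : IsConnected Ω
  isBounded : Bornology.IsBounded Ω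
  boundary : HasPiecewiseC1Boundary Ω

/-- `L = ∑ g^{ij} ∂²_{ij} + ∑ b^i ∂_i` and `μ` form a polynomial model on `Ω` for the weighted
degree `deg_a`: `L` is an elliptic diffusion operator with smooth coefficients on `Ω`, `μ` is a
probability measure with smooth positive density on `Ω` for which polynomials are dense in
`L²(μ)`, `L` is symmetric in `L²(μ)` on test functions, and there is an orthonormal family of
polynomial eigenvectors of `L`, with real eigenvalues, adapted to the spaces
`𝒫_n = {p | deg_a p ≤ n}`: for every `n` its members in `𝒫_n` span `𝒫_n`. -/
structure IsPolynomialModel {d : ℕ} (a : Fin d → ℕ) (Ω : Set (Fin d → ℝ))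
    (g : (Fin d → ℝ) → Matrix (Fin d) (Fin d) ℝ) (b : (Fin d → ℝ) → Fin d → ℝ)
    (μ : Measure (Fin d → ℝ)) : Prop where
  smooth_metric : ∀ i j, ContDiffOn ℝ ∞ (fun x => g x i j) Ω
  smooth_drift : ∀ i, ContDiffOn ℝ ∞ (fun x => b x i) Ω
  posDef : ∀ x ∈ Ω, (g x).PosDef
  isProbabilityMeasure : IsProbabilityMeasure μ
  density : ∃ ρ : (Fin d → ℝ) → ℝ, ContDiffOn ℝ ∞ ρ Ω ∧ (∀ x ∈ Ω, 0 < ρ x) ∧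
    μ = (volume.restrict Ω).withDensity (fun x => ENNReal.ofReal (ρ x))
  dense : ∀ f : (Fin d → ℝ) → ℝ, MemLp f 2 μ → ∀ ε : ℝ, 0 < ε →
    ∃ p : MvPolynomial (Fin d) ℝ,
      eLpNorm (fun x => f x - MvPolynomial.eval x p) 2 μ ≤ ENNReal.ofReal ε
  symmetric : ∀ f h : (Fin d → ℝ) → ℝ,
    ContDiff ℝ ∞ f → HasCompactSupport f → tsupport f ⊆ Ω →
    ContDiff ℝ ∞ h → HasCompactSupport h → tsupport h ⊆ Ω →
    ∫ x, diffusionOp g b f x * h x ∂μ = ∫ x, f x * diffusionOp g b h x ∂μ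
  eigenbasis : ∃ s : Set (MvPolynomial (Fin d) ℝ),
    (∀ p ∈ s, ∫ x, MvPolynomial.eval x p * MvPolynomial.eval x p ∂μ = 1) ∧
    (∀ p ∈ s, ∀ q ∈ s, p ≠ q → ∫ x, MvPolynomial.eval x p * MvPolynomial.eval x q ∂μ = 0) ∧
    (∀ p ∈ s, ∃ c : ℝ, ∀ x ∈ Ω,
      diffusionOp g b (fun y => MvPolynomial.eval y p) x = -c * MvPolynomial.eval x p) ∧
    (∀ (n : ℕ) (p : MvPolynomial (Fin d) ℝ), p.weightedTotalDegree a ≤ n →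
      p ∈ Submodule.span ℝ {q | q ∈ s ∧ q.weightedTotalDegree a ≤ n})

/-- `μ` is an admissible measure on `Ω`: some operator forms a polynomial model with it. -/
def IsAdmissibleMeasure {d : ℕ} (a : Fin d → ℕ) (Ω : Set (Fin d → ℝ))
    (μ : Measure (Fin d → ℝ)) : Prop :=
  ∃ (g : (Fin d → ℝ) → Matrix (Fin d) (Fin d) ℝ) (b : (Fin d → ℝ) → Fin d → ℝ),
    IsPolynomialModel a Ω g b μ

/-- An admissible set: a bounded domain with piecewise `C¹` boundary that carries a polynomial
model. -/
def IsAdmissible {d : ℕ} (a : Fin d → ℕ) (Ω : Set (Fin d → ℝ)) : Prop :=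
  IsPiecewiseC1Domain Ω ∧ ∃ μ : Measure (Fin d → ℝ), IsAdmissibleMeasure a Ω μ

/-- `Q` is the reduced equation of `∂Ω` (unique up to a nonzero constant): a nonzero polynomial
that generates the ideal of all real polynomials vanishing on `∂Ω`. -/
def IsReducedBoundaryEquation {d : ℕ} (Ω : Set (Fin d → ℝ))
    (Q : MvPolynomial (Fin d) ℝ) : Prop :=
  Q ≠ 0 ∧ MvPolynomial.vanishingIdeal ℝ (frontier Ω) = Ideal.span {Q}

/-- The value at `x` of a matrix of polynomials. -/
noncomputable def evalMetric {d : ℕ} (G : Matrix (Fin d) (Fin d) (MvPolynomial (Fin d) ℝ))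
    (x : Fin d → ℝ) : Matrix (Fin d) (Fin d) ℝ :=
  G.map (MvPolynomial.eval x)

/-- The boundary equations `∑_j g^{ij} ∂_j Q = L_i Q`, for a symmetric polynomial matrix
`g^{ij} ∈ 𝒫_{a_i + a_j}` and polynomials `L_i ∈ 𝒫_{a_i}`. The matrix is nonnegative and,
as for every metric considered here, nondegenerate in `Ω`. -/
structure SolvesBoundaryEquation {d : ℕ} (a : Fin d → ℕ) (Ω : Set (Fin d → ℝ))
    (Q : MvPolynomial (Fin d) ℝ) (G : Matrix (Fin d) (Fin d) (MvPolynomial (Fin d) ℝ))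
    (L : Fin d → MvPolynomial (Fin d) ℝ) : Prop where
  isSymm : G.IsSymm
  degree_metric : ∀ i j, (G i j).weightedTotalDegree a ≤ a i + a j
  degree_factor : ∀ i, (L i).weightedTotalDegree a ≤ a i
  equation : ∀ i, ∑ j, G i j * MvPolynomial.pderiv j Q = L i * Q
  posDef : ∀ x ∈ Ω, (evalMetric G x).PosDef

/-- The function `∏ |Q_k|^{r_k}`. -/
noncomputable def factorWeight {d m : ℕ} (q : Fin m → MvPolynomial (Fin d) ℝ) (r : Fin m → ℝ)
    (x : Fin d → ℝ) : ℝ :=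
  ∏ k, |MvPolynomial.eval x (q k)| ^ (r k)

/-- The measure on `Ω` with density `∏ |Q_k|^{r_k}`. -/
noncomputable def factorMeasure {d m : ℕ} (Ω : Set (Fin d → ℝ))
    (q : Fin m → MvPolynomial (Fin d) ℝ) (r : Fin m → ℝ) : Measure (Fin d → ℝ) :=
  (volume.restrict Ω).withDensity (fun x => ENNReal.ofReal (factorWeight q r x))

/-- The measure `μ` divided by its total mass. -/
noncomputable def normalizedMeasure {d : ℕ} (μ : Measure (Fin d → ℝ)) : Measure (Fin d → ℝ) :=
  (μ Set.univ)⁻¹ • μ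

/-! From a model to the boundary equations. Since `L` preserves every `𝒫_n`, applying it to `x_i`
and to `x_i x_j` shows that its coefficients are polynomials, of degrees at most `a_i` and `a_i +
a_j`. Orthogonality of the eigenvectors makes `L` symmetric on polynomials, which has the first
order form `∫ (b^i R + ∑_j g^{ij} ∂_j R) dμ = 0` for all polynomials `R`. By Weierstrass
approximation of a function and its derivative, `R` may be a `C¹` function of a polynomial. Taking
the squared positive part of a barrier supported near a regular boundary point gives `∑_j g^{ij} ν_j
= 0` there (`IsConormalAt.sum_mul_apply_eq_zero`); nothing is needed about the density at the
boundary. Hence `det g`, a nonzero element of `𝒫_{2∑a_i}`, vanishes on `∂Ω`. A reduced equation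
exists because coprime polynomials cannot both vanish on a piece of hypersurface: eliminating one
variable would give a nonzero polynomial vanishing on an open set. As `∇Q` is conormal, `g∇Q`
vanishes on `∂Ω` and so is a multiple of `Q`.

From the boundary equations to a model. Multiplying `g∇Q = LQ` by the adjugate gives `Q ∣ det(g)
∂_jQ`, and `Q` is squarefree, so `Q ∣ det g` and `Q` has no zero in `Ω`. The equation passes to each
factor `Q_k`, so that `g∇ log ρ` is a polynomial field of degrees at most `a_i` for `ρ =
∏|Q_k|^{r_k}`. Integration by parts then has no boundary term: for a field `W` with `W·∇Q = O(Q)`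
the error made by the cutoff `χ(nQ)` is dominated and tends to zero (`integral_divergence_eq_zero`),
even where `ρ` blows up. The operator is therefore symmetric on polynomials and preserves the
finite-dimensional spaces `𝒫_n`, and the finite-dimensional spectral theorem gives the eigenbasis.

Uniqueness when `Q` is `det g` up to a constant. Here `d log ρ = g⁻¹N = A/Q` is a closed rational
form with simple poles. Its residues along the factors are constants `r_k`, whence `A/Q = ∑ r_k
dQ_k/Q_k + B` with `B` polynomial. So `V = log ρ - ∑ r_k log|Q_k|` has gradient `B`, and the field
`gB` is tangent to the boundary with components of degrees at most `a_i`. Its divergence has degree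
`0` and integral zero, so it vanishes; testing against `arctan V` gives `∫ (B·gB)/(1+V²) = 0`, hence
`B = 0` and `V` is constant. -/

/-! ### The weighted degree. -/

section WeightedDegree

variable {d : ℕ} (a : Fin d → ℕ)

/-- The homomorphism `X_i ↦ X_i T^{a_i}` recording the weighted degree. -/
noncomputable def gradingHom :
    MvPolynomial (Fin d) ℝ →ₐ[ℝ] Polynomial (MvPolynomial (Fin d) ℝ) :=
  MvPolynomial.aeval fun i => Polynomial.C (MvPolynomial.X i) * Polynomial.X ^ a i

theorem gradingHom_monomial (m : Fin d →₀ ℕ) (c : ℝ) :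
    gradingHom a (MvPolynomial.monomial m c) =
      Polynomial.monomial (Finsupp.weight a m) (MvPolynomial.monomial m c) := by
  rw [gradingHom, MvPolynomial.aeval_monomial, MvPolynomial.monomial_eq,
    ← Polynomial.C_mul_X_pow_eq_monomial, Finsupp.weight_apply]
  simp only [Finsupp.prod, Finsupp.sum, mul_pow, Finset.prod_mul_distrib, map_mul, map_prod,
    map_pow, ← pow_mul, Finset.prod_pow_eq_pow_sum, smul_eq_mul]
  simp only [mul_comm (a _) _, mul_assoc]
  rfl

theorem coeff_coeff_gradingHom (p : MvPolynomial (Fin d) ℝ) (n : ℕ) (m : Fin d →₀ ℕ) :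
    ((gradingHom a p).coeff n).coeff m = if Finsupp.weight a m = n then p.coeff m else 0 := by
  induction p using MvPolynomial.induction_on' with
  | monomial u c =>
    rw [gradingHom_monomial, Polynomial.coeff_monomial]
    by_cases h : u = m
    · subst h; split_ifs <;> simp
    · split_ifs <;> simp [MvPolynomial.coeff_monomial, h]
  | add p q hp hq =>
    simp only [map_add, Polynomial.coeff_add, MvPolynomial.coeff_add, hp, hq]
    split_ifs <;> simp

/-- Turns the weighted degree into the degree in one variable over a domain, from which additivity
on products is inherited. -/
theorem natDegree_gradingHom (p : MvPolynomial (Fin d) ℝ) :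
    (gradingHom a p).natDegree = p.weightedTotalDegree a := by
  apply le_antisymm
  · rw [Polynomial.natDegree_le_iff_coeff_eq_zero]
    intro n hn
    ext m
    rw [coeff_coeff_gradingHom]
    split_ifs with h
    · by_contra hm
      have := MvPolynomial.le_weightedTotalDegree a (MvPolynomial.mem_support_iff.2 hm)
      omega
    · simp
  · refine Finset.sup_le fun m hm => Polynomial.le_natDegree_of_ne_zero fun h => ?_
    have := coeff_coeff_gradingHom a p (Finsupp.weight a m) m
    rw [h] at this
    simp at this
    exact MvPolynomial.mem_support_iff.1 hm this.symm

theorem gradingHom_injective : Function.Injective (gradingHom a) := by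
  rw [injective_iff_map_eq_zero]
  intro p hp
  ext m
  have := coeff_coeff_gradingHom a p (Finsupp.weight a m) m
  rw [hp] at this
  simpa using this.symm

theorem weightedTotalDegree_mul_le (p q : MvPolynomial (Fin d) ℝ) :
    (p * q).weightedTotalDegree a ≤ p.weightedTotalDegree a + q.weightedTotalDegree a := by
  simp only [← natDegree_gradingHom, map_mul]
  exact Polynomial.natDegree_mul_le

theorem weightedTotalDegree_mul {p q : MvPolynomial (Fin d) ℝ} (hp : p ≠ 0) (hq : q ≠ 0) :
    (p * q).weightedTotalDegree a = p.weightedTotalDegree a + q.weightedTotalDegree a := by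
  simp only [← natDegree_gradingHom, map_mul]
  apply Polynomial.natDegree_mul
  · rwa [Ne, map_eq_zero_iff _ (gradingHom_injective a)]
  · rwa [Ne, map_eq_zero_iff _ (gradingHom_injective a)]

/-- Serves to bound the degree of a quotient, such as `L_i` in `g∇Q = LQ`. -/
theorem weightedTotalDegree_le_of_mul_le {p q : MvPolynomial (Fin d) ℝ} (hq : q ≠ 0) {n : ℕ}
    (h : (p * q).weightedTotalDegree a ≤ n + q.weightedTotalDegree a) :
    p.weightedTotalDegree a ≤ n := by
  by_cases hp : p = 0
  · subst hp; rw [MvPolynomial.weightedTotalDegree_zero]; simp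
  · rw [weightedTotalDegree_mul a hp hq] at h; omega

theorem weightedTotalDegree_add_le (p q : MvPolynomial (Fin d) ℝ) {n : ℕ}
    (hp : p.weightedTotalDegree a ≤ n) (hq : q.weightedTotalDegree a ≤ n) :
    (p + q).weightedTotalDegree a ≤ n := by
  rw [← natDegree_gradingHom] at *
  rw [map_add]
  exact (Polynomial.natDegree_add_le _ _).trans (max_le hp hq)

theorem weightedTotalDegree_smul_le (c : ℝ) (p : MvPolynomial (Fin d) ℝ) {n : ℕ}
    (hp : p.weightedTotalDegree a ≤ n) : (c • p).weightedTotalDegree a ≤ n := by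
  rw [← natDegree_gradingHom] at *
  rw [map_smul]
  exact (Polynomial.natDegree_smul_le _ _).trans hp

theorem weightedTotalDegree_C (c : ℝ) :
    (MvPolynomial.C c : MvPolynomial (Fin d) ℝ).weightedTotalDegree a = 0 := by
  rw [← natDegree_gradingHom, gradingHom, MvPolynomial.algHom_C, Polynomial.algebraMap_apply,
    Polynomial.natDegree_C]

theorem weightedTotalDegree_X_le (i : Fin d) :
    (MvPolynomial.X i : MvPolynomial (Fin d) ℝ).weightedTotalDegree a ≤ a i := by
  rw [← natDegree_gradingHom, gradingHom, MvPolynomial.aeval_X]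
  exact Polynomial.natDegree_C_mul_X_pow_le _ _

/-- The space of polynomials of weighted degree at most `n`. -/
noncomputable def weightedDegreeLE (n : ℕ) : Submodule ℝ (MvPolynomial (Fin d) ℝ) where
  carrier := {p | p.weightedTotalDegree a ≤ n}
  zero_mem' := by simp [MvPolynomial.weightedTotalDegree_zero]
  add_mem' hp hq := weightedTotalDegree_add_le a _ _ hp hq
  smul_mem' c p hp := weightedTotalDegree_smul_le a c p hp

theorem mem_weightedDegreeLE {n : ℕ} {p : MvPolynomial (Fin d) ℝ} :
    p ∈ weightedDegreeLE a n ↔ p.weightedTotalDegree a ≤ n := Iff.rfl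

theorem weightedDegreeLE_mono {m n : ℕ} (h : m ≤ n) :
    weightedDegreeLE a m ≤ weightedDegreeLE a n := fun _ hp => le_trans hp h

theorem mul_mem_weightedDegreeLE {m n : ℕ} {p q : MvPolynomial (Fin d) ℝ}
    (hp : p ∈ weightedDegreeLE a m) (hq : q ∈ weightedDegreeLE a n) :
    p * q ∈ weightedDegreeLE a (m + n) :=
  (weightedTotalDegree_mul_le a p q).trans (add_le_add hp hq)

variable {a}

theorem finiteDimensional_weightedDegreeLE (ha : ∀ i, 0 < a i) (n : ℕ) :
    FiniteDimensional ℝ (weightedDegreeLE a n) := by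
  have hfin : {m : Fin d →₀ ℕ | Finsupp.weight a m ≤ n}.Finite :=
    Finsupp.finite_of_nat_weight_le a (fun i => (ha i).ne') n
  have : weightedDegreeLE a n ≤ Submodule.span ℝ
      ((fun m => MvPolynomial.monomial m (1 : ℝ)) '' {m : Fin d →₀ ℕ | Finsupp.weight a m ≤ n}) := by
    intro p hp
    rw [p.as_sum]
    refine Submodule.sum_mem _ fun m hm => ?_
    rw [← mul_one (p.coeff m), ← smul_eq_mul, ← MvPolynomial.smul_monomial]
    refine Submodule.smul_mem _ _ (Submodule.subset_span ⟨m, ?_, rfl⟩)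
    exact (MvPolynomial.le_weightedTotalDegree a hm).trans hp
  have h2 := FiniteDimensional.span_of_finite ℝ
    (hfin.image (fun m => MvPolynomial.monomial m (1 : ℝ)))
  exact Submodule.finiteDimensional_of_le this

variable (a)

/-- `∂_i` lowers the weighted degree by `a_i`. -/
theorem weightedTotalDegree_pderiv (i : Fin d) {p : MvPolynomial (Fin d) ℝ}
    (h : MvPolynomial.pderiv i p ≠ 0) :
    (MvPolynomial.pderiv i p).weightedTotalDegree a + a i ≤ p.weightedTotalDegree a := by
  obtain ⟨m, hm, he⟩ := Finset.exists_mem_eq_sup _ (MvPolynomial.support_nonempty.2 h)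
    (Finsupp.weight a)
  have he : (MvPolynomial.pderiv i p).weightedTotalDegree a = Finsupp.weight a m := he
  have hc : p.coeff (m + Finsupp.single i 1) ≠ 0 := by
    intro h0
    rw [MvPolynomial.mem_support_iff] at hm
    apply hm
    rw [MvPolynomial.coeff_pderiv, h0]
    simp
  have := MvPolynomial.le_weightedTotalDegree a (MvPolynomial.mem_support_iff.2 hc)
  rw [map_add, Finsupp.weight_single] at this
  simp at this
  omega

theorem mul_pderiv_mem {i : Fin d} {k n : ℕ} {p q : MvPolynomial (Fin d) ℝ}
    (hq : q ∈ weightedDegreeLE a (k + a i)) (hp : p ∈ weightedDegreeLE a n) :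
    q * MvPolynomial.pderiv i p ∈ weightedDegreeLE a (k + n) := by
  by_cases h : MvPolynomial.pderiv i p = 0
  · rw [h, mul_zero]; exact Submodule.zero_mem _
  · have h1 := weightedTotalDegree_pderiv a i h
    have h2 := weightedTotalDegree_mul_le a q (MvPolynomial.pderiv i p)
    rw [mem_weightedDegreeLE] at *
    omega

theorem pderiv_mem {i : Fin d} {n : ℕ} {p : MvPolynomial (Fin d) ℝ}
    (hp : p ∈ weightedDegreeLE a (n + a i)) :
    MvPolynomial.pderiv i p ∈ weightedDegreeLE a n := by
  by_cases h : MvPolynomial.pderiv i p = 0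
  · rw [h]; exact Submodule.zero_mem _
  · have h1 := weightedTotalDegree_pderiv a i h
    rw [mem_weightedDegreeLE] at *
    omega

theorem prod_mem_weightedDegreeLE {ι : Type*} (s : Finset ι) (f : ι → MvPolynomial (Fin d) ℝ)
    (n : ι → ℕ) (h : ∀ i ∈ s, f i ∈ weightedDegreeLE a (n i)) :
    ∏ i ∈ s, f i ∈ weightedDegreeLE a (∑ i ∈ s, n i) := by
  classical
  induction s using Finset.induction_on with
  | empty =>
    simp only [Finset.prod_empty, Finset.sum_empty]
    exact (weightedTotalDegree_C a 1).le
  | insert i s hi ih =>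
    rw [Finset.prod_insert hi, Finset.sum_insert hi]
    exact mul_mem_weightedDegreeLE a (h i (by simp)) (ih fun j hj => h j (by simp [hj]))

/-- In each term of the Leibniz expansion the row weights and the column weights both add up to `∑
a_i`. -/
theorem det_mem_weightedDegreeLE (G : Matrix (Fin d) (Fin d) (MvPolynomial (Fin d) ℝ))
    (hG : ∀ i j, G i j ∈ weightedDegreeLE a (a i + a j)) :
    G.det ∈ weightedDegreeLE a (2 * ∑ i, a i) := by
  rw [Matrix.det_apply]
  refine Submodule.sum_mem _ fun σ _ => ?_
  have h : ∏ i, G (σ i) i ∈ weightedDegreeLE a (2 * ∑ i, a i) := by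
    have h1 := prod_mem_weightedDegreeLE a Finset.univ (fun i => G (σ i) i)
      (fun i => a (σ i) + a i) fun i _ => hG _ _
    rwa [Finset.sum_add_distrib, Equiv.sum_comp σ a, ← two_mul] at h1
  rw [Units.smul_def]
  exact zsmul_mem h _

end WeightedDegree

/-! ### Polynomials as smooth functions. -/

section Evaluation

variable {d : ℕ}

theorem hasFDerivAt_eval (p : MvPolynomial (Fin d) ℝ) (x : Fin d → ℝ) :
    HasFDerivAt (fun y => MvPolynomial.eval y p)
      (∑ i, MvPolynomial.eval x (MvPolynomial.pderiv i p) •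
        (ContinuousLinearMap.proj i : (Fin d → ℝ) →L[ℝ] ℝ)) x := by
  induction p using MvPolynomial.induction_on with
  | C c => simpa using hasFDerivAt_const c x
  | add p q hp hq =>
    refine (hp.add hq).congr_fderiv ?_ |>.congr_of_eventuallyEq
      (Filter.Eventually.of_forall fun y => by simp)
    simp [add_smul, Finset.sum_add_distrib]
  | mul_X p i hp =>
    have h := hp.mul (ContinuousLinearMap.proj i : (Fin d → ℝ) →L[ℝ] ℝ).hasFDerivAt
    have e : (fun y => MvPolynomial.eval y (p * MvPolynomial.X i)) =
        (fun y => MvPolynomial.eval y p) *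
          ⇑(ContinuousLinearMap.proj i : (Fin d → ℝ) →L[ℝ] ℝ) := by
      ext y; simp
    rw [e]
    refine h.congr_fderiv ?_
    ext v
    simp only [Derivation.leibniz, MvPolynomial.pderiv_X, smul_eq_mul, map_add, map_mul,
      MvPolynomial.eval_X, Pi.single_apply, apply_ite (MvPolynomial.eval x), map_one, map_zero,
      add_smul, Finset.sum_add_distrib]
    simp [Finset.mul_sum, mul_assoc]

theorem partialD_eval (i : Fin d) (p : MvPolynomial (Fin d) ℝ) :
    partialD i (fun y => MvPolynomial.eval y p) =
      fun y => MvPolynomial.eval y (MvPolynomial.pderiv i p) := by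
  ext x
  rw [partialD, (hasFDerivAt_eval p x).fderiv]
  simp [Pi.single_apply]

theorem contDiff_eval {n : WithTop ℕ∞} (p : MvPolynomial (Fin d) ℝ) :
    ContDiff ℝ n (fun y : Fin d → ℝ => MvPolynomial.eval y p) :=
  (AnalyticOnNhd.eval_mvPolynomial p).contDiff

theorem continuous_eval (p : MvPolynomial (Fin d) ℝ) :
    Continuous (fun y : Fin d → ℝ => MvPolynomial.eval y p) :=
  p.continuous_eval

/-- Lets identities between values on `Ω` be lifted to identities of polynomials; an open set
contains a product of infinite sets. -/
theorem eq_zero_of_eval_eq_zero_of_isOpen {U : Set (Fin d → ℝ)} (hU : IsOpen U)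
    (hne : U.Nonempty) {p : MvPolynomial (Fin d) ℝ}
    (h : ∀ x ∈ U, MvPolynomial.eval x p = 0) : p = 0 := by
  obtain ⟨x, hx⟩ := hne
  obtain ⟨ε, hε, hb⟩ := Metric.isOpen_iff.1 hU x hx
  refine MvPolynomial.funext_set (fun i => Metric.ball (x i) ε) (fun i => ?_) fun y hy => ?_
  · rw [Real.ball_eq_Ioo]; exact Set.Ioo_infinite (by linarith)
  · rw [map_zero]
    refine h y (hb ?_)
    rw [ball_pi x hε]
    exact hy

theorem eq_of_eval_eq_of_isOpen {U : Set (Fin d → ℝ)} (hU : IsOpen U)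
    (hne : U.Nonempty) {p q : MvPolynomial (Fin d) ℝ}
    (h : ∀ x ∈ U, MvPolynomial.eval x p = MvPolynomial.eval x q) : p = q :=
  sub_eq_zero.1 (eq_zero_of_eval_eq_zero_of_isOpen hU hne fun x hx => by simp [h x hx])

theorem diffusionOp_eval (g : (Fin d → ℝ) → Matrix (Fin d) (Fin d) ℝ)
    (b : (Fin d → ℝ) → Fin d → ℝ) (p : MvPolynomial (Fin d) ℝ) (x : Fin d → ℝ) :
    diffusionOp g b (fun y => MvPolynomial.eval y p) x =
      (∑ i, ∑ j, g x i j *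
        MvPolynomial.eval x (MvPolynomial.pderiv i (MvPolynomial.pderiv j p))) +
      ∑ i, b x i * MvPolynomial.eval x (MvPolynomial.pderiv i p) := by
  simp only [diffusionOp, partialD_eval]

end Evaluation

/-! ### Elimination of one variable. -/

section Elimination

-- By Gauss's lemma `f` and `g` stay coprime over the fraction field; clearing the denominators in a
-- Bézout relation there gives `N`.
open Polynomial in
theorem exists_C_mem_span_of_isRelPrime {A : Type*} [CommRing A] [IsDomain A]
    [UniqueFactorizationMonoid A] {f g : A[X]} (h : IsRelPrime f g) :
    ∃ N : A, N ≠ 0 ∧ C N ∈ Ideal.span {f, g} := by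
  let K := FractionRing A
  have hinj : Function.Injective (algebraMap A K) := IsFractionRing.injective A K
  have hco : IsCoprime (f.map (algebraMap A K)) (g.map (algebraMap A K)) := by
    classical
    rw [← EuclideanDomain.gcd_isUnit_iff]
    set w := EuclideanDomain.gcd (f.map (algebraMap A K)) (g.map (algebraMap A K)) with hw
    have hw0 : w ≠ 0 := by
      intro h0
      obtain ⟨hf, hg⟩ := EuclideanDomain.gcd_eq_zero_iff.1 h0
      rw [Polynomial.map_eq_zero_iff hinj] at hf hg
      subst hf hg
      exact not_isUnit_zero (h dvd_rfl dvd_rfl)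
    -- Clearing denominators in the gcd and taking the primitive part gives a common divisor of `f`
    -- and `g` over `A` itself, hence a unit.
    let _ : NormalizedGCDMonoid A := (inferInstance : Nonempty (NormalizedGCDMonoid A)).some
    obtain ⟨c, c0, hc⟩ := IsLocalization.integerNormalization_spec (nonZeroDivisors A) w
    refine isUnit_or_eq_zero_of_isUnit_integerNormalization_primPart (R := A) hw0 ?_
    set r := IsLocalization.integerNormalization (nonZeroDivisors A) w with hr
    have hdvd : r.primPart.map (algebraMap A K) ∣ w := by
      have h1 : r.primPart.map (algebraMap A K) ∣ r.map (algebraMap A K) :=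
        Polynomial.map_dvd _ r.primPart_dvd
      rw [hc, Algebra.smul_def, Polynomial.algebraMap_apply] at h1
      have hu : IsUnit (C (algebraMap A K c)) := by
        rw [Polynomial.isUnit_C, isUnit_iff_ne_zero]
        exact (map_ne_zero_iff _ hinj).2 (nonZeroDivisors.ne_zero c0)
      exact hu.dvd_mul_left.1 h1
    apply h
    · exact r.isPrimitive_primPart.dvd_of_fraction_map_dvd_fraction_map
        (hdvd.trans (EuclideanDomain.gcd_dvd_left _ _))
    · exact r.isPrimitive_primPart.dvd_of_fraction_map_dvd_fraction_map
        (hdvd.trans (EuclideanDomain.gcd_dvd_right _ _))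
  obtain ⟨u, v, huv⟩ := hco
  obtain ⟨c, c0, hc⟩ := IsLocalization.integerNormalization_spec (nonZeroDivisors A) u
  obtain ⟨e, e0, he⟩ := IsLocalization.integerNormalization_spec (nonZeroDivisors A) v
  set U := IsLocalization.integerNormalization (nonZeroDivisors A) u
  set V := IsLocalization.integerNormalization (nonZeroDivisors A) v
  refine ⟨c * e, mul_ne_zero (nonZeroDivisors.ne_zero c0) (nonZeroDivisors.ne_zero e0), ?_⟩
  rw [Ideal.mem_span_pair]
  refine ⟨C e * U, C c * V, Polynomial.map_injective _ hinj ?_⟩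
  rw [Algebra.smul_def, Polynomial.algebraMap_apply] at hc he
  simp only [Polynomial.map_add, Polynomial.map_mul, hc, he, Polynomial.map_C, map_mul]
  linear_combination (C (algebraMap A K c)) * (C (algebraMap A K e)) * huv

/-- `N` plays the role of the resultant with respect to `x_j`: both polynomials are read as
polynomials in `x_j` over the ring of the other variables, a unique factorization domain. -/
theorem exists_eliminant {d : ℕ} {p q : MvPolynomial (Fin d) ℝ} (h : IsRelPrime p q)
    (j : Fin d) : ∃ N : MvPolynomial (Fin d) ℝ, N ≠ 0 ∧ MvPolynomial.pderiv j N = 0 ∧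
      (∀ (x : Fin d → ℝ) (t : ℝ),
        MvPolynomial.eval (x + Pi.single j t) N = MvPolynomial.eval x N) ∧
      N ∈ Ideal.span {p, q} := by
  classical
  let e : MvPolynomial (Fin d) ℝ ≃ₐ[ℝ] Polynomial (MvPolynomial {i : Fin d // i ≠ j} ℝ) :=
    (MvPolynomial.renameEquiv ℝ (Equiv.optionSubtypeNe j).symm).trans
      (MvPolynomial.optionEquivLeft ℝ _)
  have hrel : IsRelPrime (e p) (e q) := by
    intro w hp hq
    have hp' : e.symm w ∣ p := by simpa using map_dvd e.symm hp
    have hq' : e.symm w ∣ q := by simpa using map_dvd e.symm hq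
    simpa using (h hp' hq').map e
  obtain ⟨N, hN, hmem⟩ := exists_C_mem_span_of_isRelPrime hrel
  have hren : ∀ N : MvPolynomial {i : Fin d // i ≠ j} ℝ,
      e (MvPolynomial.rename Subtype.val N) = Polynomial.C N := by
    intro N
    induction N using MvPolynomial.induction_on with
    | C c => simp [e]
    | add p q hp hq => simp only [map_add, hp, hq]
    | mul_X p i hp =>
      rw [map_mul, map_mul, hp, map_mul]
      simp [e, i.2]
  refine ⟨MvPolynomial.rename Subtype.val N, ?_, ?_, ?_, ?_⟩
  · rwa [Ne, map_eq_zero_iff _ (MvPolynomial.rename_injective _ Subtype.val_injective)]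
  · refine MvPolynomial.pderiv_eq_zero_of_notMem_vars fun h => ?_
    obtain ⟨i, -, hi⟩ := Finset.mem_image.1 (MvPolynomial.vars_rename _ _ h)
    exact i.2 hi
  · intro x t
    rw [MvPolynomial.eval_rename, MvPolynomial.eval_rename]
    congr 2
    ext i
    simp [i.2]
  · obtain ⟨u, v, huv⟩ := Ideal.mem_span_pair.1 hmem
    rw [Ideal.mem_span_pair]
    refine ⟨e.symm u, e.symm v, e.injective ?_⟩
    simp [huv, hren]

end Elimination

/-! ### The divergence theorem without boundary term. -/

section DivergenceTheorem

variable {d : ℕ}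

theorem Filter.EventuallyEq.partialD_eq {f g : (Fin d → ℝ) → ℝ} {x : Fin d → ℝ} (h : f =ᶠ[𝓝 x] g)
    (i : Fin d) : partialD i f x = partialD i g x := by
  rw [partialD, partialD, h.fderiv_eq]

theorem ContDiff.continuous_partialD {f : (Fin d → ℝ) → ℝ} (hf : ContDiff ℝ 1 f) (i : Fin d) :
    Continuous (partialD i f) :=
  (hf.continuous_fderiv (by norm_num)).clm_apply continuous_const

theorem HasCompactSupport.partialD {f : (Fin d → ℝ) → ℝ} (hf : HasCompactSupport f) (i : Fin d) :
    HasCompactSupport (partialD i f) :=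
  hf.fderiv_apply (𝕜 := ℝ) _

theorem integral_partialD_eq_zero {f : (Fin d → ℝ) → ℝ} (hf : ContDiff ℝ 1 f)
    (hc : HasCompactSupport f) (i : Fin d) : ∫ x, partialD i f x = 0 := by
  have hi : Integrable (fun x => fderiv ℝ f x (Pi.single i 1)) :=
    (hf.continuous_partialD i).integrable_of_hasCompactSupport (hc.partialD i)
  have h := integral_mul_fderiv_eq_neg_fderiv_mul_of_integrable (μ := (volume : Measure (Fin d → ℝ)))
    (f := fun _ => (1 : ℝ)) (g := f) (v := Pi.single i 1) (by simp)
    (by simpa only [one_mul] using hi)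
    (by simpa using hf.continuous.integrable_of_hasCompactSupport hc)
    (fun x _ => differentiableAt_const _)
    (fun x _ => (hf.differentiable (by norm_num)).differentiableAt)
  simp only [one_mul, fderiv_fun_const, Pi.zero_apply, zero_apply, zero_mul,
    integral_zero, neg_zero] at h
  exact h

/-- Fields known only on `Ω` are extended by zero, so that integration by parts on the whole space
applies. -/
theorem contDiff_indicator_of_isCompact {n : WithTop ℕ∞} {Ω K : Set (Fin d → ℝ)} (hΩ : IsOpen Ω)
    (hK : IsCompact K) (hKΩ : K ⊆ Ω) {f : (Fin d → ℝ) → ℝ} (hf : ContDiffOn ℝ n f Ω)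
    (h0 : ∀ x ∈ Ω, x ∉ K → f x = 0) : ContDiff ℝ n (Ω.indicator f) := by
  rw [contDiff_iff_contDiffAt]
  intro x
  by_cases hx : x ∈ Ω
  · refine (hf.contDiffAt (hΩ.mem_nhds hx)).congr_of_eventuallyEq ?_
    filter_upwards [hΩ.mem_nhds hx] with y hy using Set.indicator_of_mem hy f
  · refine (contDiffAt_const (c := (0 : ℝ))).congr_of_eventuallyEq ?_
    filter_upwards [hK.isClosed.isOpen_compl.mem_nhds fun h => hx (hKΩ h)] with y hy
    by_cases hyΩ : y ∈ Ω
    · rw [Set.indicator_of_mem hyΩ, h0 y hyΩ hy]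
    · exact Set.indicator_of_notMem hyΩ f

theorem hasCompactSupport_indicator_of_isCompact {Ω K : Set (Fin d → ℝ)}
    (hK : IsCompact K) {f : (Fin d → ℝ) → ℝ}
    (h0 : ∀ x ∈ Ω, x ∉ K → f x = 0) : HasCompactSupport (Ω.indicator f) := by
  refine HasCompactSupport.intro hK fun x hx => ?_
  by_cases hxΩ : x ∈ Ω
  · rw [Set.indicator_of_mem hxΩ, h0 x hxΩ hx]
  · exact Set.indicator_of_notMem hxΩ f

/-- The divergence theorem for a vector field compactly supported in `Ω`. -/
theorem integral_divergence_eq_zero_of_isCompact {Ω K : Set (Fin d → ℝ)} (hΩ : IsOpen Ω)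
    (hK : IsCompact K) (hKΩ : K ⊆ Ω) {W : Fin d → (Fin d → ℝ) → ℝ}
    (hW : ∀ i, ContDiffOn ℝ 1 (W i) Ω) (h0 : ∀ i, ∀ x ∈ Ω, x ∉ K → W i x = 0) :
    ∫ x in Ω, ∑ i, partialD i (W i) x = 0 := by
  have hsm := fun i => contDiff_indicator_of_isCompact hΩ hK hKΩ (hW i) (h0 i)
  have hcs := fun i => hasCompactSupport_indicator_of_isCompact hK (h0 i)
  have e : ∀ i, ∀ x ∈ Ω, partialD i (W i) x = partialD i (Ω.indicator (W i)) x := fun i x hx =>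
    Filter.EventuallyEq.partialD_eq
      (by filter_upwards [hΩ.mem_nhds hx] with y hy using (Set.indicator_of_mem hy _).symm) i
  rw [setIntegral_congr_fun hΩ.measurableSet
    (g := fun x => ∑ i, partialD i (Ω.indicator (W i)) x)
    (fun x hx => Finset.sum_congr rfl fun i _ => e i x hx), integral_finsetSum]
  · refine Finset.sum_eq_zero fun i _ => ?_
    rw [setIntegral_eq_integral_of_forall_compl_eq_zero, integral_partialD_eq_zero (hsm i) (hcs i)]
    intro x hx
    have : Ω.indicator (W i) =ᶠ[𝓝 x] fun _ => 0 := by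
      filter_upwards [hK.isClosed.isOpen_compl.mem_nhds fun h => hx (hKΩ h)] with y hy
      by_cases hyΩ : y ∈ Ω
      · rw [Set.indicator_of_mem hyΩ, h0 i y hyΩ hy]
      · exact Set.indicator_of_notMem hyΩ _
    rw [this.partialD_eq, partialD]
    simp
  · exact fun i _ => (((hsm i).continuous_partialD i).integrable_of_hasCompactSupport
      ((hcs i).partialD i)).integrableOn

theorem partialD_mul {f g : (Fin d → ℝ) → ℝ} {x : Fin d → ℝ} (hf : DifferentiableAt ℝ f x)
    (hg : DifferentiableAt ℝ g x) (i : Fin d) :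
    partialD i (fun y => f y * g y) x = f x * partialD i g x + partialD i f x * g x := by
  simp only [partialD, fderiv_fun_mul hf hg]
  simp [mul_comm]

theorem partialD_sub {f g : (Fin d → ℝ) → ℝ} {x : Fin d → ℝ} (hf : DifferentiableAt ℝ f x)
    (hg : DifferentiableAt ℝ g x) (i : Fin d) :
    partialD i (fun y => f y - g y) x = partialD i f x - partialD i g x := by
  simp only [partialD, fderiv_fun_sub hf hg]
  simp

theorem partialD_comp {u : ℝ → ℝ} {f : (Fin d → ℝ) → ℝ} {x : Fin d → ℝ}
    (hu : DifferentiableAt ℝ u (f x)) (hf : DifferentiableAt ℝ f x) (i : Fin d) :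
    partialD i (fun y => u (f y)) x = deriv u (f x) * partialD i f x := by
  have := (hu.hasDerivAt.comp_hasFDerivAt x hf.hasFDerivAt).fderiv
  rw [partialD, show (fun y => u (f y)) = u ∘ f from rfl, this]
  simp [partialD]

theorem partialD_sum {ι : Type*} (s : Finset ι) {f : ι → (Fin d → ℝ) → ℝ} {x : Fin d → ℝ}
    (hf : ∀ k ∈ s, DifferentiableAt ℝ (f k) x) (i : Fin d) :
    partialD i (fun y => ∑ k ∈ s, f k y) x = ∑ k ∈ s, partialD i (f k) x := by
  simp only [partialD, fderiv_fun_sum hf]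
  simp

/-- A smooth function vanishing near `0` and equal to `1` away from it. -/
noncomputable def cutoff (t : ℝ) : ℝ := Real.smoothTransition (t ^ 2 - 1)

theorem contDiff_cutoff {n : ℕ∞} : ContDiff ℝ n cutoff :=
  Real.smoothTransition.contDiff.comp ((contDiff_id.pow 2).sub contDiff_const)

theorem cutoff_eq_zero {t : ℝ} (h : |t| ≤ 1) : cutoff t = 0 :=
  Real.smoothTransition.zero_of_nonpos (by rw [← sq_abs]; nlinarith [abs_nonneg t])

theorem cutoff_eq_one {t : ℝ} (h : 2 ≤ |t|) : cutoff t = 1 :=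
  Real.smoothTransition.one_of_one_le (by rw [← sq_abs]; nlinarith [abs_nonneg t])

theorem deriv_cutoff_eq_zero {t : ℝ} (h : 2 < |t|) : deriv cutoff t = 0 := by
  have : cutoff =ᶠ[𝓝 t] fun _ => 1 := by
    filter_upwards [(isOpen_lt continuous_const continuous_abs).mem_nhds h] with s hs
    exact cutoff_eq_one (le_of_lt hs)
  rw [this.deriv_eq, deriv_const]

theorem cutoff_nonneg (t : ℝ) : 0 ≤ cutoff t := Real.smoothTransition.nonneg _
theorem cutoff_le_one (t : ℝ) : cutoff t ≤ 1 := Real.smoothTransition.le_one _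

/-- The scale-invariant bound behind the cutoffs `χ(nQ)`: when `W·∇Q = O(Q)`, the term `n χ'(nQ)
W·∇Q` is controlled by `nQ χ'(nQ)`, uniformly in `n`. -/
theorem exists_bound_mul_deriv_cutoff : ∃ C, 0 ≤ C ∧ ∀ t, |deriv cutoff t * t| ≤ C := by
  have hcont : Continuous fun t => deriv cutoff t * t :=
    ((contDiff_cutoff (n := 1)).continuous_deriv (by norm_num)).mul continuous_id
  obtain ⟨C, hC⟩ := (isCompact_Icc (a := (-2 : ℝ)) (b := 2)).exists_bound_of_continuousOn
    hcont.continuousOn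
  refine ⟨max C 0, le_max_right _ _, fun t => ?_⟩
  by_cases h : |t| ≤ 2
  · exact (hC t (abs_le.1 h)).trans (le_max_left _ _)
  · rw [deriv_cutoff_eq_zero (not_le.1 h)]; simp

/-- The divergence theorem without boundary term: if `Q` is an equation of the boundary that does
not vanish in `Ω` and `W·∇Q` is dominated by `Q`, then the divergence of `W` has integral zero. -/
theorem integral_divergence_eq_zero {Ω : Set (Fin d → ℝ)} (hΩ : IsOpen Ω)
    (hb : Bornology.IsBounded Ω) {Q : MvPolynomial (Fin d) ℝ}
    (hQ0 : ∀ x ∈ frontier Ω, MvPolynomial.eval x Q = 0)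
    (hQ1 : ∀ x ∈ Ω, MvPolynomial.eval x Q ≠ 0)
    {W : Fin d → (Fin d → ℝ) → ℝ} (hW : ∀ i, ContDiffOn ℝ 1 (W i) Ω)
    (hint : IntegrableOn (fun x => ∑ i, partialD i (W i) x) Ω)
    {h : (Fin d → ℝ) → ℝ} (hh : IntegrableOn h Ω)
    (hWQ : ∀ x ∈ Ω, |∑ i, W i x * MvPolynomial.eval x (MvPolynomial.pderiv i Q)| ≤
      h x * |MvPolynomial.eval x Q|) :
    ∫ x in Ω, ∑ i, partialD i (W i) x = 0 := by
  obtain ⟨C, hC0, hC⟩ := exists_bound_mul_deriv_cutoff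
  set q : (Fin d → ℝ) → ℝ := fun x => MvPolynomial.eval x Q with hq
  have hqs : ContDiff ℝ 1 q := contDiff_eval Q
  set ψ : ℕ → (Fin d → ℝ) → ℝ := fun n x => cutoff (n * q x) with hψ
  have hψs : ∀ n, ContDiff ℝ 1 (ψ n) := fun n =>
    (contDiff_cutoff (n := 1)).comp (contDiff_const.mul hqs)
  have hWd : ∀ i, ∀ x ∈ Ω, DifferentiableAt ℝ (W i) x := fun i x hx =>
    ((hW i).contDiffAt (hΩ.mem_nhds hx)).differentiableAt (by norm_num)
  have hψd : ∀ n i x, partialD i (ψ n) x = deriv cutoff (n * q x) *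
      (n * MvPolynomial.eval x (MvPolynomial.pderiv i Q)) := by
    intro n i x
    rw [hψ, partialD_comp (f := fun x => (n : ℝ) * q x)
      ((contDiff_cutoff (n := 1)).differentiable (by norm_num)).differentiableAt
      ((contDiff_const.mul hqs).differentiable (by norm_num)).differentiableAt,
      partialD_mul (differentiableAt_const _) (hqs.differentiable (by norm_num)).differentiableAt,
      hq, partialD_eval]
    simp [partialD]
  have hdiv : ∀ n, ∀ x ∈ Ω, ∑ i, partialD i (fun y => ψ n y * W i y) x =
      ψ n x * ∑ i, partialD i (W i) x + deriv cutoff (n * q x) * n *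
        ∑ i, W i x * MvPolynomial.eval x (MvPolynomial.pderiv i Q) := by
    intro n x hx
    rw [Finset.mul_sum, Finset.mul_sum, ← Finset.sum_add_distrib]
    refine Finset.sum_congr rfl fun i _ => ?_
    rw [partialD_mul ((hψs n).differentiable (by norm_num)).differentiableAt (hWd i x hx), hψd]
    ring
  have hzero : ∀ n, ∫ x in Ω, ∑ i, partialD i (fun y => ψ n y * W i y) x = 0 := by
    intro n
    -- `K` is compact and misses the frontier, where `Q` vanishes, so it lies in `Ω`; the cutoff is
    -- zero off `K`.
    set K := closure Ω ∩ {x | 1 ≤ |n * q x|} with hKdef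
    have hcl : IsClosed {x | 1 ≤ |n * q x|} :=
      isClosed_le continuous_const (continuous_const.mul hqs.continuous).abs
    refine integral_divergence_eq_zero_of_isCompact (K := K) hΩ
      (hb.isCompact_closure.inter_right hcl) ?_ (fun i => (hψs n).contDiffOn.mul (hW i)) ?_
    · rintro x ⟨hx1, hx2⟩
      by_contra hx
      have : x ∈ frontier Ω := ⟨hx1, by rwa [hΩ.interior_eq]⟩
      have h0 : q x = 0 := hQ0 x this
      simp only [Set.mem_ofPred_eq, h0] at hx2
      norm_num at hx2
    · intro i x hx hxK
      have : |n * q x| ≤ 1 := by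
        by_contra hlt
        exact hxK ⟨subset_closure hx, le_of_lt (not_le.1 hlt)⟩
      simp [hψ, cutoff_eq_zero this]
  -- The term with the derivative of the cutoff is at most `C h`, and at each point of `Ω` it is
  -- zero once `n|Q| > 2`; the cutoff itself is then `1`.
  have hlim := tendsto_integral_of_dominated_convergence (μ := volume.restrict Ω)
    (F := fun n x => ∑ i, partialD i (fun y => ψ n y * W i y) x)
    (f := fun x => ∑ i, partialD i (W i) x)
    (fun x => |∑ i, partialD i (W i) x| + C * h x) ?_ (hint.abs.add (hh.const_mul C)) ?_ ?_
  · simp only [hzero] at hlim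
    exact tendsto_nhds_unique tendsto_const_nhds hlim |>.symm
  · intro n
    refine ContinuousOn.aestronglyMeasurable ?_ hΩ.measurableSet
    refine continuousOn_finsetSum _ fun i _ => ?_
    have := (((hψs n).contDiffOn.mul (hW i)).continuousOn_fderiv_of_isOpen hΩ (by norm_num))
    exact this.clm_apply continuousOn_const
  · intro n
    refine (ae_restrict_iff' hΩ.measurableSet).2 (Filter.Eventually.of_forall fun x hx => ?_)
    rw [hdiv n x hx, Real.norm_eq_abs]
    refine (abs_add_le _ _).trans (add_le_add ?_ ?_)
    · rw [abs_mul, abs_of_nonneg (cutoff_nonneg _)]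
      exact mul_le_of_le_one_left (abs_nonneg _) (cutoff_le_one _)
    · rw [abs_mul]
      have h1 : 0 < |q x| := abs_pos.2 (hQ1 x hx)
      have hx0 : 0 ≤ h x := by
        have := (abs_nonneg _).trans (hWQ x hx)
        exact nonneg_of_mul_nonneg_left this h1
      have h2 := hC (n * q x)
      calc _ ≤ |deriv cutoff (n * q x) * n| * (h x * |q x|) :=
            mul_le_mul_of_nonneg_left (hWQ x hx) (abs_nonneg _)
        _ = |deriv cutoff (n * q x) * (n * q x)| * h x := by simp only [abs_mul]; ring
        _ ≤ C * h x := mul_le_mul_of_nonneg_right h2 hx0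
  · refine (ae_restrict_iff' hΩ.measurableSet).2 (Filter.Eventually.of_forall fun x hx => ?_)
    refine tendsto_const_nhds.congr' ?_
    have h1 : 0 < |q x| := abs_pos.2 (hQ1 x hx)
    obtain ⟨N, hN⟩ := exists_nat_gt (2 / |q x|)
    filter_upwards [Filter.eventually_ge_atTop N] with n hn
    have h2 : 2 < |n * q x| := by
      rw [abs_mul, Nat.abs_cast]
      rw [div_lt_iff₀ h1] at hN
      have : (N : ℝ) ≤ n := by exact_mod_cast hn
      nlinarith
    rw [hdiv n x hx, deriv_cutoff_eq_zero h2]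
    simp [hψ, cutoff_eq_one h2.le]

end DivergenceTheorem

/-! ### Eigenvectors adapted to a filtration. -/

section SpectralTheorem

variable {V : Type*} [NormedAddCommGroup V] [InnerProductSpace ℝ V]

/-- The orthogonal increments of a filtration. -/
noncomputable def orthogonalIncrement (P : ℕ → Submodule ℝ V) : ℕ → Submodule ℝ V
  | 0 => P 0
  | n + 1 => (P n)ᗮ ⊓ P (n + 1)

theorem orthogonalIncrement_le (P : ℕ → Submodule ℝ V) (n : ℕ) : orthogonalIncrement P n ≤ P n := by
  cases n with
  | zero => exact le_rfl
  | succ n => exact inf_le_right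

theorem inner_eq_zero_of_mem_orthogonalIncrement {P : ℕ → Submodule ℝ V} (hP : Monotone P)
    {m n : ℕ} (hmn : m < n) {v w : V} (hv : v ∈ orthogonalIncrement P m)
    (hw : w ∈ orthogonalIncrement P n) : inner ℝ v w = 0 := by
  cases n with
  | zero => omega
  | succ n =>
    exact hw.1 v (hP (Nat.lt_succ_iff.1 hmn) (orthogonalIncrement_le P m hv))

/-- A symmetric operator preserving a filtration by finite-dimensional subspaces has an
orthonormal family of eigenvectors adapted to the filtration. -/
theorem LinearMap.IsSymmetric.exists_adapted_eigenvectors {T : V →ₗ[ℝ] V} (hT : T.IsSymmetric)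
    {P : ℕ → Submodule ℝ V} (hP : Monotone P) (hfin : ∀ n, FiniteDimensional ℝ (P n))
    (hinv : ∀ n, ∀ v ∈ P n, T v ∈ P n) :
    ∃ s : Set V, (∀ p ∈ s, inner ℝ p p = 1) ∧ (∀ p ∈ s, ∀ q ∈ s, p ≠ q → inner ℝ p q = 0) ∧
      (∀ p ∈ s, ∃ c : ℝ, T p = c • p) ∧ ∀ n, P n ≤ Submodule.span ℝ {q | q ∈ s ∧ q ∈ P n} := by
  -- By symmetry, invariance of `P n` passes to its orthogonal complement, so the spectral theorem
  -- can be applied to each increment separately.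
  have hE : ∀ n, ∀ v ∈ orthogonalIncrement P n, T v ∈ orthogonalIncrement P n := by
    intro n v hv
    cases n with
    | zero => exact hinv 0 v hv
    | succ n =>
      refine ⟨fun u hu => ?_, hinv _ v hv.2⟩
      rw [← hT u v]
      exact hv.1 _ (hinv n u hu)
  have hEfin : ∀ n, FiniteDimensional ℝ (orthogonalIncrement P n) := fun n =>
    Submodule.finiteDimensional_of_le (orthogonalIncrement_le P n)
  have hsym : ∀ n, (T.restrict (hE n)).IsSymmetric := fun n => hT.restrict_invariant (hE n)
  let e := fun n => (hsym n).eigenvectorBasis rfl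
  refine ⟨{v | ∃ n i, v = e n i}, ?_, ?_, ?_, ?_⟩
  · rintro _ ⟨n, i, rfl⟩
    rw [← Submodule.coe_inner, real_inner_self_eq_norm_sq, (e n).norm_eq_one]
    norm_num
  · rintro _ ⟨n, i, rfl⟩ _ ⟨m, j, rfl⟩ hne
    rcases lt_trichotomy n m with h | h | h
    · exact inner_eq_zero_of_mem_orthogonalIncrement hP h (e n i).2 (e m j).2
    · subst h
      rw [← Submodule.coe_inner]
      exact (e n).inner_eq_zero fun h => hne (by rw [h])
    · rw [real_inner_comm]
      exact inner_eq_zero_of_mem_orthogonalIncrement hP h (e m j).2 (e n i).2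
  · rintro _ ⟨n, i, rfl⟩
    exact ⟨_, congrArg Subtype.val ((hsym n).apply_eigenvectorBasis rfl i)⟩
  · have hspan : ∀ n, orthogonalIncrement P n ≤
        Submodule.span ℝ {q | (∃ n i, q = (e n i : V)) ∧ q ∈ P n} := by
      intro n v hv
      have h1 := (e n).sum_repr ⟨v, hv⟩
      have h2 := congrArg Subtype.val h1
      simp only [Submodule.coe_sum, Submodule.coe_smul] at h2
      rw [← h2]
      exact Submodule.sum_mem _ fun i _ => Submodule.smul_mem _ _
        (Submodule.subset_span ⟨⟨n, i, rfl⟩, orthogonalIncrement_le P n (e n i).2⟩)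
    intro n
    induction n with
    | zero => exact hspan 0
    | succ n ih =>
      have h1 : P n ⊔ (P n)ᗮ ⊓ P (n + 1) = P (n + 1) :=
        Submodule.sup_orthogonal_inf_of_hasOrthogonalProjection (hP n.le_succ)
      conv_lhs => rw [← h1]
      refine sup_le (ih.trans (Submodule.span_mono fun q hq => ⟨hq.1, hP n.le_succ hq.2⟩)) ?_
      exact hspan (n + 1)

end SpectralTheorem

/-! ### Integrals against a density, and density of polynomials. -/

section Density

variable {d : ℕ} {Ω : Set (Fin d → ℝ)}

theorem IntegrableOn.mul_continuous (hΩ : IsOpen Ω) (hb : Bornology.IsBounded Ω)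
    {ρ f : (Fin d → ℝ) → ℝ} (hρ : IntegrableOn ρ Ω) (hf : Continuous f) :
    IntegrableOn (fun x => ρ x * f x) Ω :=
  hρ.mul_continuousOn_of_subset hf.continuousOn hΩ.measurableSet hb.isCompact_closure subset_closure

theorem aemeasurable_ofReal_of_continuousOn (hΩ : IsOpen Ω) {ρ : (Fin d → ℝ) → ℝ}
    (hρ : ContinuousOn ρ Ω) :
    AEMeasurable (fun x => ENNReal.ofReal (ρ x)) (volume.restrict Ω) :=
  (hρ.aemeasurable hΩ.measurableSet).ennreal_ofReal

theorem integral_withDensity_restrict (hΩ : IsOpen Ω) {ρ : (Fin d → ℝ) → ℝ}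
    (hρ : ContinuousOn ρ Ω) (hpos : ∀ x ∈ Ω, 0 < ρ x) (f : (Fin d → ℝ) → ℝ) :
    ∫ x, f x ∂((volume.restrict Ω).withDensity (fun x => ENNReal.ofReal (ρ x))) =
      ∫ x in Ω, ρ x * f x := by
  rw [integral_withDensity_eq_integral_toReal_smul₀ (aemeasurable_ofReal_of_continuousOn hΩ hρ)
    (Filter.Eventually.of_forall fun x => ENNReal.ofReal_lt_top)]
  refine setIntegral_congr_fun hΩ.measurableSet fun x hx => ?_
  simp [ENNReal.toReal_ofReal (hpos x hx).le]

theorem integrableOn_iff_withDensity_lt_top (hΩ : IsOpen Ω) {ρ : (Fin d → ℝ) → ℝ}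
    (hρ : ContinuousOn ρ Ω) (hpos : ∀ x ∈ Ω, 0 < ρ x) :
    IntegrableOn ρ Ω ↔
      (volume.restrict Ω).withDensity (fun x => ENNReal.ofReal (ρ x)) Set.univ < ⊤ := by
  rw [withDensity_apply _ MeasurableSet.univ, Measure.restrict_univ, IntegrableOn, Integrable,
    and_iff_right (hρ.aestronglyMeasurable hΩ.measurableSet), hasFiniteIntegral_iff_norm]
  rw [setLIntegral_congr_fun hΩ.measurableSet
    (g := fun x => ENNReal.ofReal (ρ x)) fun x hx => by rw [Real.norm_of_nonneg (hpos x hx).le]]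

theorem eqOn_zero_of_setIntegral_eq_zero (hΩ : IsOpen Ω) {F : (Fin d → ℝ) → ℝ}
    (hF : ContinuousOn F Ω) (hint : IntegrableOn F Ω) (hnn : ∀ x ∈ Ω, 0 ≤ F x)
    (h : ∫ x in Ω, F x = 0) : ∀ x ∈ Ω, F x = 0 := by
  rw [setIntegral_eq_zero_iff_of_nonneg_ae
    ((ae_restrict_iff' hΩ.measurableSet).2 (Filter.Eventually.of_forall hnn)) hint] at h
  exact Measure.eqOn_open_of_ae_eq h hΩ hF continuousOn_const

theorem ae_mem_of_withDensity_restrict (hΩ : IsOpen Ω) (f : (Fin d → ℝ) → ENNReal) :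
    ∀ᵐ x ∂((volume.restrict Ω).withDensity f), x ∈ Ω :=
  (withDensity_absolutelyContinuous _ _).ae_le (ae_restrict_mem hΩ.measurableSet)

theorem exists_eval_near_of_continuous {K : Set (Fin d → ℝ)} (hK : IsCompact K)
    {f : (Fin d → ℝ) → ℝ} (hf : Continuous f) {ε : ℝ} (hε : 0 < ε) :
    ∃ p : MvPolynomial (Fin d) ℝ, ∀ x ∈ K, |f x - MvPolynomial.eval x p| < ε := by
  have : CompactSpace K := isCompact_iff_compactSpace.1 hK
  let coord : Fin d → C(K, ℝ) := fun i => ⟨fun x => x.1 i, (continuous_apply i).comp continuous_subtype_val⟩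
  let φ : MvPolynomial (Fin d) ℝ →ₐ[ℝ] C(K, ℝ) := MvPolynomial.aeval coord
  have hφ : ∀ p (x : K), φ p x = MvPolynomial.eval x.1 p := by
    intro p x
    induction p using MvPolynomial.induction_on with
    | C c => simp [φ]
    | add p q hp hq => simp [hp, hq]
    | mul_X p i hp => simp [hp]; left; simp [φ, coord]
  have hsep : φ.range.SeparatesPoints := by
    intro x y hxy
    have : ∃ i, x.1 i ≠ y.1 i := by
      by_contra! h
      exact hxy (Subtype.ext (funext h))
    obtain ⟨i, hi⟩ := this
    exact ⟨φ (MvPolynomial.X i), ⟨φ (MvPolynomial.X i), ⟨_, rfl⟩, rfl⟩, by simpa [hφ] using hi⟩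
  obtain ⟨⟨_, p, rfl⟩, hg⟩ := ContinuousMap.exists_mem_subalgebra_near_continuous_of_separatesPoints
    φ.range hsep (fun x : K => f x.1) (hf.comp continuous_subtype_val) ε hε
  refine ⟨p, fun x hx => ?_⟩
  have := hg ⟨x, hx⟩
  rw [abs_sub_comm, ← Real.norm_eq_abs]
  convert! this using 3
  exact (hφ p ⟨x, hx⟩).symm

/-- Compactly supported continuous functions are dense in `L²(μ)`. As `Ω` is bounded,
Stone–Weierstrass on its closure approximates them uniformly, and `μ` has mass one. -/
theorem exists_eval_eLpNorm_sub_le (hb : Bornology.IsBounded Ω) {μ : Measure (Fin d → ℝ)}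
    [IsProbabilityMeasure μ] (hμ : ∀ᵐ x ∂μ, x ∈ Ω) {f : (Fin d → ℝ) → ℝ} (hf : MemLp f 2 μ)
    {ε : ℝ} (hε : 0 < ε) : ∃ p : MvPolynomial (Fin d) ℝ,
      eLpNorm (fun x => f x - MvPolynomial.eval x p) 2 μ ≤ ENNReal.ofReal ε := by
  obtain ⟨g, -, hgL, hgc, -⟩ := hf.exists_hasCompactSupport_eLpNorm_sub_le (by norm_num)
    (ε := ENNReal.ofReal (ε / 2)) (by simpa using hε)
  obtain ⟨p, hp⟩ := exists_eval_near_of_continuous hb.isCompact_closure hgc (half_pos hε)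
  refine ⟨p, ?_⟩
  have h1 : (fun x => f x - MvPolynomial.eval x p) =
      (f - g) + fun x => g x - MvPolynomial.eval x p := by
    ext x; simp
  have hgp : Continuous fun x => g x - MvPolynomial.eval x p := hgc.sub (continuous_eval p)
  have h2 : eLpNorm (fun x => g x - MvPolynomial.eval x p) 2 μ ≤ ENNReal.ofReal (ε / 2) := by
    have := eLpNorm_le_of_ae_bound (p := 2) (μ := μ) (f := fun x => g x - MvPolynomial.eval x p)
      (C := ε / 2) (hμ.mono fun x hx => (hp x (subset_closure hx)).le)
    simpa using this
  rw [h1]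
  refine (eLpNorm_add_le (hf.1.sub hgc.aestronglyMeasurable) hgp.aestronglyMeasurable
    (by norm_num)).trans ?_
  refine (add_le_add hgL h2).trans ?_
  rw [← ENNReal.ofReal_add (half_pos hε).le (half_pos hε).le, add_halves]

end Density

/-! ### The operator on polynomials and on test functions. -/

section Generator

variable {d : ℕ} {G : Matrix (Fin d) (Fin d) (MvPolynomial (Fin d) ℝ)}
  {Q : MvPolynomial (Fin d) ℝ} {L N : Fin d → MvPolynomial (Fin d) ℝ} {Ω : Set (Fin d → ℝ)}

open MvPolynomial (pderiv eval)

/-- The operator `∑ g^{ij} ∂²_{ij} + ∑ b^i ∂_i` on polynomials. -/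
noncomputable def polyGenerator (G : Matrix (Fin d) (Fin d) (MvPolynomial (Fin d) ℝ))
    (β : Fin d → MvPolynomial (Fin d) ℝ) :
    MvPolynomial (Fin d) ℝ →ₗ[ℝ] MvPolynomial (Fin d) ℝ where
  toFun p := (∑ i, ∑ j, G i j * pderiv i (pderiv j p)) + ∑ i, β i * pderiv i p
  map_add' p q := by
    simp only [map_add, mul_add, Finset.sum_add_distrib]
    ring
  map_smul' c p := by
    simp only [Derivation.map_smul, mul_smul_comm, Finset.smul_sum, smul_add, RingHom.id_apply]

/-- The bilinear form `∑ g^{ij} ∂_i p ∂_j q` on polynomials. -/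
noncomputable def polyGamma (G : Matrix (Fin d) (Fin d) (MvPolynomial (Fin d) ℝ))
    (p q : MvPolynomial (Fin d) ℝ) : MvPolynomial (Fin d) ℝ :=
  ∑ i, ∑ j, G i j * (pderiv i p * pderiv j q)

theorem polyGamma_comm (hG : G.IsSymm) (p q : MvPolynomial (Fin d) ℝ) :
    polyGamma G p q = polyGamma G q p := by
  rw [polyGamma, polyGamma, Finset.sum_comm]
  refine Finset.sum_congr rfl fun i _ => Finset.sum_congr rfl fun j _ => ?_
  rw [hG.apply, mul_comm (pderiv j p)]

theorem eval_polyGenerator (β : Fin d → MvPolynomial (Fin d) ℝ) (p : MvPolynomial (Fin d) ℝ)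
    (x : Fin d → ℝ) : eval x (polyGenerator G β p) =
      diffusionOp (evalMetric G) (fun y i => eval y (β i)) (fun y => eval y p) x := by
  rw [diffusionOp_eval]
  simp [polyGenerator, evalMetric]

theorem polyGenerator_mem {a : Fin d → ℕ} {β : Fin d → MvPolynomial (Fin d) ℝ}
    (hG : ∀ i j, G i j ∈ weightedDegreeLE a (a i + a j)) (hβ : ∀ i, β i ∈ weightedDegreeLE a (a i))
    {n : ℕ} {p : MvPolynomial (Fin d) ℝ} (hp : p ∈ weightedDegreeLE a n) :
    polyGenerator G β p ∈ weightedDegreeLE a n := by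
  refine Submodule.add_mem _ (Submodule.sum_mem _ fun i _ => Submodule.sum_mem _ fun j _ => ?_)
    (Submodule.sum_mem _ fun i _ => ?_)
  · by_cases h : pderiv i (pderiv j p) = 0
    · rw [h, mul_zero]; exact Submodule.zero_mem _
    · have h0 : pderiv j p ≠ 0 := fun h0 => h (by rw [h0, map_zero])
      have h1 := weightedTotalDegree_pderiv a i h
      have h2 := weightedTotalDegree_pderiv a j h0
      have h3 := weightedTotalDegree_mul_le a (G i j) (pderiv i (pderiv j p))
      have h4 := hG i j
      rw [mem_weightedDegreeLE] at *
      omega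
  · simpa using mul_pderiv_mem a (k := 0) (by simpa using hβ i) hp

/-- Integration by parts for a polynomial vector field that is tangent to the boundary. -/
theorem integral_mul_divergence_eq_zero (hΩ : IsOpen Ω) (hb : Bornology.IsBounded Ω)
    (hQ0 : ∀ x ∈ frontier Ω, eval x Q = 0) (hQ1 : ∀ x ∈ Ω, eval x Q ≠ 0)
    {ρ : (Fin d → ℝ) → ℝ} (hρ : ContDiffOn ℝ 1 ρ Ω) (hint : IntegrableOn ρ Ω)
    {V : Fin d → MvPolynomial (Fin d) ℝ} {M K : MvPolynomial (Fin d) ℝ}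
    (hM : ∑ i, V i * pderiv i Q = M * Q)
    (hK : ∀ x ∈ Ω, ∑ i, eval x (V i) * partialD i ρ x = eval x K * ρ x) :
    ∫ x in Ω, ρ x * eval x (∑ i, pderiv i (V i) + K) = 0 := by
  have hdiv : ∀ x ∈ Ω, ∑ i, partialD i (fun y => ρ y * eval y (V i)) x =
      ρ x * eval x (∑ i, pderiv i (V i) + K) := by
    intro x hx
    have hd := (hρ.contDiffAt (hΩ.mem_nhds hx)).differentiableAt (by norm_num)
    simp only [partialD_mul hd (hasFDerivAt_eval _ x).differentiableAt, partialD_eval,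
      Finset.sum_add_distrib, map_add, map_sum, mul_add, Finset.mul_sum]
    rw [mul_comm (ρ x) (eval x K), ← hK x hx]
    simp only [mul_comm]
  rw [← setIntegral_congr_fun hΩ.measurableSet hdiv]
  refine integral_divergence_eq_zero hΩ hb hQ0 hQ1
    (fun i => hρ.mul (contDiff_eval (V i)).contDiffOn) ?_
    (IntegrableOn.mul_continuous hΩ hb hint (continuous_eval M)).abs fun x hx => ?_
  · exact (integrableOn_congr_fun hdiv hΩ.measurableSet).2
      (IntegrableOn.mul_continuous hΩ hb hint (continuous_eval _))
  · rw [← abs_mul, mul_assoc, ← map_mul, ← hM, map_sum, Finset.mul_sum]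
    simp only [map_mul, mul_assoc, le_refl]

/-- Green's formula without boundary term. Here `N` is `g∇ log ρ`, so the drift is the one that
makes `ρ(q Lp + Γ(p,q))` the divergence of `ρ q g∇p`, a field tangent to the boundary by `g∇Q = LQ`.
-/
theorem integral_mul_polyGenerator (hΩ : IsOpen Ω) (hb : Bornology.IsBounded Ω)
    (hQ0 : ∀ x ∈ frontier Ω, eval x Q = 0) (hQ1 : ∀ x ∈ Ω, eval x Q ≠ 0) (hG : G.IsSymm)
    (hL : ∀ i, ∑ j, G i j * pderiv j Q = L i * Q)
    {ρ : (Fin d → ℝ) → ℝ} (hρ : ContDiffOn ℝ 1 ρ Ω) (hint : IntegrableOn ρ Ω)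
    (hN : ∀ i, ∀ x ∈ Ω, ∑ j, eval x (G i j) * partialD j ρ x = eval x (N i) * ρ x)
    (p q : MvPolynomial (Fin d) ℝ) :
    ∫ x in Ω, ρ x * eval x (q * polyGenerator G (fun i => ∑ j, pderiv j (G i j) + N i) p +
      polyGamma G p q) = 0 := by
  have hsw : ∀ F : Fin d → Fin d → MvPolynomial (Fin d) ℝ,
      ∑ i, ∑ j, G i j * F i j = ∑ i, ∑ j, G i j * F j i := by
    intro F
    rw [Finset.sum_comm]
    exact Finset.sum_congr rfl fun i _ => Finset.sum_congr rfl fun j _ => by rw [hG.apply]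
  have h := integral_mul_divergence_eq_zero hΩ hb hQ0 hQ1 hρ hint
    (V := fun i => ∑ j, G i j * (q * pderiv j p)) (M := ∑ j, q * pderiv j p * L j)
    (K := ∑ j, q * pderiv j p * N j) ?_ ?_
  · convert h using 4
    simp only [polyGenerator, polyGamma, LinearMap.coe_mk, AddHom.coe_mk, map_sum,
      Derivation.leibniz, smul_eq_mul]
    simp only [Finset.mul_sum, Finset.sum_mul, mul_add, add_mul, Finset.sum_add_distrib]
    have e1 : ∑ i, ∑ j, q * (pderiv j (G i j) * pderiv i p) =
        ∑ i, ∑ j, q * pderiv j p * pderiv i (G i j) := by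
      rw [Finset.sum_comm]
      refine Finset.sum_congr rfl fun i _ => Finset.sum_congr rfl fun j _ => ?_
      rw [hG.apply]; ring
    have e2 : ∑ i, ∑ j, G i j * (pderiv i p * pderiv j q) =
        ∑ i, ∑ j, G i j * (pderiv j p * pderiv i q) := hsw fun i j => pderiv i p * pderiv j q
    rw [e1, e2]
    simp only [mul_comm, mul_left_comm]
    ring_nf
  · simp only [Finset.sum_mul, mul_assoc]
    rw [Finset.sum_comm]
    refine Finset.sum_congr rfl fun j _ => ?_
    rw [← hL, Finset.mul_sum, Finset.mul_sum]
    refine Finset.sum_congr rfl fun i _ => ?_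
    rw [hG.apply]; ring
  · intro x hx
    simp only [map_sum, map_mul, Finset.sum_mul, mul_assoc]
    rw [Finset.sum_comm]
    refine Finset.sum_congr rfl fun j _ => ?_
    rw [← hN j x hx, Finset.mul_sum, Finset.mul_sum]
    refine Finset.sum_congr rfl fun i _ => ?_
    rw [hG.apply]; ring

theorem integral_polyGenerator_mul_eq (hΩ : IsOpen Ω) (hb : Bornology.IsBounded Ω)
    (hQ0 : ∀ x ∈ frontier Ω, eval x Q = 0) (hQ1 : ∀ x ∈ Ω, eval x Q ≠ 0) (hG : G.IsSymm)
    (hL : ∀ i, ∑ j, G i j * pderiv j Q = L i * Q)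
    {ρ : (Fin d → ℝ) → ℝ} (hρ : ContDiffOn ℝ 1 ρ Ω) (hint : IntegrableOn ρ Ω)
    (hN : ∀ i, ∀ x ∈ Ω, ∑ j, eval x (G i j) * partialD j ρ x = eval x (N i) * ρ x)
    (p q : MvPolynomial (Fin d) ℝ) :
    ∫ x in Ω, ρ x * (eval x (polyGenerator G (fun i => ∑ j, pderiv j (G i j) + N i) p) *
      eval x q) = ∫ x in Ω, ρ x * (eval x p *
        eval x (polyGenerator G (fun i => ∑ j, pderiv j (G i j) + N i) q)) := by
  have h1 := integral_mul_polyGenerator hΩ hb hQ0 hQ1 hG hL hρ hint hN p q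
  have h2 := integral_mul_polyGenerator hΩ hb hQ0 hQ1 hG hL hρ hint hN q p
  have hi := fun p => IntegrableOn.mul_continuous hΩ hb hint (continuous_eval p)
  simp only [map_add, mul_add] at h1 h2
  rw [integral_add (hi _) (hi _)] at h1 h2
  rw [polyGamma_comm hG q p] at h2
  simp only [map_mul] at h1 h2
  simp only [mul_comm (eval _ (polyGenerator _ _ p))]
  linarith

theorem symmetricDrift_eq (hΩ : IsOpen Ω) {ρ : (Fin d → ℝ) → ℝ} (hρ : ContDiffOn ℝ 1 ρ Ω)
    (hpos : ∀ x ∈ Ω, 0 < ρ x)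
    (hN : ∀ i, ∀ x ∈ Ω, ∑ j, eval x (G i j) * partialD j ρ x = eval x (N i) * ρ x)
    {x : Fin d → ℝ} (hx : x ∈ Ω) (i : Fin d) :
    symmetricDrift (evalMetric G) ρ x i = eval x (∑ j, pderiv j (G i j) + N i) := by
  have hd := (hρ.contDiffAt (hΩ.mem_nhds hx)).differentiableAt (by norm_num)
  have hx0 := (hpos x hx).ne'
  have : ∑ j, partialD j (fun y => ρ y * evalMetric G y i j) x =
      ρ x * eval x (∑ j, pderiv j (G i j) + N i) := by
    simp only [evalMetric, Matrix.map_apply,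
      partialD_mul hd (hasFDerivAt_eval _ x).differentiableAt, partialD_eval,
      Finset.sum_add_distrib, map_add, map_sum, mul_add, Finset.mul_sum]
    rw [mul_comm (ρ x) (eval x (N i)), ← hN i x hx]
    simp only [mul_comm]
  rw [symmetricDrift, this, inv_mul_cancel_left₀ hx0]

theorem contDiff_partialD {f : (Fin d → ℝ) → ℝ} (hf : ContDiff ℝ ∞ f) (i : Fin d) :
    ContDiff ℝ ∞ (partialD i f) :=
  (hf.fderiv_right (m := ∞) (by simp)).clm_apply contDiff_const

/-- `ρ(h Lf - f Lh)` is the divergence of `ρ g(h∇f - f∇h)`, which has compact support in `Ω`; so the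
boundary equation plays no part. -/
theorem integral_diffusionOp_mul_eq (hΩ : IsOpen Ω) (hG : G.IsSymm)
    {ρ : (Fin d → ℝ) → ℝ} (hρ : ContDiffOn ℝ 1 ρ Ω)
    (hN : ∀ i, ∀ x ∈ Ω, ∑ j, eval x (G i j) * partialD j ρ x = eval x (N i) * ρ x)
    {b : (Fin d → ℝ) → Fin d → ℝ}
    (hbeq : ∀ x ∈ Ω, ∀ i, b x i = eval x (∑ j, pderiv j (G i j) + N i))
    {f h : (Fin d → ℝ) → ℝ} (hf : ContDiff ℝ ∞ f) (hfc : HasCompactSupport f)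
    (hfΩ : tsupport f ⊆ Ω) (hh : ContDiff ℝ ∞ h) :
    ∫ x in Ω, ρ x * (diffusionOp (evalMetric G) b f x * h x) =
      ∫ x in Ω, ρ x * (f x * diffusionOp (evalMetric G) b h x) := by
  -- `b` is prescribed on `Ω` only; its polynomial extension is continuous everywhere.
  set b' : (Fin d → ℝ) → Fin d → ℝ := fun x i => eval x (∑ j, pderiv j (G i j) + N i) with hb'
  have hop : ∀ u : (Fin d → ℝ) → ℝ, ∀ x ∈ Ω, diffusionOp (evalMetric G) b u x =
      diffusionOp (evalMetric G) b' u x := by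
    intro u x hx
    simp only [diffusionOp, hbeq x hx, hb']
  have hcont : ∀ u : (Fin d → ℝ) → ℝ, ContDiff ℝ ∞ u →
      Continuous (diffusionOp (evalMetric G) b' u) := by
    intro u hu
    unfold diffusionOp
    refine (continuous_finsetSum _ fun i _ => continuous_finsetSum _ fun j _ => ?_).add
      (continuous_finsetSum _ fun i _ => ?_)
    · exact (continuous_eval (G i j)).mul (contDiff_partialD (contDiff_partialD hu j) i).continuous
    · exact (continuous_eval _).mul (contDiff_partialD hu i).continuous
  have hf0 : ∀ x, x ∉ tsupport f → f x = 0 := fun x hx => image_eq_zero_of_notMem_tsupport hx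
  have hfd0 : ∀ i, ∀ x, x ∉ tsupport f → partialD i f x = 0 := by
    intro i x hx
    have h1 : f =ᶠ[𝓝 x] fun _ => 0 := notMem_tsupport_iff_eventuallyEq.1 hx
    rw [h1.partialD_eq, partialD]; simp
  have hfdd0 : ∀ i j, ∀ x, x ∉ tsupport f → partialD i (partialD j f) x = 0 := by
    intro i j x hx
    have h1 : partialD j f =ᶠ[𝓝 x] fun _ => 0 := by
      filter_upwards [(isClosed_tsupport f).isOpen_compl.mem_nhds hx] with y hy using hfd0 j y hy
    rw [h1.partialD_eq, partialD]; simp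
  have hint : ∀ F : (Fin d → ℝ) → ℝ, Continuous F → (∀ x, x ∉ tsupport f → F x = 0) →
      IntegrableOn (fun x => ρ x * F x) Ω := by
    intro F hF h0
    have h1 := contDiff_indicator_of_isCompact (n := 0) hΩ hfc hfΩ
      (f := fun x => ρ x * F x) (contDiffOn_zero.2 (hρ.continuousOn.mul hF.continuousOn))
      (fun x _ hx => by simp [h0 x hx])
    have h2 := hasCompactSupport_indicator_of_isCompact (Ω := Ω) hfc
      (f := fun x => ρ x * F x) (fun x _ hx => by simp [h0 x hx])
    exact (integrable_indicator_iff hΩ.measurableSet).1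
      (h1.continuous.integrable_of_hasCompactSupport h2)
  rw [setIntegral_congr_fun hΩ.measurableSet
      (g := fun x => ρ x * (diffusionOp (evalMetric G) b' f x * h x))
      (fun x hx => by simp only [hop f x hx]),
    setIntegral_congr_fun hΩ.measurableSet
      (f := fun x => ρ x * (f x * diffusionOp (evalMetric G) b h x))
      (g := fun x => ρ x * (f x * diffusionOp (evalMetric G) b' h x))
      (fun x hx => by simp only [hop h x hx]), ← sub_eq_zero, ← integral_sub]
  · have hG' : ∀ x i j, eval x (G i j) = eval x (G j i) := fun x i j => by rw [hG.apply]
    have hdf : ∀ {u : (Fin d → ℝ) → ℝ}, ContDiff ℝ ∞ u → ∀ x, DifferentiableAt ℝ u x :=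
      fun hu x => (hu.differentiable (by simp)).differentiableAt
    have hWs : ∀ j, ContDiff ℝ ∞ (fun x => h x * partialD j f x - f x * partialD j h x) := fun j =>
      (hh.mul (contDiff_partialD hf j)).sub (hf.mul (contDiff_partialD hh j))
    have hsub : ∀ i j x, partialD i (fun x => h x * partialD j f x - f x * partialD j h x) x =
        h x * partialD i (partialD j f) x + partialD i h x * partialD j f x -
        (f x * partialD i (partialD j h) x + partialD i f x * partialD j h x) := by
      intro i j x
      rw [← partialD_mul (hdf hh x) (hdf (contDiff_partialD hf j) x),
        ← partialD_mul (hdf hf x) (hdf (contDiff_partialD hh j) x)]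
      exact partialD_sub (hdf (hh.mul (contDiff_partialD hf j)) x)
        (hdf (hf.mul (contDiff_partialD hh j)) x) i
    have key := integral_divergence_eq_zero_of_isCompact hΩ hfc hfΩ
      (W := fun i x => ∑ j, (ρ x * eval x (G i j)) *
        (h x * partialD j f x - f x * partialD j h x))
      (fun i => ContDiffOn.sum fun j _ => (hρ.mul (contDiff_eval (G i j)).contDiffOn).mul
        ((hWs j).of_le (by simp)).contDiffOn)
      (fun i x _ hx => Finset.sum_eq_zero fun j _ => by simp [hf0 x hx, hfd0 j x hx])
    rw [← key]
    refine setIntegral_congr_fun hΩ.measurableSet fun x hx => ?_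
    have hd := (hρ.contDiffAt (hΩ.mem_nhds hx)).differentiableAt (by norm_num)
    have hd2 : ∀ i j, DifferentiableAt ℝ (fun y => ρ y * eval y (G i j)) x := fun i j =>
      hd.mul (hasFDerivAt_eval _ x).differentiableAt
    have hdrift : ∀ j, ∑ i, partialD i (fun y => ρ y * eval y (G i j)) x = ρ x * b' x j := by
      intro j
      simp only [partialD_mul hd (hasFDerivAt_eval _ x).differentiableAt, partialD_eval,
        Finset.sum_add_distrib, hb', map_add, map_sum, mul_add, Finset.mul_sum]
      rw [mul_comm (ρ x) (eval x (N j)), ← hN j x hx]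
      refine congrArg₂ _ (Finset.sum_congr rfl fun i _ => ?_) (Finset.sum_congr rfl fun i _ => ?_)
      · rw [hG.apply]
      · rw [hG', mul_comm]
    have e1 : ∀ i, partialD i (fun x => ∑ j, (ρ x * eval x (G i j)) *
        (h x * partialD j f x - f x * partialD j h x)) x =
        ∑ j, (ρ x * eval x (G i j) * (h x * partialD i (partialD j f) x +
          partialD i h x * partialD j f x -
          (f x * partialD i (partialD j h) x + partialD i f x * partialD j h x)) +
          partialD i (fun y => ρ y * eval y (G i j)) x *
            (h x * partialD j f x - f x * partialD j h x)) := by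
      intro i
      rw [partialD_sum (f := fun j x => (ρ x * eval x (G i j)) *
        (h x * partialD j f x - f x * partialD j h x)) _ fun j _ => (hd2 i j).mul (hdf (hWs j) x)]
      refine Finset.sum_congr rfl fun j _ => ?_
      rw [partialD_mul (hd2 i j) (hdf (hWs j) x), hsub]
    simp only [e1, Finset.sum_add_distrib]
    rw [Finset.sum_comm (f := fun i j => partialD i (fun y => ρ y * eval y (G i j)) x *
            (h x * partialD j f x - f x * partialD j h x))]
    simp only [← Finset.sum_mul, hdrift]
    have e2 : ∑ i, ∑ j, ρ x * eval x (G i j) * (partialD i h x * partialD j f x) =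
        ∑ i, ∑ j, ρ x * eval x (G i j) * (partialD i f x * partialD j h x) := by
      rw [Finset.sum_comm]
      refine Finset.sum_congr rfl fun i _ => Finset.sum_congr rfl fun j _ => ?_
      rw [hG']; ring
    simp only [mul_sub, mul_add, Finset.sum_add_distrib, Finset.sum_sub_distrib, e2, diffusionOp,
      evalMetric, Matrix.map_apply, Finset.mul_sum, Finset.sum_mul, add_mul]
    simp only [mul_comm, mul_left_comm, mul_assoc]
    ring
  · exact hint _ ((hcont f hf).mul hh.continuous) fun x hx => by
      simp [diffusionOp, hfd0 _ x hx, hfdd0 _ _ x hx]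
  · exact hint _ (hf.continuous.mul (hcont h hh)) fun x hx => by simp [hf0 x hx]

end Generator

/-! ### Construction of polynomial models. -/

section Model

variable {d : ℕ} {a : Fin d → ℕ} {G : Matrix (Fin d) (Fin d) (MvPolynomial (Fin d) ℝ)}
  {Q : MvPolynomial (Fin d) ℝ} {L N : Fin d → MvPolynomial (Fin d) ℝ} {Ω : Set (Fin d → ℝ)}

open MvPolynomial (pderiv eval)

theorem eq_zero_of_integral_mul_sq_eq_zero (hΩ : IsOpen Ω) (hne : Ω.Nonempty)
    (hb : Bornology.IsBounded Ω) {ρ : (Fin d → ℝ) → ℝ} (hρ : ContinuousOn ρ Ω)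
    (hpos : ∀ x ∈ Ω, 0 < ρ x) (hint : IntegrableOn ρ Ω) {p : MvPolynomial (Fin d) ℝ}
    (h : ∫ x in Ω, ρ x * (eval x p * eval x p) = 0) : p = 0 := by
  have hi := IntegrableOn.mul_continuous hΩ hb hint (continuous_eval (p * p))
  simp only [map_mul] at hi
  refine eq_zero_of_eval_eq_zero_of_isOpen hΩ hne fun x hx => ?_
  have := eqOn_zero_of_setIntegral_eq_zero hΩ
    (hρ.mul ((continuous_eval p).mul (continuous_eval p)).continuousOn) hi
    (fun x hx => mul_nonneg (hpos x hx).le (mul_self_nonneg _)) h x hx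
  simpa [(hpos x hx).ne'] using this

/-- The `L²(ρ dx)` inner product on polynomials. -/
noncomputable abbrev polynomialInnerCore (hΩ : IsOpen Ω) (hne : Ω.Nonempty)
    (hb : Bornology.IsBounded Ω) {ρ : (Fin d → ℝ) → ℝ} (hρ : ContinuousOn ρ Ω)
    (hpos : ∀ x ∈ Ω, 0 < ρ x) (hint : IntegrableOn ρ Ω) :
    InnerProductSpace.Core ℝ (MvPolynomial (Fin d) ℝ) where
  inner p q := ∫ x in Ω, ρ x * (eval x p * eval x q)
  conj_inner_symm p q := by
    simp only [conj_trivial]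
    simp only [mul_comm]
  re_inner_nonneg p := by
    refine setIntegral_nonneg hΩ.measurableSet fun x hx => ?_
    exact mul_nonneg (hpos x hx).le (mul_self_nonneg _)
  add_left p q r := by
    have h := fun p q => IntegrableOn.mul_continuous hΩ hb hint (continuous_eval (p * q))
    simp only [map_mul] at h
    rw [← integral_add (h p r) (h q r)]
    simp only [map_add, add_mul, mul_add]
  smul_left p q c := by
    rw [conj_trivial, ← integral_const_mul]
    simp only [MvPolynomial.smul_eval]
    congr 1
    ext x
    ring
  definite p h := eq_zero_of_integral_mul_sq_eq_zero hΩ hne hb hρ hpos hint h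

/-- A density solving the boundary equations defines a polynomial model. -/
theorem isPolynomialModel_of_density (ha : ∀ i, 0 < a i) (hΩ : IsOpen Ω) (hne : Ω.Nonempty)
    (hb : Bornology.IsBounded Ω)
    (hQ0 : ∀ x ∈ frontier Ω, eval x Q = 0) (hQ1 : ∀ x ∈ Ω, eval x Q ≠ 0)
    (hS : SolvesBoundaryEquation a Ω Q G L)
    {ρ : (Fin d → ℝ) → ℝ} (hρ : ContDiffOn ℝ ∞ ρ Ω) (hpos : ∀ x ∈ Ω, 0 < ρ x)
    (hprob : IsProbabilityMeasure
      ((volume.restrict Ω).withDensity (fun x => ENNReal.ofReal (ρ x))))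
    (hNd : ∀ i, N i ∈ weightedDegreeLE a (a i))
    (hN : ∀ i, ∀ x ∈ Ω, ∑ j, eval x (G i j) * partialD j ρ x = eval x (N i) * ρ x) :
    IsPolynomialModel a Ω (evalMetric G) (symmetricDrift (evalMetric G) ρ)
      ((volume.restrict Ω).withDensity (fun x => ENNReal.ofReal (ρ x))) := by
  have hint : IntegrableOn ρ Ω :=
    (integrableOn_iff_withDensity_lt_top hΩ hρ.continuousOn hpos).2 (measure_lt_top _ _)
  have hρ1 : ContDiffOn ℝ 1 ρ Ω := hρ.of_le (by simp)
  have hdrift := fun x hx i => symmetricDrift_eq (G := G) (x := x) hΩ hρ1 hpos hN hx i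
  have hI := integral_withDensity_restrict hΩ hρ.continuousOn hpos
  refine ⟨fun i j => (contDiff_eval (G i j)).contDiffOn, fun i => ?_, hS.posDef, hprob,
    ⟨ρ, hρ, hpos, rfl⟩, fun f hf ε hε => ?_, fun f h hf hfc hfΩ hh _ _ => ?_, ?_⟩
  · exact (contDiff_eval (∑ j, pderiv j (G i j) + N i)).contDiffOn.congr fun x hx => hdrift x hx i
  · exact exists_eval_eLpNorm_sub_le hb (ae_mem_of_withDensity_restrict hΩ _) hf hε
  · rw [hI, hI]
    exact integral_diffusionOp_mul_eq hΩ hS.isSymm hρ1 hN hdrift hf hfc hfΩ hh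
  -- The polynomials themselves carry the `L²(ρ dx)` inner product: a polynomial of norm zero
  -- vanishes on the open set `Ω`.
  · let core := polynomialInnerCore hΩ hne hb hρ.continuousOn hpos hint
    let _ : NormedAddCommGroup (MvPolynomial (Fin d) ℝ) := core.toNormedAddCommGroup
    let _ : InnerProductSpace ℝ (MvPolynomial (Fin d) ℝ) := InnerProductSpace.ofCore core.toCore
    have hinner : ∀ p q : MvPolynomial (Fin d) ℝ,
        inner ℝ p q = ∫ x in Ω, ρ x * (eval x p * eval x q) := fun p q => rfl
    set β : Fin d → MvPolynomial (Fin d) ℝ := fun i => ∑ j, pderiv j (G i j) + N i with hβ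
    have hsym : (polyGenerator G β).IsSymmetric := fun p q => by
      rw [hinner, hinner]
      exact integral_polyGenerator_mul_eq hΩ hb hQ0 hQ1 hS.isSymm hS.equation hρ1 hint hN p q
    have hβd : ∀ i, β i ∈ weightedDegreeLE a (a i) := fun i =>
      Submodule.add_mem _ (Submodule.sum_mem _ fun j _ => pderiv_mem a (hS.degree_metric i j))
        (hNd i)
    obtain ⟨s, h1, h2, h3, h4⟩ := hsym.exists_adapted_eigenvectors
      (P := weightedDegreeLE a) (fun m n h => weightedDegreeLE_mono a h)
      (finiteDimensional_weightedDegreeLE ha) fun n p hp => polyGenerator_mem hS.degree_metric hβd hp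
    refine ⟨s, fun p hp => ?_, fun p hp q hq hpq => ?_, fun p hp => ?_, fun n p hp => h4 n hp⟩
    · rw [hI, ← hinner, h1 p hp]
    · rw [hI, ← hinner, h2 p hp q hq hpq]
    · obtain ⟨c, hc⟩ := h3 p hp
      -- Models write the eigenvalue equation as `Lp = -c p`.
      refine ⟨-c, fun x hx => ?_⟩
      have := eval_polyGenerator (G := G) β p x
      rw [hc, MvPolynomial.smul_eval, diffusionOp_eval] at this
      rw [diffusionOp_eval, neg_neg, this]
      simp only [hdrift x hx, hβ]

end Model

/-! ### The reduced equation, its factors and the determinant. -/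

section ReducedEquation

variable {d : ℕ} {a : Fin d → ℕ} {G : Matrix (Fin d) (Fin d) (MvPolynomial (Fin d) ℝ)}
  {Q : MvPolynomial (Fin d) ℝ} {L : Fin d → MvPolynomial (Fin d) ℝ} {Ω : Set (Fin d → ℝ)}
  {m : ℕ} {q : Fin m → MvPolynomial (Fin d) ℝ}

open MvPolynomial (pderiv eval)

theorem mem_vanishingIdeal_frontier {p : MvPolynomial (Fin d) ℝ} :
    p ∈ MvPolynomial.vanishingIdeal ℝ (frontier Ω) ↔ ∀ x ∈ frontier Ω, eval x p = 0 := by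
  simp [MvPolynomial.mem_vanishingIdeal_iff, MvPolynomial.aeval_eq_eval]

theorem IsReducedBoundaryEquation.dvd_iff (hQ : IsReducedBoundaryEquation Ω Q)
    {p : MvPolynomial (Fin d) ℝ} : Q ∣ p ↔ ∀ x ∈ frontier Ω, eval x p = 0 := by
  rw [← mem_vanishingIdeal_frontier, hQ.2, Ideal.mem_span_singleton]

theorem IsReducedBoundaryEquation.eval_eq_zero (hQ : IsReducedBoundaryEquation Ω Q)
    {x : Fin d → ℝ} (hx : x ∈ frontier Ω) : eval x Q = 0 :=
  hQ.dvd_iff.1 dvd_rfl x hx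

theorem IsReducedBoundaryEquation.of_associated (hQ : IsReducedBoundaryEquation Ω Q)
    {P : MvPolynomial (Fin d) ℝ} (h : Associated P Q) : IsReducedBoundaryEquation Ω P :=
  ⟨h.ne_zero_iff.2 hQ.1, by rw [hQ.2, Ideal.span_singleton_eq_span_singleton]; exact h.symm⟩

theorem exists_eq_C_of_pderiv_eq_zero {p : MvPolynomial (Fin d) ℝ}
    (h : ∀ j, pderiv j p = 0) : ∃ c : ℝ, p = MvPolynomial.C c := by
  refine ⟨p.coeff 0, ?_⟩
  ext n
  rw [MvPolynomial.coeff_C]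
  split_ifs with hn
  · rw [hn]
  · obtain ⟨j, hj⟩ : ∃ j, n j ≠ 0 := by
      by_contra! h0
      exact hn (Finsupp.ext h0).symm
    have h1 := congrArg (MvPolynomial.coeff (n - Finsupp.single j 1)) (h j)
    have hle : Finsupp.single j 1 ≤ n := by
      rw [Finsupp.single_le_iff]; omega
    rw [MvPolynomial.coeff_pderiv, tsub_add_cancel_of_le hle, MvPolynomial.coeff_zero] at h1
    rcases mul_eq_zero.1 h1 with h2 | h2
    · exact h2
    · exfalso
      have : (0 : ℝ) ≤ (((n - Finsupp.single j 1 : Fin d →₀ ℕ) j : ℕ) : ℝ) := Nat.cast_nonneg _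
      linarith

/-- Differentiation lowers the degree, so a derivative divisible by `p` is zero; if all derivatives
were zero, `p` would be constant in characteristic zero. -/
theorem exists_not_dvd_pderiv {p : MvPolynomial (Fin d) ℝ} (hp : Irreducible p) :
    ∃ j, ¬ p ∣ pderiv j p := by
  by_contra! h
  have h0 : ∀ j, pderiv j p = 0 := by
    intro j
    by_contra hne
    obtain ⟨c, hc⟩ := h j
    have h1 := weightedTotalDegree_pderiv (fun _ => 1) j hne
    have h2 := weightedTotalDegree_mul (fun _ => 1) hp.ne_zero
      (q := c) (fun hc0 => hne (by rw [hc, hc0, mul_zero]))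
    rw [hc, h2] at h1
    omega
  obtain ⟨c, rfl⟩ := exists_eq_C_of_pderiv_eq_zero h0
  have hc : c ≠ 0 := fun h => hp.ne_zero (by rw [h, map_zero])
  exact hp.not_isUnit ((isUnit_iff_ne_zero.2 hc).map MvPolynomial.C)

/-- The product of the factors other than the `k`-th. -/
noncomputable def cofactor (q : Fin m → MvPolynomial (Fin d) ℝ) (k : Fin m) :
    MvPolynomial (Fin d) ℝ := ∏ l ∈ Finset.univ.erase k, q l

theorem mul_cofactor (q : Fin m → MvPolynomial (Fin d) ℝ) (k : Fin m) :
    q k * cofactor q k = ∏ l, q l := Finset.mul_prod_erase _ _ (Finset.mem_univ k)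

/-- A reduced equation is squarefree: with a repeated factor, the cofactor would still vanish on
`∂Ω` and so would be a multiple of `Q`. -/
theorem IsReducedBoundaryEquation.not_dvd_cofactor
    (hQ : IsReducedBoundaryEquation Ω (∏ k, q k)) (hq : ∀ k, Irreducible (q k)) (k : Fin m) :
    ¬ q k ∣ cofactor q k := by
  intro h
  have h1 : ∏ l, q l ∣ cofactor q k := by
    rw [hQ.dvd_iff]
    intro x hx
    have h2 := hQ.eval_eq_zero hx
    rw [← mul_cofactor q k, map_mul] at h2
    rcases mul_eq_zero.1 h2 with h3 | h3
    · obtain ⟨c, hc⟩ := h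
      rw [hc, map_mul, h3, zero_mul]
    · exact h3
  have h0 : cofactor q k ≠ 0 := fun h0 => hQ.1 (by rw [← mul_cofactor q k, h0, mul_zero])
  rw [← mul_cofactor q k] at h1
  obtain ⟨c, hc⟩ := h1
  have : q k * c = 1 := by
    apply mul_left_cancel₀ h0
    rw [mul_one]
    nth_rewrite 2 [hc]
    ring
  exact (hq k).not_isUnit (IsUnit.of_mul_eq_one _ this)

theorem IsReducedBoundaryEquation.prod_dvd_of_forall_dvd
    (hQ : IsReducedBoundaryEquation Ω (∏ k, q k)) (hq : ∀ k, Irreducible (q k))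
    {F : MvPolynomial (Fin d) ℝ} (h : ∀ k, q k ∣ F) : ∏ k, q k ∣ F := by
  refine Finset.prod_dvd_of_isRelPrime (fun k _ l _ hkl => ?_) fun k _ => h k
  refine (hq k).isRelPrime_iff_not_dvd.2 fun hd => hQ.not_dvd_cofactor hq k (hd.trans ?_)
  exact Finset.dvd_prod_of_mem q (Finset.mem_erase.2 ⟨hkl.symm, Finset.mem_univ l⟩)

theorem pderiv_prod_eq (q : Fin m → MvPolynomial (Fin d) ℝ) (k : Fin m) (j : Fin d) :
    pderiv j (∏ l, q l) = cofactor q k * pderiv j (q k) + q k * pderiv j (cofactor q k) := by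
  rw [← mul_cofactor q k, Derivation.leibniz, smul_eq_mul, smul_eq_mul]
  ring

/-- Tangency to `{Q = 0}` passes to each factor: modulo `q_k` the gradient of `Q` is the cofactor
times the gradient of `q_k`, and the prime `q_k` does not divide the cofactor. -/
theorem dvd_mul_pderiv_iff (hQ : IsReducedBoundaryEquation Ω (∏ k, q k))
    (hq : ∀ k, Irreducible (q k)) (k : Fin m) (V : Fin d → MvPolynomial (Fin d) ℝ)
    (h : ∏ l, q l ∣ ∑ j, V j * pderiv j (∏ l, q l)) : q k ∣ ∑ j, V j * pderiv j (q k) := by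
  have h1 : q k ∣ ∏ l, q l := Finset.dvd_prod_of_mem q (Finset.mem_univ k)
  have h2 : ∑ j, V j * pderiv j (∏ l, q l) = cofactor q k * (∑ j, V j * pderiv j (q k)) +
      q k * ∑ j, V j * pderiv j (cofactor q k) := by
    simp only [pderiv_prod_eq q k, Finset.mul_sum, ← Finset.sum_add_distrib]
    exact Finset.sum_congr rfl fun j _ => by ring
  have h3 : q k ∣ cofactor q k * (∑ j, V j * pderiv j (q k)) :=
    (dvd_add_left (dvd_mul_right _ _)).1 (h2 ▸ h1.trans h)
  exact ((hq k).prime.dvd_or_dvd h3).resolve_left (hQ.not_dvd_cofactor hq k)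

theorem exists_prod_irreducible_associated (hQ : Q ≠ 0) :
    ∃ (m : ℕ) (q : Fin m → MvPolynomial (Fin d) ℝ), (∀ k, Irreducible (q k)) ∧
      Associated (∏ k, q k) Q := by
  obtain ⟨f, hf, hfQ⟩ := WfDvdMonoid.exists_factors Q hQ
  refine ⟨f.toList.length, fun k => f.toList.get k,
    fun k => hf _ (Multiset.mem_toList.1 (List.get_mem _ k)), ?_⟩
  have : ∏ k, f.toList.get k = f.prod := by
    rw [← List.prod_ofFn, List.ofFn_get, Multiset.prod_toList]
  rwa [this]

/-- Each prime factor `q_k` divides `F ∂_j q_k` for all `j`, and fails to divide one of the `∂_j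
q_k`. The factors are pairwise coprime, so their product divides `F`. -/
theorem IsReducedBoundaryEquation.dvd_of_forall_dvd_mul_pderiv
    (hQ : IsReducedBoundaryEquation Ω Q) {F : MvPolynomial (Fin d) ℝ}
    (h : ∀ j, Q ∣ F * pderiv j Q) : Q ∣ F := by
  obtain ⟨m, q, hq, hass⟩ := exists_prod_irreducible_associated hQ.1
  have hQ' := hQ.of_associated hass
  rw [← hass.dvd_iff_dvd_left]
  refine hQ'.prod_dvd_of_forall_dvd hq fun k => ?_
  obtain ⟨j, hj⟩ := exists_not_dvd_pderiv (hq k)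
  -- The product differs from `Q` by a unit `v`, and on `∂Ω` the derivative of `Qv` is `v ∂_jQ`.
  have h1 : ∏ l, q l ∣ F * pderiv j (∏ l, q l) := by
    rw [hQ'.dvd_iff]
    intro x hx
    obtain ⟨v, hv⟩ := hass.symm
    have h2 := hQ.dvd_iff.1 (h j) x hx
    rw [← hv, Derivation.leibniz, smul_eq_mul, smul_eq_mul, map_mul, map_add, map_mul, map_mul,
      hQ.eval_eq_zero hx, zero_mul, zero_add, mul_left_comm, ← map_mul, h2, mul_zero]
  have h2 := dvd_mul_pderiv_iff hQ' hq k (Pi.single j F) (by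
    simpa [Pi.single_apply] using h1)
  have h3 : q k ∣ F * pderiv j (q k) := by simpa [Pi.single_apply] using h2
  exact ((hq k).prime.dvd_or_dvd h3).resolve_right hj

theorem det_mul_pderiv_eq (hL : ∀ i, ∑ j, G i j * pderiv j Q = L i * Q) (j : Fin d) :
    G.det * pderiv j Q = (∑ i, G.adjugate j i * L i) * Q := by
  have h1 : G.mulVec (fun j => pderiv j Q) = fun i => L i * Q := funext hL
  have h2 := congrFun (congrArg G.adjugate.mulVec h1) j
  rw [Matrix.mulVec_mulVec, Matrix.adjugate_mul, Matrix.smul_mulVec, Matrix.one_mulVec] at h2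
  simp only [Pi.smul_apply, smul_eq_mul, Matrix.mulVec, dotProduct] at h2
  rw [h2, Finset.sum_mul]
  exact Finset.sum_congr rfl fun i _ => by ring

theorem eval_det_eq (x : Fin d → ℝ) : eval x G.det = (evalMetric G x).det := by
  rw [evalMetric, RingHom.map_det]
  rfl

theorem SolvesBoundaryEquation.dvd_det (hS : SolvesBoundaryEquation a Ω Q G L)
    (hQ : IsReducedBoundaryEquation Ω Q) : Q ∣ G.det :=
  hQ.dvd_of_forall_dvd_mul_pderiv fun j => ⟨_, (det_mul_pderiv_eq hS.equation j).trans
    (mul_comm _ _)⟩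

/-- Makes the logarithms of the factors smooth in `Ω` and the cutoffs along `Q` effective; it rests
on `det g > 0` in `Ω`. -/
theorem SolvesBoundaryEquation.eval_ne_zero (hS : SolvesBoundaryEquation a Ω Q G L)
    (hQ : IsReducedBoundaryEquation Ω Q) {x : Fin d → ℝ} (hx : x ∈ Ω) : eval x Q ≠ 0 := by
  intro h
  obtain ⟨c, hc⟩ := hS.dvd_det hQ
  have h1 := (hS.posDef x hx).det_pos
  rw [← eval_det_eq, hc, map_mul, h, zero_mul] at h1
  exact lt_irrefl _ h1

/-- `M i k` is the `i`-th component of `g∇ log q_k`. Hence `g∇ log ρ` is polynomial for every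
product of powers `ρ` of the factors. -/
theorem SolvesBoundaryEquation.exists_factor (hS : SolvesBoundaryEquation a Ω (∏ k, q k) G L)
    (hQ : IsReducedBoundaryEquation Ω (∏ k, q k)) (hq : ∀ k, Irreducible (q k)) :
    ∃ M : Fin d → Fin m → MvPolynomial (Fin d) ℝ, ∀ i k, M i k ∈ weightedDegreeLE a (a i) ∧
      ∑ j, G i j * pderiv j (q k) = M i k * q k := by
  have h : ∀ i k, ∃ M, M ∈ weightedDegreeLE a (a i) ∧
      ∑ j, G i j * pderiv j (q k) = M * q k := by
    intro i k
    obtain ⟨M, hM⟩ := dvd_mul_pderiv_iff hQ hq k (G i) ⟨L i, by rw [hS.equation, mul_comm]⟩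
    refine ⟨M, weightedTotalDegree_le_of_mul_le a (hq k).ne_zero ?_, by rw [hM, mul_comm]⟩
    rw [mul_comm, ← hM]
    exact Submodule.sum_mem (weightedDegreeLE a (a i + (q k).weightedTotalDegree a))
      fun j _ => mul_pderiv_mem a (hS.degree_metric i j) ((mem_weightedDegreeLE a).2 le_rfl)
  choose M hM using h
  exact ⟨M, hM⟩

end ReducedEquation

/-! ### Products of powers of the factors as densities. -/

section FactorWeight

variable {d : ℕ} {a : Fin d → ℕ} {G : Matrix (Fin d) (Fin d) (MvPolynomial (Fin d) ℝ)}
  {Q : MvPolynomial (Fin d) ℝ} {L : Fin d → MvPolynomial (Fin d) ℝ} {Ω : Set (Fin d → ℝ)}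
  {m : ℕ} {q : Fin m → MvPolynomial (Fin d) ℝ} {r : Fin m → ℝ}

open MvPolynomial (pderiv eval)

theorem eval_factor_ne_zero {x : Fin d → ℝ} (h : eval x (∏ k, q k) ≠ 0) (k : Fin m) :
    eval x (q k) ≠ 0 := by
  rw [map_prod, Finset.prod_ne_zero_iff] at h
  exact h k (Finset.mem_univ k)

/-- The logarithm of `∏ |Q_k|^{r_k}`. -/
noncomputable def logWeight (q : Fin m → MvPolynomial (Fin d) ℝ) (r : Fin m → ℝ)
    (x : Fin d → ℝ) : ℝ := ∑ k, r k * Real.log (eval x (q k))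

theorem factorWeight_eq_exp {x : Fin d → ℝ} (h : ∀ k, eval x (q k) ≠ 0) :
    factorWeight q r x = Real.exp (logWeight q r x) := by
  rw [factorWeight, logWeight, Real.exp_sum]
  refine Finset.prod_congr rfl fun k _ => ?_
  rw [Real.rpow_def_of_pos (abs_pos.2 (h k)), Real.log_abs, mul_comm]

theorem contDiffAt_logWeight {x : Fin d → ℝ} (h : ∀ k, eval x (q k) ≠ 0) {n : WithTop ℕ∞} :
    ContDiffAt ℝ n (logWeight q r) x :=
  ContDiffAt.sum fun k _ => contDiffAt_const.mul ((contDiff_eval (q k)).contDiffAt.log (h k))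

theorem partialD_logWeight {x : Fin d → ℝ} (h : ∀ k, eval x (q k) ≠ 0) (j : Fin d) :
    partialD j (logWeight q r) x = ∑ k, r k * (eval x (pderiv j (q k)) / eval x (q k)) := by
  have hd : ∀ k, DifferentiableAt ℝ (fun y => Real.log (eval y (q k))) x := fun k =>
    (hasFDerivAt_eval _ x).differentiableAt.log (h k)
  unfold logWeight
  rw [partialD_sum (f := fun k x => r k * Real.log (eval x (q k))) _
    fun k _ => (differentiableAt_const _).mul (hd k)]
  refine Finset.sum_congr rfl fun k _ => ?_
  rw [partialD_mul (differentiableAt_const _) (hd k),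
    partialD_comp (Real.differentiableAt_log (h k)) (hasFDerivAt_eval _ x).differentiableAt,
    partialD_eval, Real.deriv_log]
  simp [partialD, div_eq_inv_mul]

theorem factorWeight_pos {x : Fin d → ℝ} (h : ∀ k, eval x (q k) ≠ 0) :
    0 < factorWeight q r x := by
  rw [factorWeight_eq_exp h]; exact Real.exp_pos _

theorem factorWeight_eventuallyEq {x : Fin d → ℝ} (h : ∀ k, eval x (q k) ≠ 0) :
    factorWeight q r =ᶠ[𝓝 x] fun y => Real.exp (logWeight q r y) := by
  have : ∀ᶠ y in 𝓝 x, ∀ k, eval y (q k) ≠ 0 := Filter.eventually_all.2 fun k =>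
    (continuous_eval (q k)).continuousAt.eventually_ne (h k)
  filter_upwards [this] with y hy using factorWeight_eq_exp hy

theorem contDiffAt_factorWeight {x : Fin d → ℝ} (h : ∀ k, eval x (q k) ≠ 0)
    {n : WithTop ℕ∞} : ContDiffAt ℝ n (factorWeight q r) x :=
  (contDiffAt_logWeight h).exp.congr_of_eventuallyEq (factorWeight_eventuallyEq h)

theorem partialD_factorWeight {x : Fin d → ℝ} (h : ∀ k, eval x (q k) ≠ 0) (j : Fin d) :
    partialD j (factorWeight q r) x = factorWeight q r x *
      ∑ k, r k * (eval x (pderiv j (q k)) / eval x (q k)) := by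
  rw [(factorWeight_eventuallyEq h).partialD_eq, partialD_comp Real.differentiableAt_exp
    ((contDiffAt_logWeight h (n := 1)).differentiableAt (by norm_num)), partialD_logWeight h,
    Real.deriv_exp, factorWeight_eq_exp h]

theorem partialD_const_mul (c : ℝ) (f : (Fin d → ℝ) → ℝ) (j : Fin d) (x : Fin d → ℝ) :
    partialD j (fun y => c * f y) x = c * partialD j f x := by
  have : (fun y => c * f y) = c • f := rfl
  rw [partialD, partialD, this, fderiv_const_smul_field]
  simp

theorem symmetricDrift_const_mul (g : (Fin d → ℝ) → Matrix (Fin d) (Fin d) ℝ) {c : ℝ} (hc : c ≠ 0)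
    (ρ : (Fin d → ℝ) → ℝ) : symmetricDrift g (fun x => c * ρ x) = symmetricDrift g ρ := by
  ext x i
  simp only [symmetricDrift, mul_assoc, partialD_const_mul, ← Finset.mul_sum]
  rw [mul_inv, mul_comm c⁻¹, mul_assoc, inv_mul_cancel_left₀ hc]

theorem normalizedMeasure_withDensity {ρ : (Fin d → ℝ) → ℝ}
    (hfin : (volume.restrict Ω).withDensity (fun x => ENNReal.ofReal (ρ x)) Set.univ < ⊤)
    (h0 : (volume.restrict Ω).withDensity (fun x => ENNReal.ofReal (ρ x)) ≠ 0) :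
    IsProbabilityMeasure (normalizedMeasure
      ((volume.restrict Ω).withDensity (fun x => ENNReal.ofReal (ρ x)))) ∧
    ∃ c : ℝ, 0 < c ∧ normalizedMeasure
      ((volume.restrict Ω).withDensity (fun x => ENNReal.ofReal (ρ x))) =
      (volume.restrict Ω).withDensity (fun x => ENNReal.ofReal (c * ρ x)) := by
  set ν := (volume.restrict Ω).withDensity (fun x => ENNReal.ofReal (ρ x)) with hν
  have h1 : ν Set.univ ≠ 0 := by rwa [Ne, Measure.measure_univ_eq_zero]
  refine ⟨⟨?_⟩, ((ν Set.univ)⁻¹).toReal, ?_, ?_⟩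
  · rw [normalizedMeasure, Measure.smul_apply, smul_eq_mul, ENNReal.inv_mul_cancel h1 hfin.ne]
  · exact ENNReal.toReal_pos (ENNReal.inv_ne_zero.2 hfin.ne) (ENNReal.inv_ne_top.2 h1)
  · rw [normalizedMeasure, hν, ← withDensity_smul' _ _ (ENNReal.inv_ne_top.2 h1)]
    congr 1
    ext x
    rw [ENNReal.ofReal_mul ENNReal.toReal_nonneg, ENNReal.ofReal_toReal (ENNReal.inv_ne_top.2 h1)]
    rfl

theorem withDensity_restrict_ne_zero (hΩ : IsOpen Ω) (hne : Ω.Nonempty) {ρ : (Fin d → ℝ) → ℝ}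
    (hρ : ContinuousOn ρ Ω) (hpos : ∀ x ∈ Ω, 0 < ρ x) :
    (volume.restrict Ω).withDensity (fun x => ENNReal.ofReal (ρ x)) ≠ 0 := by
  intro h
  rw [withDensity_eq_zero_iff (aemeasurable_ofReal_of_continuousOn hΩ hρ)] at h
  have h1 : ∀ᵐ x ∂(volume.restrict Ω), False := by
    filter_upwards [h, ae_restrict_mem hΩ.measurableSet] with x hx hxΩ
    have := hpos x hxΩ
    simp at hx
    linarith
  rw [Filter.eventually_false_iff_eq_bot, ae_eq_bot, Measure.restrict_eq_zero] at h1
  exact (hΩ.measure_pos volume hne).ne' h1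

/-- Every integrable product of powers of the factors of the boundary equation is the density of a
polynomial model. -/
theorem isPolynomialModel_factorMeasure (ha : ∀ i, 0 < a i) (hΩ : IsPiecewiseC1Domain Ω)
    (hQ : IsReducedBoundaryEquation Ω (∏ k, q k))
    (hS : SolvesBoundaryEquation a Ω (∏ k, q k) G L) (hq : ∀ k, Irreducible (q k))
    (hfin : factorMeasure Ω q r Set.univ < ⊤) :
    IsPolynomialModel a Ω (evalMetric G) (symmetricDrift (evalMetric G) (factorWeight q r))
      (normalizedMeasure (factorMeasure Ω q r)) := by
  have hq0 : ∀ x ∈ Ω, ∀ k, eval x (q k) ≠ 0 := fun x hx k =>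
    eval_factor_ne_zero (hS.eval_ne_zero hQ hx) k
  have hsm : ContDiffOn ℝ ∞ (factorWeight q r) Ω := fun x hx =>
    (contDiffAt_factorWeight (hq0 x hx)).contDiffWithinAt
  have hpos : ∀ x ∈ Ω, 0 < factorWeight q r x := fun x hx => factorWeight_pos (hq0 x hx)
  obtain ⟨hprob, c, hc, heq⟩ := normalizedMeasure_withDensity hfin
    (withDensity_restrict_ne_zero hΩ.isOpen hΩ.isConnected.nonempty hsm.continuousOn hpos)
  rw [heq] at hprob
  obtain ⟨M, hM⟩ := hS.exists_factor hQ hq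
  -- This `N` is `g∇ log ρ`, namely `∑ r_k g∇ log q_k`.
  have key := isPolynomialModel_of_density (N := fun i => ∑ k, r k • M i k) ha hΩ.isOpen
    hΩ.isConnected.nonempty hΩ.isBounded (fun x hx => hQ.eval_eq_zero hx)
    (fun x hx => hS.eval_ne_zero hQ hx) hS (contDiffOn_const.mul hsm)
    (fun x hx => mul_pos hc (hpos x hx)) hprob
    (fun i => Submodule.sum_mem _ fun k _ => Submodule.smul_mem _ _ (hM i k).1) ?_
  · rw [symmetricDrift_const_mul _ hc.ne'] at key
    rw [factorMeasure, heq]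
    exact key
  · intro i x hx
    simp only [partialD_const_mul, partialD_factorWeight (hq0 x hx), map_sum,
      MvPolynomial.smul_eval, Finset.mul_sum, Finset.sum_mul]
    rw [Finset.sum_comm]
    refine Finset.sum_congr rfl fun k _ => ?_
    have h1 := congrArg (eval x) (hM i k).2
    rw [map_mul, map_sum] at h1
    have h2 : eval x (M i k) = (∑ j, eval x (G i j * pderiv j (q k))) / eval x (q k) := by
      rw [h1, mul_div_cancel_right₀ _ (hq0 x hx k)]
    rw [h2, Finset.sum_div, Finset.mul_sum, Finset.sum_mul]
    refine Finset.sum_congr rfl fun j _ => ?_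
    rw [map_mul]
    ring

theorem factorMeasure_zero_lt_top (hb : Bornology.IsBounded Ω) :
    factorMeasure Ω q (fun _ => 0) Set.univ < ⊤ := by
  simp only [factorMeasure, factorWeight, Real.rpow_zero, Finset.prod_const_one,
    ENNReal.ofReal_one]
  have : (volume.restrict Ω).withDensity (fun _ => (1 : ENNReal)) = volume.restrict Ω :=
    withDensity_one
  rw [this, Measure.restrict_apply_univ]
  exact hb.measure_lt_top

end FactorWeight

/-! ### From polynomials to `C¹` functions of a polynomial. -/

section Approximation

variable {d : ℕ} {Ω : Set (Fin d → ℝ)}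

theorem exists_derivative_eq (w : Polynomial ℝ) : ∃ W : Polynomial ℝ, W.derivative = w := by
  induction w using Polynomial.induction_on' with
  | add p q hp hq =>
    obtain ⟨P, rfl⟩ := hp
    obtain ⟨Q, rfl⟩ := hq
    exact ⟨P + Q, Polynomial.derivative_add⟩
  | monomial n c =>
    refine ⟨Polynomial.monomial (n + 1) (c / (n + 1)), ?_⟩
    rw [Polynomial.derivative_monomial]
    have : (n : ℝ) + 1 ≠ 0 := by positivity
    simp [this]

/-- Weierstrass is applied to the derivative, and a primitive agreeing with `u` at `0` is taken; the
mean value inequality controls the values. -/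
theorem exists_polynomial_near_contDiff {u : ℝ → ℝ} (hu : ContDiff ℝ 1 u) (M : ℝ) {ε : ℝ}
    (hε : 0 < ε) : ∃ W : Polynomial ℝ, ∀ t ∈ Set.Icc (-M) M,
      |W.eval t - u t| ≤ ε * M ∧ |W.derivative.eval t - deriv u t| ≤ ε := by
  obtain ⟨w, hw⟩ := exists_polynomial_near_of_continuousOn (-M) M (deriv u)
    (hu.continuous_deriv le_rfl).continuousOn ε hε
  obtain ⟨W₀, hW₀⟩ := exists_derivative_eq w
  set W := W₀ + Polynomial.C (u 0 - W₀.eval 0) with hW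
  have hWd : W.derivative = w := by simp [hW, hW₀]
  have hd : ∀ t, HasDerivAt (fun t => W.eval t - u t) (w.eval t - deriv u t) t := fun t => by
    have h1 := W.hasDerivAt t
    rw [hWd] at h1
    exact h1.sub (hu.differentiable (by norm_num) t).hasDerivAt
  refine ⟨W, fun t ht => ⟨?_, ?_⟩⟩
  · have hM : 0 ≤ M := by linarith [ht.1, ht.2]
    have h1 := (convex_Icc (-M) M).norm_image_sub_le_of_norm_hasDerivWithin_le
      (fun s _ => (hd s).hasDerivWithinAt) (C := ε) (fun s hs => (hw s hs).le)
      (x := 0) (y := t) ⟨by linarith, hM⟩ ht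
    simp only [hW, Polynomial.eval_add, Polynomial.eval_C, Real.norm_eq_abs, sub_zero] at h1 ⊢
    rw [show W₀.eval 0 + (u 0 - W₀.eval 0) - u 0 = 0 by ring, sub_zero] at h1
    exact h1.trans (mul_le_mul_of_nonneg_left (abs_le.2 ht) hε.le)
  · rw [hWd]; exact (hw t ht).le

/-- A first order functional vanishing on the polynomials in `h` vanishes on the `C¹` functions
of `h`. -/
theorem integral_comp_eq_zero (hb : Bornology.IsBounded Ω) {μ : Measure (Fin d → ℝ)}
    [IsProbabilityMeasure μ] (hμ : ∀ᵐ x ∂μ, x ∈ Ω) {α γ h : (Fin d → ℝ) → ℝ}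
    (hα : Continuous α) (hγ : Continuous γ) (hh : Continuous h)
    (H : ∀ W : Polynomial ℝ,
      ∫ x, α x * W.eval (h x) + γ x * W.derivative.eval (h x) ∂μ = 0)
    {u : ℝ → ℝ} (hu : ContDiff ℝ 1 u) :
    ∫ x, α x * u (h x) + γ x * deriv u (h x) ∂μ = 0 := by
  obtain ⟨A, hA⟩ := hb.isCompact_closure.exists_bound_of_continuousOn hα.continuousOn
  obtain ⟨B, hB⟩ := hb.isCompact_closure.exists_bound_of_continuousOn hγ.continuousOn
  obtain ⟨M, hM⟩ := hb.isCompact_closure.exists_bound_of_continuousOn hh.continuousOn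
  have hint : ∀ F : (Fin d → ℝ) → ℝ, Continuous F → Integrable F μ := by
    intro F hF
    obtain ⟨C, hC⟩ := hb.isCompact_closure.exists_bound_of_continuousOn hF.continuousOn
    exact Integrable.of_bound hF.aestronglyMeasurable C
      (hμ.mono fun x hx => hC x (subset_closure hx))
  have hud : Continuous (deriv u) := hu.continuous_deriv le_rfl
  have key : ∀ ε, 0 < ε → |∫ x, α x * u (h x) + γ x * deriv u (h x) ∂μ| ≤
      ε * (|A| * |M| + |B|) := by
    intro ε hε
    obtain ⟨W, hW⟩ := exists_polynomial_near_contDiff hu |M| hε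
    have hW1 : Continuous fun x => α x * W.eval (h x) + γ x * W.derivative.eval (h x) :=
      (hα.mul (W.continuous.comp hh)).add (hγ.mul (W.derivative.continuous.comp hh))
    have hW2 : Continuous fun x => α x * u (h x) + γ x * deriv u (h x) :=
      (hα.mul (hu.continuous.comp hh)).add (hγ.mul (hud.comp hh))
    have h1 := integral_sub (hint _ hW1) (hint _ hW2)
    rw [H W, zero_sub] at h1
    rw [← abs_neg, ← h1, ← Real.norm_eq_abs]
    refine (norm_integral_le_of_norm_le_const (C := ε * (|A| * |M| + |B|))
      (hμ.mono fun x hx => ?_)).trans (by simp)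
    have hx' := subset_closure hx
    have ht : h x ∈ Set.Icc (-|M|) |M| := abs_le.1 ((hM x hx').trans (le_abs_self M))
    obtain ⟨e1, e2⟩ := hW _ ht
    have a1 : |α x| ≤ |A| := (hA x hx').trans (le_abs_self A)
    have a2 : |γ x| ≤ |B| := (hB x hx').trans (le_abs_self B)
    calc ‖α x * W.eval (h x) + γ x * W.derivative.eval (h x) -
          (α x * u (h x) + γ x * deriv u (h x))‖
        = |α x * (W.eval (h x) - u (h x)) +
          γ x * (W.derivative.eval (h x) - deriv u (h x))| := by
          rw [Real.norm_eq_abs]; congr 1; ring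
      _ ≤ |A| * (ε * |M|) + |B| * ε := by
          refine (abs_add_le _ _).trans (add_le_add ?_ ?_)
          · rw [abs_mul]; exact mul_le_mul a1 e1 (abs_nonneg _) (abs_nonneg _)
          · rw [abs_mul]; exact mul_le_mul a2 e2 (abs_nonneg _) (abs_nonneg _)
      _ = ε * (|A| * |M| + |B|) := by ring
  have hC : 0 ≤ |A| * |M| + |B| := by positivity
  by_contra hne
  have hpos := abs_pos.2 hne
  set I := |∫ x, α x * u (h x) + γ x * deriv u (h x) ∂μ|
  -- For this `ε` the estimate gives `I ≤ I/2`.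
  have := key (I / (2 * (|A| * |M| + |B| + 1))) (by positivity)
  rw [div_mul_eq_mul_div, le_div_iff₀ (by positivity)] at this
  nlinarith

/-- The square of the positive part. -/
noncomputable def posSq (t : ℝ) : ℝ := max t 0 ^ 2

theorem hasDerivAt_posSq (t : ℝ) : HasDerivAt posSq (2 * max t 0) t := by
  rcases lt_trichotomy t 0 with h | h | h
  · rw [max_eq_right h.le, mul_zero]
    refine (hasDerivAt_const t (0 : ℝ)).congr_of_eventuallyEq ?_
    filter_upwards [gt_mem_nhds h] with s hs
    simp [posSq, max_eq_right hs.le]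
  · subst h
    have h1 : posSq =O[𝓝 0] fun s => ‖s - 0‖ ^ 2 := by
      refine Asymptotics.IsBigO.of_bound 1 (Filter.Eventually.of_forall fun s => ?_)
      have h2 : max s 0 ≤ |s| := max_le (le_abs_self s) (abs_nonneg s)
      have h3 : 0 ≤ max s 0 := le_max_right _ _
      simp only [posSq, Real.norm_eq_abs, sub_zero, abs_pow, abs_abs, one_mul, abs_of_nonneg h3]
      gcongr
    have h2 := (h1.hasFDerivAt (n := 2) (by norm_num)).hasDerivAt
    simpa using h2
  · rw [max_eq_left h.le]
    refine ((hasDerivAt_pow 2 t).congr_deriv (by simp)).congr_of_eventuallyEq ?_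
    filter_upwards [lt_mem_nhds h] with s hs
    simp [posSq, max_eq_left (le_of_lt hs)]

theorem deriv_posSq : deriv posSq = fun t => 2 * max t 0 := funext fun t => (hasDerivAt_posSq t).deriv

/-- The profile of the localized test functions: `posSq ∘ h` lives on `{h > 0}`, where both `posSq`
and its derivative are positive, and one derivative is all that the first order functional needs. -/
theorem contDiff_posSq : ContDiff ℝ 1 posSq := by
  rw [contDiff_one_iff_deriv, deriv_posSq]
  exact ⟨fun t => (hasDerivAt_posSq t).differentiableAt,
    continuous_const.mul (continuous_id.max continuous_const)⟩

end Approximation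

/-! ### The coefficients of a model are polynomials. -/

section ModelCoefficients

variable {d : ℕ} {a : Fin d → ℕ} {Ω : Set (Fin d → ℝ)}
  {g : (Fin d → ℝ) → Matrix (Fin d) (Fin d) ℝ} {b : (Fin d → ℝ) → Fin d → ℝ}
  {μ : Measure (Fin d → ℝ)}

open MvPolynomial (pderiv eval)

/-- `𝒫_n` is spanned by the eigenvectors that it contains, hence preserved by the operator. -/
theorem IsPolynomialModel.exists_diffusionOp_eval (hm : IsPolynomialModel a Ω g b μ) {n : ℕ}
    {p : MvPolynomial (Fin d) ℝ} (hp : p ∈ weightedDegreeLE a n) :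
    ∃ R ∈ weightedDegreeLE a n, ∀ x ∈ Ω, diffusionOp g b (fun y => eval y p) x = eval x R := by
  obtain ⟨s, -, -, hs, hspan⟩ := hm.eigenbasis
  refine Submodule.span_induction (p := fun p _ => ∃ R ∈ weightedDegreeLE a n, ∀ x ∈ Ω,
    diffusionOp g b (fun y => eval y p) x = eval x R) ?_ ?_ ?_ ?_ (hspan n p hp)
  · rintro q ⟨hq, hqn⟩
    obtain ⟨c, hc⟩ := hs q hq
    exact ⟨(-c) • q, Submodule.smul_mem _ _ hqn, fun x hx => by
      rw [hc x hx, MvPolynomial.smul_eval]⟩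
  · exact ⟨0, Submodule.zero_mem _, fun x _ => by rw [diffusionOp_eval]; simp⟩
  · rintro p q _ _ ⟨R, hR, h1⟩ ⟨S, hS, h2⟩
    refine ⟨R + S, Submodule.add_mem _ hR hS, fun x hx => ?_⟩
    rw [map_add, ← h1 x hx, ← h2 x hx, diffusionOp_eval, diffusionOp_eval, diffusionOp_eval]
    simp only [map_add, mul_add, Finset.sum_add_distrib]
    ring
  · rintro c p _ ⟨R, hR, h1⟩
    refine ⟨c • R, Submodule.smul_mem _ c hR, fun x hx => ?_⟩
    rw [MvPolynomial.smul_eval, ← h1 x hx, diffusionOp_eval, diffusionOp_eval]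
    simp only [Derivation.map_smul, MvPolynomial.smul_eval, mul_add,
      Finset.mul_sum, mul_left_comm c]

/-- `b^i = L x_i`. -/
theorem IsPolynomialModel.exists_drift (hm : IsPolynomialModel a Ω g b μ) :
    ∃ β : Fin d → MvPolynomial (Fin d) ℝ, ∀ i, β i ∈ weightedDegreeLE a (a i) ∧
      ∀ x ∈ Ω, b x i = eval x (β i) := by
  have h := fun i => hm.exists_diffusionOp_eval (weightedTotalDegree_X_le a i)
  choose β hβ using h
  refine ⟨β, fun i => ⟨(hβ i).1, fun x hx => ?_⟩⟩
  rw [← (hβ i).2 x hx, diffusionOp_eval]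
  simp [MvPolynomial.pderiv_X, Pi.single_apply, apply_ite]

/-- The coefficients of the operator of a polynomial model are polynomials. -/
theorem IsPolynomialModel.exists_coefficients (hm : IsPolynomialModel a Ω g b μ) :
    ∃ (G : Matrix (Fin d) (Fin d) (MvPolynomial (Fin d) ℝ)) (β : Fin d → MvPolynomial (Fin d) ℝ),
      G.IsSymm ∧ (∀ i j, G i j ∈ weightedDegreeLE a (a i + a j)) ∧
      (∀ i, β i ∈ weightedDegreeLE a (a i)) ∧ (∀ x ∈ Ω, g x = evalMetric G x) ∧
      ∀ x ∈ Ω, ∀ i, b x i = eval x (β i) := by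
  obtain ⟨β, hβ⟩ := hm.exists_drift
  have hX := fun i => weightedTotalDegree_X_le a i
  have h : ∀ i j, ∃ R ∈ weightedDegreeLE a (a i + a j), ∀ x ∈ Ω,
      diffusionOp g b (fun y => eval y (MvPolynomial.X i * MvPolynomial.X j)) x = eval x R :=
    fun i j => hm.exists_diffusionOp_eval (mul_mem_weightedDegreeLE a (hX i) (hX j))
  choose R hRd hR using h
  -- From `L(x_i x_j) = 2 g^{ij} + x_i b^j + x_j b^i`.
  let F : Fin d → Fin d → MvPolynomial (Fin d) ℝ := fun i j =>
    (1 / 2 : ℝ) • (R i j - (MvPolynomial.X i * β j + β i * MvPolynomial.X j))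
  have hF : ∀ i j, ∀ x ∈ Ω, eval x (F i j) = g x i j := by
    intro i j x hx
    have hsymm : g x j i = g x i j := by
      simpa using (hm.posDef x hx).1.apply i j
    have e1 := hR i j x hx
    rw [diffusionOp_eval] at e1
    simp only [Derivation.leibniz, MvPolynomial.pderiv_X, smul_eq_mul, map_add,
      MvPolynomial.eval_X, Pi.single_apply, apply_ite (eval x), map_one, map_zero,
      apply_ite (pderiv _), mul_add, Finset.sum_add_distrib, mul_ite, mul_one, mul_zero,
      Finset.sum_ite_eq, Finset.mem_univ, if_true] at e1
    simp only [F, MvPolynomial.smul_eval, map_sub, map_add, map_mul, MvPolynomial.eval_X,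
      ← (hβ _).2 x hx, ← e1]
    simp
    linarith
  -- Copying the upper triangle makes the polynomial matrix symmetric by construction, with no
  -- return from values on `Ω` to polynomials.
  refine ⟨Matrix.of fun i j => if i ≤ j then F i j else F j i, β, ?_, ?_, fun i => (hβ i).1, ?_,
    fun x hx i => (hβ i).2 x hx⟩
  · ext i j
    simp only [Matrix.transpose_apply, Matrix.of_apply]
    rcases lt_trichotomy i j with h | h | h
    · simp [h.le, not_le.2 h]
    · simp [h]
    · simp [h.le, not_le.2 h]
  · have hFd : ∀ i j, F i j ∈ weightedDegreeLE a (a i + a j) := fun i j =>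
      Submodule.smul_mem _ _ (Submodule.sub_mem _ (hRd i j) (Submodule.add_mem _
        (mul_mem_weightedDegreeLE a (hX i) (hβ j).1) (mul_mem_weightedDegreeLE a (hβ i).1 (hX j))))
    intro i j
    simp only [Matrix.of_apply]
    split_ifs
    · exact hFd i j
    · rw [add_comm]; exact hFd j i
  · intro x hx
    ext i j
    have hsymm : g x j i = g x i j := by
      simpa using (hm.posDef x hx).1.apply i j
    simp only [evalMetric, Matrix.map_apply, Matrix.of_apply]
    split_ifs
    · rw [hF i j x hx]
    · rw [hF j i x hx, hsymm]

end ModelCoefficients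

/-! ### Symmetry on polynomials and its first order form. -/

section IntegrationByParts

variable {d : ℕ} {a : Fin d → ℕ} {Ω : Set (Fin d → ℝ)}
  {g : (Fin d → ℝ) → Matrix (Fin d) (Fin d) ℝ} {b : (Fin d → ℝ) → Fin d → ℝ}
  {μ : Measure (Fin d → ℝ)}
  {G : Matrix (Fin d) (Fin d) (MvPolynomial (Fin d) ℝ)} {β : Fin d → MvPolynomial (Fin d) ℝ}

open MvPolynomial (pderiv eval)

theorem integrable_eval (hb : Bornology.IsBounded Ω) [IsFiniteMeasure μ]
    (hμ : ∀ᵐ x ∂μ, x ∈ Ω) (p : MvPolynomial (Fin d) ℝ) : Integrable (fun x => eval x p) μ := by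
  obtain ⟨C, hC⟩ := hb.isCompact_closure.exists_bound_of_continuousOn (continuous_eval p).continuousOn
  exact Integrable.of_bound (continuous_eval p).aestronglyMeasurable C
    (hμ.mono fun x hx => hC x (subset_closure hx))

theorem IsPolynomialModel.ae_mem (hm : IsPolynomialModel a Ω g b μ) (hΩ : IsOpen Ω) :
    ∀ᵐ x ∂μ, x ∈ Ω := by
  obtain ⟨ρ, -, -, rfl⟩ := hm.density
  exact ae_mem_of_withDensity_restrict hΩ _

/-- Polynomials are not test functions on `Ω`; here symmetry comes from the orthogonal eigenvectors,
by comparing two bilinear forms on a spanning set. -/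
theorem IsPolynomialModel.integral_polyGenerator_mul (hm : IsPolynomialModel a Ω g b μ)
    (hΩ : IsOpen Ω) (hne : Ω.Nonempty) (hb : Bornology.IsBounded Ω)
    (hG : ∀ x ∈ Ω, g x = evalMetric G x) (hβ : ∀ x ∈ Ω, ∀ i, b x i = eval x (β i))
    (p q : MvPolynomial (Fin d) ℝ) :
    ∫ x, eval x (polyGenerator G β p * q) ∂μ = ∫ x, eval x (p * polyGenerator G β q) ∂μ := by
  have := hm.isProbabilityMeasure
  have hμ := hm.ae_mem hΩ
  obtain ⟨s, -, hs1, hs2, hs3⟩ := hm.eigenbasis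
  let B : MvPolynomial (Fin d) ℝ →ₗ[ℝ] MvPolynomial (Fin d) ℝ →ₗ[ℝ] ℝ :=
    LinearMap.mk₂ ℝ (fun p q => ∫ x, eval x (p * q) ∂μ)
      (fun p p' q => by
        simp only [add_mul, map_add]
        exact integral_add (integrable_eval hb hμ _) (integrable_eval hb hμ _))
      (fun c p q => by
        simp only [smul_mul_assoc, MvPolynomial.smul_eval, smul_eq_mul, integral_const_mul])
      (fun p q q' => by
        simp only [mul_add, map_add]
        exact integral_add (integrable_eval hb hμ _) (integrable_eval hb hμ _))
      (fun c p q => by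
        simp only [mul_smul_comm, MvPolynomial.smul_eval, smul_eq_mul, integral_const_mul])
  have hBs : ∀ p ∈ s, ∀ q ∈ s, p ≠ q → B p q = 0 := fun p hp q hq hpq => by
    rw [← hs1 p hp q hq hpq]
    simp only [B, LinearMap.mk₂_apply, map_mul]
  have hTs : ∀ p ∈ s, ∃ c : ℝ, polyGenerator G β p = c • p := by
    intro p hp
    obtain ⟨c, hc⟩ := hs2 p hp
    refine ⟨-c, eq_of_eval_eq_of_isOpen hΩ hne fun x hx => ?_⟩
    rw [MvPolynomial.smul_eval, ← hc x hx, eval_polyGenerator, diffusionOp_eval, diffusionOp_eval,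
      hG x hx]
    simp only [hβ x hx]
  have hspan : ∀ p : MvPolynomial (Fin d) ℝ, p ∈ Submodule.span ℝ s := fun p =>
    Submodule.span_mono (fun q hq => hq.1) (hs3 _ p le_rfl)
  suffices h : B.comp (polyGenerator G β) = B.compl₂ (polyGenerator G β) by
    exact LinearMap.congr_fun₂ h p q
  refine LinearMap.ext_on (s := s) (by
    rw [eq_top_iff]; exact fun p _ => hspan p) fun p hp => ?_
  refine LinearMap.ext_on (s := s) (by
    rw [eq_top_iff]; exact fun p _ => hspan p) fun q hq => ?_
  obtain ⟨c, hc⟩ := hTs p hp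
  obtain ⟨e, he⟩ := hTs q hq
  rw [LinearMap.comp_apply, LinearMap.compl₂_apply, hc, he, map_smul, LinearMap.smul_apply, map_smul]
  by_cases hpq : p = q
  · subst hpq
    have hce : c • p = e • p := hc.symm.trans he
    rw [← LinearMap.smul_apply, ← map_smul, hce, map_smul, LinearMap.smul_apply]
  · rw [hBs p hp q hq hpq, smul_zero, smul_zero]

theorem polyGenerator_mul (hG : G.IsSymm) (p q : MvPolynomial (Fin d) ℝ) :
    polyGenerator G β (p * q) =
      p * polyGenerator G β q + q * polyGenerator G β p + 2 * polyGamma G p q := by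
  have h := polyGamma_comm hG p q
  have h2 : 2 * polyGamma G p q = polyGamma G p q + polyGamma G q p := by rw [← h]; ring
  rw [h2]
  simp only [polyGenerator, polyGamma, LinearMap.coe_mk, AddHom.coe_mk, Derivation.leibniz,
    smul_eq_mul, map_add, mul_add, Finset.sum_add_distrib, Finset.mul_sum]
  simp only [mul_comm, mul_left_comm]
  ring

/-- The first order form of the symmetry of the operator. -/
theorem IsPolynomialModel.integral_drift_mul (hm : IsPolynomialModel a Ω g b μ)
    (hΩ : IsOpen Ω) (hne : Ω.Nonempty) (hb : Bornology.IsBounded Ω) (hGs : G.IsSymm)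
    (hG : ∀ x ∈ Ω, g x = evalMetric G x) (hβ : ∀ x ∈ Ω, ∀ i, b x i = eval x (β i))
    (i : Fin d) (R : MvPolynomial (Fin d) ℝ) :
    ∫ x, eval x (β i * R + ∑ j, G i j * pderiv j R) ∂μ = 0 := by
  have := hm.isProbabilityMeasure
  have hμ := hm.ae_mem hΩ
  have hsymm := hm.integral_polyGenerator_mul hΩ hne hb hG hβ
  have hX : polyGenerator G β (MvPolynomial.X i) = β i := by
    simp [polyGenerator, MvPolynomial.pderiv_X, Pi.single_apply, apply_ite]
  have hΓ : polyGamma G (MvPolynomial.X i) R = ∑ j, G i j * pderiv j R := by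
    simp [polyGamma, MvPolynomial.pderiv_X, Pi.single_apply, Finset.sum_ite_irrel]
  have h1 : polyGenerator G β 1 = 0 := by simp [polyGenerator]
  -- Symmetry is tested on the pairs `(x_i R, 1)` and `(x_i, R)`; in the difference `x_i LR` cancels
  -- and twice the first order expression remains.
  have h2 := hsymm (MvPolynomial.X i * R) 1
  have h3 := hsymm (MvPolynomial.X i) R
  rw [h1, mul_zero, mul_one, polyGenerator_mul hGs, hX, hΓ] at h2
  rw [hX] at h3
  have hadd : ∀ p q : MvPolynomial (Fin d) ℝ, ∫ x, eval x (p + q) ∂μ =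
      ∫ x, eval x p ∂μ + ∫ x, eval x q ∂μ := fun p q => by
    simp only [map_add]
    exact integral_add (integrable_eval hb hμ p) (integrable_eval hb hμ q)
  simp only [map_zero, integral_zero, hadd, mul_comm R (β i), ← h3] at h2
  have h4 : ∫ x, eval x (2 * ∑ j, G i j * pderiv j R) ∂μ =
      2 * ∫ x, eval x (∑ j, G i j * pderiv j R) ∂μ := by
    rw [← integral_const_mul]
    simp only [map_mul, map_ofNat]
  rw [h4] at h2
  rw [hadd]
  linarith

/-- If the functional `R ↦ ∫ (γ R + V·∇R) dμ` vanishes on polynomials, it vanishes on the `C¹`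
functions of a polynomial. -/
theorem integral_drift_comp [IsProbabilityMeasure μ] (hμ : ∀ᵐ x ∂μ, x ∈ Ω)
    (hb : Bornology.IsBounded Ω) {γ : MvPolynomial (Fin d) ℝ} {V : Fin d → MvPolynomial (Fin d) ℝ}
    (H : ∀ R, ∫ x, eval x (γ * R + ∑ j, V j * pderiv j R) ∂μ = 0)
    (h : MvPolynomial (Fin d) ℝ) {u : ℝ → ℝ} (hu : ContDiff ℝ 1 u) :
    ∫ x, eval x γ * u (eval x h) +
      eval x (∑ j, V j * pderiv j h) * deriv u (eval x h) ∂μ = 0 := by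
  refine integral_comp_eq_zero hb hμ (continuous_eval _) (continuous_eval _) (continuous_eval _)
    (fun W => ?_) hu
  rw [← H (Polynomial.aeval h W)]
  congr 1
  ext x
  have hev : ∀ W : Polynomial ℝ, eval x (Polynomial.aeval h W) = W.eval (eval x h) := by
    intro W
    rw [← MvPolynomial.coe_aeval_eq_eval, RingHom.coe_coe, ← Polynomial.aeval_algHom_apply,
      Polynomial.coe_aeval_eq_eval]
  simp only [Derivation.map_aeval, smul_eq_mul, map_add, map_mul, map_sum, hev, Finset.sum_mul]
  refine congrArg₂ _ rfl (Finset.sum_congr rfl fun j _ => by ring)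

/-- The squared Euclidean distance to a point. -/
noncomputable def sqDist (y : Fin d → ℝ) : MvPolynomial (Fin d) ℝ :=
  ∑ k, (MvPolynomial.X k - MvPolynomial.C (y k)) ^ 2

theorem eval_sqDist (x y : Fin d → ℝ) : eval x (sqDist y) = ∑ k, (x k - y k) ^ 2 := by
  simp [sqDist]

theorem eval_pderiv_sqDist (x y : Fin d → ℝ) (j : Fin d) :
    eval x (pderiv j (sqDist y)) = 2 * (x j - y j) := by
  simp [sqDist, MvPolynomial.pderiv_X, Pi.single_apply, Derivation.leibniz_pow, apply_ite]

theorem sq_le_eval_sqDist (x y : Fin d → ℝ) : ‖x - y‖ ^ 2 ≤ eval x (sqDist y) := by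
  rw [eval_sqDist]
  have h0 : 0 ≤ ∑ k, (x k - y k) ^ 2 := Finset.sum_nonneg fun k _ => sq_nonneg _
  have h1 : ‖x - y‖ ≤ √(∑ k, (x k - y k) ^ 2) := by
    refine (pi_norm_le_iff_of_nonneg (Real.sqrt_nonneg _)).2 fun k => ?_
    rw [Pi.sub_apply, Real.norm_eq_abs]
    exact Real.abs_le_sqrt
      (Finset.single_le_sum (f := fun k => (x k - y k) ^ 2) (fun k _ => sq_nonneg _)
        (Finset.mem_univ k))
  calc ‖x - y‖ ^ 2 ≤ √(∑ k, (x k - y k) ^ 2) ^ 2 := by gcongr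
    _ = _ := Real.sq_sqrt h0

/-- The drift of a polynomial model is determined by the metric and the density. -/
theorem drift_eq_of_integral_eq_zero (hΩ : IsOpen Ω) (hb : Bornology.IsBounded Ω)
    {ρ : (Fin d → ℝ) → ℝ} (hρ : ContDiffOn ℝ 1 ρ Ω) (hpos : ∀ x ∈ Ω, 0 < ρ x)
    [IsProbabilityMeasure ((volume.restrict Ω).withDensity (fun x => ENNReal.ofReal (ρ x)))]
    {γ : MvPolynomial (Fin d) ℝ} {V : Fin d → MvPolynomial (Fin d) ℝ}
    (H : ∀ R, ∫ x, eval x (γ * R + ∑ j, V j * pderiv j R)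
      ∂((volume.restrict Ω).withDensity (fun x => ENNReal.ofReal (ρ x))) = 0)
    {y : Fin d → ℝ} (hy : y ∈ Ω) :
    ∑ j, partialD j (fun x => ρ x * eval x (V j)) y = ρ y * eval y γ := by
  have hint : IntegrableOn ρ Ω :=
    (integrableOn_iff_withDensity_lt_top hΩ hρ.continuousOn hpos).2 (measure_lt_top _ _)
  have hVs : ∀ j, ContDiffOn ℝ 1 (fun x => ρ x * eval x (V j)) Ω := fun j =>
    hρ.mul (contDiff_eval (V j)).contDiffOn
  set e : (Fin d → ℝ) → ℝ := fun x =>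
    ρ x * eval x γ - ∑ j, partialD j (fun x => ρ x * eval x (V j)) x with he
  have hec : ContinuousOn e Ω := by
    refine (hρ.continuousOn.mul (continuous_eval γ).continuousOn).sub
      (continuousOn_finsetSum _ fun j _ => ?_)
    exact ((hVs j).continuousOn_fderiv_of_isOpen hΩ (by norm_num)).clm_apply continuousOn_const
  suffices h0 : e y = 0 by linarith [sub_eq_zero.1 h0]
  by_contra hne
  have hnear : ∀ᶠ x in 𝓝 y, x ∈ Ω ∧ 0 < e y * e x := by
    refine (hΩ.eventually_mem hy).and ?_
    have h1 : ContinuousAt (fun x => e y * e x) y :=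
      continuousAt_const.mul (hec.continuousAt (hΩ.mem_nhds hy))
    exact h1.eventually (lt_mem_nhds (mul_self_pos.2 hne))
  obtain ⟨r, hr, hball⟩ := Metric.eventually_nhds_iff_ball.1 hnear
  -- The test function `posSq ∘ h` is a bump around `y`, supported where the defect `e` keeps its
  -- sign. Integration by parts gives `∫ e · posSq(h) = 0`, which forces `e y = 0`.
  set h : MvPolynomial (Fin d) ℝ := MvPolynomial.C ((r / 2) ^ 2) - sqDist y with hh
  have hheval : ∀ x, eval x h = (r / 2) ^ 2 - eval x (sqDist y) := fun x => by simp [hh]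
  have hK : ∀ x, 0 < eval x h → x ∈ Metric.closedBall y (r / 2) := by
    intro x hx
    rw [hheval] at hx
    have h1 := sq_le_eval_sqDist x y
    rw [mem_closedBall_iff_norm]
    exact abs_le_of_sq_le_sq' (by linarith) (by positivity) |>.2
  have hKΩ : Metric.closedBall y (r / 2) ⊆ Metric.ball y r :=
    Metric.closedBall_subset_ball (by linarith)
  set f : (Fin d → ℝ) → ℝ := fun x => posSq (eval x h) with hf
  have hfs : ContDiff ℝ 1 f := contDiff_posSq.comp (contDiff_eval h)
  have hf0 : ∀ x, x ∉ Metric.closedBall y (r / 2) → f x = 0 := by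
    intro x hx
    have : eval x h ≤ 0 := not_lt.1 fun hlt => hx (hK x hlt)
    simp [hf, posSq, max_eq_right this]
  have hI := integral_drift_comp (ae_mem_of_withDensity_restrict hΩ _) hb H h contDiff_posSq
  rw [integral_withDensity_restrict hΩ hρ.continuousOn hpos] at hI
  have hdiv := integral_divergence_eq_zero_of_isCompact hΩ
    (isCompact_closedBall y (r / 2)) (hKΩ.trans fun x hx => (hball x hx).1)
    (W := fun j x => (ρ x * eval x (V j)) * f x)
    (fun j => (hVs j).mul hfs.contDiffOn) (fun j x _ hx => by simp [hf0 x hx])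
  set F : (Fin d → ℝ) → ℝ := fun x => ρ x * (eval x γ * posSq (eval x h) +
      eval x (∑ j, V j * pderiv j h) * deriv posSq (eval x h)) with hF
  have hFi : IntegrableOn F Ω := by
    refine IntegrableOn.mul_continuous hΩ hb hint ?_
    exact ((continuous_eval _).mul (contDiff_posSq.continuous.comp (continuous_eval _))).add
      ((continuous_eval _).mul ((contDiff_posSq.continuous_deriv le_rfl).comp (continuous_eval _)))
  have hefi : IntegrableOn (fun x => e x * f x) Ω := by
    have h1 := contDiff_indicator_of_isCompact (n := 0) hΩ (isCompact_closedBall y (r / 2))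
      (hKΩ.trans fun x hx => (hball x hx).1) (f := fun x => e x * f x)
      (contDiffOn_zero.2 (hec.mul hfs.continuous.continuousOn)) (fun x _ hx => by simp [hf0 x hx])
    have h2 := hasCompactSupport_indicator_of_isCompact (Ω := Ω)
      (isCompact_closedBall y (r / 2)) (f := fun x => e x * f x)
      (fun x _ hx => by simp [hf0 x hx])
    exact (integrable_indicator_iff hΩ.measurableSet).1
      (h1.continuous.integrable_of_hasCompactSupport h2)
  have heq : ∀ x ∈ Ω, ∑ j, partialD j (fun x => (ρ x * eval x (V j)) * f x) x =
      F x - e x * f x := by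
    intro x hx
    have hd : ∀ j, DifferentiableAt ℝ (fun x => ρ x * eval x (V j)) x := fun j =>
      ((hVs j).contDiffAt (hΩ.mem_nhds hx)).differentiableAt (by norm_num)
    have hfd : ∀ j, partialD j f x = deriv posSq (eval x h) * eval x (pderiv j h) := by
      intro j
      rw [hf, partialD_comp (hasDerivAt_posSq _).differentiableAt
        (hasFDerivAt_eval h x).differentiableAt, partialD_eval]
    simp only [fun j => partialD_mul (hd j) (hfs.differentiable (by norm_num) x), hfd, hF, he,
      Finset.sum_add_distrib, ← Finset.sum_mul, map_sum, map_mul]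
    simp only [mul_add, sub_mul, Finset.sum_mul, Finset.mul_sum, hf]
    simp only [mul_assoc, mul_left_comm, mul_comm]
    ring
  rw [setIntegral_congr_fun hΩ.measurableSet heq, integral_sub hFi hefi, hI, zero_sub,
    neg_eq_zero] at hdiv
  have hnn : ∀ x ∈ Ω, 0 ≤ e y * (e x * f x) := by
    intro x hx
    rw [← mul_assoc]
    by_cases hxK : x ∈ Metric.closedBall y (r / 2)
    · exact mul_nonneg (hball x (hKΩ hxK)).2.le (sq_nonneg _)
    · rw [hf0 x hxK, mul_zero]
  have hz := eqOn_zero_of_setIntegral_eq_zero hΩ (F := fun x => e y * (e x * f x))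
    (continuousOn_const.mul (hec.mul hfs.continuous.continuousOn)) (hefi.const_mul (e y)) hnn
    (by rw [integral_const_mul, hdiv, mul_zero]) y hy
  have hfy : f y ≠ 0 := by
    have : eval y h = (r / 2) ^ 2 := by rw [hheval, eval_sqDist]; simp
    have h2 : 0 < (r / 2) ^ 2 := by positivity
    simp only [hf, posSq, this, max_eq_left h2.le]
    positivity
  exact mul_ne_zero hne (mul_ne_zero hne hfy) hz

end IntegrationByParts

/-! ### Conormals at regular points, and existence of the reduced equation. -/

section Normal

variable {d : ℕ} {Ω : Set (Fin d → ℝ)}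

open MvPolynomial (pderiv eval)

/-- The linear form `ν` is an outer conormal of `Ω` at `x₀`: outside thin cones around its kernel,
`Ω` coincides near `x₀` with the side where `ν` is negative. -/
def IsConormalAt (Ω : Set (Fin d → ℝ)) (x₀ : Fin d → ℝ) (ν : (Fin d → ℝ) →L[ℝ] ℝ) : Prop :=
  ∀ δ : ℝ, 0 < δ → ∀ᶠ x in 𝓝 x₀, (ν (x - x₀) < -(δ * ‖x - x₀‖) → x ∈ Ω) ∧
    (δ * ‖x - x₀‖ < ν (x - x₀) → x ∉ Ω)

/-- `ν` is the differential of `φ`: continuity forces `φ(x₀) = 0`, and the first order expansion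
fixes the sign of `φ` outside thin cones. -/
theorem IsRegularBoundaryPoint.exists_conormal (hΩ : IsOpen Ω) {x₀ : Fin d → ℝ}
    (h : IsRegularBoundaryPoint Ω x₀) :
    ∃ ν : (Fin d → ℝ) →L[ℝ] ℝ, ν ≠ 0 ∧ IsConormalAt Ω x₀ ν := by
  obtain ⟨hx, φ, hφ, hd, hφΩ⟩ := h
  have hx0 : x₀ ∉ Ω := by
    have := hx.2
    rwa [hΩ.interior_eq] at this
  have h0 : φ x₀ = 0 := by
    apply le_antisymm
    · by_contra! hlt
      have h1 : ∀ᶠ y in 𝓝 x₀, y ∉ Ω := by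
        filter_upwards [hφΩ, hφ.continuousAt.eventually (lt_mem_nhds hlt)] with y hy hy' hyΩ
        exact absurd (hy.1 hyΩ) (not_lt.2 (le_of_lt hy'))
      exact mem_closure_iff_frequently.1 hx.1 h1
    · by_contra! hlt
      exact hx0 (hφΩ.self_of_nhds.2 hlt)
  refine ⟨fderiv ℝ φ x₀, hd, fun δ hδ => ?_⟩
  have h1 := (hφ.differentiableAt (by norm_num)).hasFDerivAt.isLittleO.def hδ
  filter_upwards [hφΩ, h1] with x hx1 hx2
  rw [h0, sub_zero, Real.norm_eq_abs, abs_le] at hx2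
  exact ⟨fun h => hx1.2 (by linarith [hx2.2]), fun h hxΩ => by linarith [hx1.1 hxΩ, hx2.1]⟩

theorem exists_mem_segment_frontier {p q : Fin d → ℝ} (hp : p ∈ Ω) (hq : q ∉ Ω) :
    ∃ θ ∈ Set.Icc (0 : ℝ) 1, p + θ • (q - p) ∈ segment ℝ p q ∧ p + θ • (q - p) ∈ frontier Ω := by
  obtain ⟨z, hz, hzf⟩ : ∃ z ∈ segment ℝ p q, z ∈ frontier Ω := by
    by_contra! h
    have hsub : segment ℝ p q ⊆ interior Ω ∪ (closure Ω)ᶜ := fun z hz => by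
      by_contra hz'
      simp only [Set.mem_union, Set.mem_compl_iff, not_or, not_not] at hz'
      exact h z hz ⟨hz'.2, hz'.1⟩
    have hpi : p ∈ interior Ω := (hsub (left_mem_segment ℝ p q)).resolve_right
      fun hp' => hp' (subset_closure hp)
    have hqi : q ∈ (closure Ω)ᶜ := (hsub (right_mem_segment ℝ p q)).resolve_left
      fun hq' => hq (interior_subset hq')
    obtain ⟨z, -, hz1, hz2⟩ := (convex_segment p q).isPreconnected _ _ isOpen_interior
      isClosed_closure.isOpen_compl hsub ⟨p, left_mem_segment ℝ p q, hpi⟩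
      ⟨q, right_mem_segment ℝ p q, hqi⟩
    exact hz2 (subset_closure (interior_subset hz1))
  have hz' := hz
  rw [segment_eq_image'] at hz'
  obtain ⟨θ, hθ, rfl⟩ := hz'
  exact ⟨θ, hθ, hz, hzf⟩

theorem apply_eq_sum_single (ν : (Fin d → ℝ) →L[ℝ] ℝ) (v : Fin d → ℝ) :
    ν v = ∑ j, v j * ν (Pi.single j 1) := by
  conv_lhs => rw [pi_eq_sum_univ' v]
  simp [map_sum]

/-- Coprime polynomials do not both vanish on a piece of the boundary. -/
theorem IsConormalAt.false_of_isRelPrime {x₀ : Fin d → ℝ} {ν : (Fin d → ℝ) →L[ℝ] ℝ}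
    (hν : IsConormalAt Ω x₀ ν) (hν0 : ν ≠ 0) {p q : MvPolynomial (Fin d) ℝ}
    (hpq : IsRelPrime p q) (h : ∀ᶠ x in 𝓝 x₀, x ∈ frontier Ω → eval x p = 0 ∧ eval x q = 0) :
    False := by
  obtain ⟨j, hj⟩ : ∃ j, ν (Pi.single j 1) ≠ 0 := by
    by_contra! h0
    refine hν0 (ContinuousLinearMap.ext fun v => ?_)
    rw [apply_eq_sum_single]
    simp [h0]
  -- The direction `e_j` is transverse to the boundary, so each line parallel to it near `x₀` meets
  -- `∂Ω` in a common zero of `p` and `q`. There `N` vanishes, and `N` is constant along the line;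
  -- thus `N` vanishes on an open set.
  obtain ⟨N, hN0, -, hNinv, hNmem⟩ := exists_eliminant hpq j
  set v : Fin d → ℝ := Pi.single j (ν (Pi.single j 1))⁻¹ with hv
  have hsm : ∀ t : ℝ, t • v = Pi.single j (t * (ν (Pi.single j 1))⁻¹) := fun t => by
    rw [hv, ← Pi.single_smul, smul_eq_mul]
  have hνv : ν v = 1 := by
    have : v = (ν (Pi.single j 1))⁻¹ • Pi.single j 1 := by
      rw [hv, ← Pi.single_smul, smul_eq_mul, mul_one]
    rw [this, map_smul, smul_eq_mul, inv_mul_cancel₀ hj]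
  -- With this `δ` the points `x₀ ± t v` lie strictly inside the two cones, and so do their small
  -- perturbations.
  obtain ⟨δ, hδ0, hδv⟩ : ∃ δ : ℝ, 0 < δ ∧ δ * ‖v‖ < 1 := by
    refine ⟨1 / (‖v‖ + 1), by positivity, ?_⟩
    rw [div_mul_eq_mul_div, one_mul, div_lt_one (by positivity)]
    linarith
  obtain ⟨r, hr, hball⟩ := Metric.eventually_nhds_iff_ball.1 ((hν δ hδ0).and h)
  obtain ⟨t, ht0, htr⟩ : ∃ t : ℝ, 0 < t ∧ ‖t • v‖ < r := by
    refine ⟨r / (2 * (‖v‖ + 1)), by positivity, ?_⟩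
    rw [norm_smul, Real.norm_of_nonneg (by positivity), div_mul_eq_mul_div,
      div_lt_iff₀ (by positivity)]
    nlinarith [norm_nonneg v]
  have hmem : ∀ᶠ x in 𝓝 x₀, (x - t • v ∈ Metric.ball x₀ r ∧
      ν (x - t • v - x₀) < -(δ * ‖x - t • v - x₀‖)) ∧ (x + t • v ∈ Metric.ball x₀ r ∧
      δ * ‖x + t • v - x₀‖ < ν (x + t • v - x₀)) := by
    have c1 : Continuous fun x : Fin d → ℝ => x - t • v := continuous_id.sub continuous_const
    have c2 : Continuous fun x : Fin d → ℝ => x + t • v := continuous_id.add continuous_const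
    have hlt : δ * ‖t • v‖ < t := by
      rw [norm_smul, Real.norm_of_nonneg ht0.le]; nlinarith
    refine (Filter.Eventually.and ?_ ?_).and (Filter.Eventually.and ?_ ?_)
    · refine (Metric.isOpen_ball.preimage c1).mem_nhds ?_
      simpa [mem_ball_iff_norm] using htr
    · refine (isOpen_lt (ν.continuous.comp (c1.sub continuous_const))
        (continuous_const.mul (c1.sub continuous_const).norm).neg).mem_nhds ?_
      simpa [hνv] using hlt
    · refine (Metric.isOpen_ball.preimage c2).mem_nhds ?_
      simpa [mem_ball_iff_norm] using htr
    · refine (isOpen_lt (continuous_const.mul (c2.sub continuous_const).norm)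
        (ν.continuous.comp (c2.sub continuous_const))).mem_nhds ?_
      simpa [hνv] using hlt
  obtain ⟨U, hU, hUo, hxU⟩ := eventually_nhds_iff.1 hmem
  refine hN0 (eq_zero_of_eval_eq_zero_of_isOpen hUo ⟨x₀, hxU⟩ fun x hx => ?_)
  obtain ⟨⟨h1, h2⟩, h3, h4⟩ := hU x hx
  obtain ⟨θ, -, hz, hzf⟩ :=
    exists_mem_segment_frontier ((hball _ h1).1.1 h2) ((hball _ h3).1.2 h4)
  set z := x - t • v + θ • (x + t • v - (x - t • v)) with hzdef
  have hzb := (convex_ball x₀ r).segment_subset h1 h3 hz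
  obtain ⟨e1, e2⟩ := (hball z hzb).2 hzf
  have hNz : eval z N = 0 := by
    obtain ⟨A, B, hAB⟩ := Ideal.mem_span_pair.1 hNmem
    rw [← hAB]; simp [e1, e2]
  have : z = x + (2 * θ * t - t) • v := by
    rw [hzdef]; module
  rw [this, hsm, hNinv] at hNz
  exact hNz

/-- The gradient of a polynomial that vanishes on the boundary is conormal. -/
theorem IsConormalAt.sum_mul_pderiv_eq_zero {x₀ : Fin d → ℝ} {ν : (Fin d → ℝ) →L[ℝ] ℝ}
    (hν : IsConormalAt Ω x₀ ν) (hν0 : ν ≠ 0) {P : MvPolynomial (Fin d) ℝ}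
    (hx₀ : x₀ ∈ frontier Ω) (hP : ∀ x ∈ frontier Ω, eval x P = 0) {τ : Fin d → ℝ} (hτ : ν τ = 0) :
    ∑ j, τ j * eval x₀ (pderiv j P) = 0 := by
  have key : ∀ τ : Fin d → ℝ, ν τ = 0 → ∑ j, τ j * eval x₀ (pderiv j P) ≤ 0 := by
    intro τ hτ
    by_contra! hpos
    set D : (Fin d → ℝ) →L[ℝ] ℝ := ∑ i, eval x₀ (pderiv i P) •
      (ContinuousLinearMap.proj i : (Fin d → ℝ) →L[ℝ] ℝ) with hD
    have hDP : HasFDerivAt (fun y => eval y P) D x₀ := hasFDerivAt_eval P x₀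
    have hDτ : D τ = ∑ j, τ j * eval x₀ (pderiv j P) := by
      simp [hD, mul_comm]
    rw [← hDτ] at hpos
    obtain ⟨w, hw⟩ : ∃ w, ν w ≠ 0 := by
      by_contra! h0
      exact hν0 (ContinuousLinearMap.ext h0)
    set σ := (ν w)⁻¹ • w with hσ
    have hνσ : ν σ = 1 := by rw [hσ, map_smul, smul_eq_mul, inv_mul_cancel₀ hw]
    -- If `DP(τ) > 0`, then moving `τ` by `sσ` with `|s| ≤ ε` keeps `DP` at least `DP(τ)/2`, while
    -- `ν` takes both signs and a boundary point appears in between.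
    set ε := D τ / (2 * (|D σ| + 1)) with hε
    have hε0 : 0 < ε := by positivity
    have hεσ : ε * |D σ| ≤ D τ / 2 := by
      rw [hε, div_mul_eq_mul_div, div_le_iff₀ (by positivity)]
      nlinarith [abs_nonneg (D σ)]
    set B := ‖τ‖ + ε * ‖σ‖ + 1 with hB
    have hB0 : 0 < B := by positivity
    have hBle : ∀ s : ℝ, |s| ≤ ε → ‖τ + s • σ‖ < B := by
      intro s hs
      refine (norm_add_le _ _).trans_lt ?_
      rw [norm_smul, Real.norm_eq_abs]
      nlinarith [mul_le_mul_of_nonneg_right hs (norm_nonneg σ)]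
    have hη0 : 0 < D τ / (2 * B) := by positivity
    obtain ⟨r, hr, hball⟩ := Metric.eventually_nhds_iff_ball.1
      ((hν (ε / B) (by positivity)).and (hDP.isLittleO.def hη0))
    set t := r / B with ht
    have ht0 : 0 < t := by positivity
    have hin : ∀ s : ℝ, |s| ≤ ε → x₀ + t • (τ + s • σ) ∈ Metric.ball x₀ r := by
      intro s hs
      rw [mem_ball_iff_norm, add_sub_cancel_left, norm_smul, Real.norm_of_nonneg ht0.le, ht,
        div_mul_eq_mul_div, div_lt_iff₀ hB0]
      exact mul_lt_mul_of_pos_left (hBle s hs) hr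
    have habs : |ε| ≤ ε := (abs_of_pos hε0).le
    have habs' : |(-ε)| ≤ ε := by rw [abs_neg]; exact habs
    have hνs : ∀ s : ℝ, ν (x₀ + t • (τ + s • σ) - x₀) = t * s := by
      intro s
      rw [add_sub_cancel_left, map_smul, map_add, map_smul, hτ, hνσ]
      simp
    have hns : ∀ s : ℝ, |s| ≤ ε → ε / B * ‖x₀ + t • (τ + s • σ) - x₀‖ < t * ε := by
      intro s hs
      rw [add_sub_cancel_left, norm_smul, Real.norm_of_nonneg ht0.le, div_mul_eq_mul_div,
        div_lt_iff₀ hB0]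
      have := mul_lt_mul_of_pos_left (hBle s hs) (mul_pos hε0 ht0)
      linarith
    have hpΩ : x₀ + t • (τ + (-ε) • σ) ∈ Ω := by
      refine (hball _ (hin _ habs')).1.1 ?_
      rw [hνs]
      linarith [hns _ habs']
    have hqΩ : x₀ + t • (τ + ε • σ) ∉ Ω := by
      refine (hball _ (hin _ habs)).1.2 ?_
      rw [hνs]
      exact hns _ habs
    obtain ⟨θ, hθ, -, hzf⟩ := exists_mem_segment_frontier hpΩ hqΩ
    set z := x₀ + t • (τ + (-ε) • σ) +
      θ • (x₀ + t • (τ + ε • σ) - (x₀ + t • (τ + (-ε) • σ))) with hθz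
    have hzs : z = x₀ + t • (τ + (2 * θ * ε - ε) • σ) := by
      rw [hθz]; module
    have hs : |2 * θ * ε - ε| ≤ ε := by
      rw [abs_le]; constructor <;> nlinarith [hθ.1, hθ.2]
    -- Both `P(z)` and `P(x₀)` vanish, so the remainder bound limits the linear term at `z`, which
    -- is too large.
    have h1 := (hball z (hzs ▸ hin _ hs)).2
    rw [hP z hzf, hP x₀ hx₀, sub_zero, zero_sub, norm_neg, hzs, add_sub_cancel_left, map_smul,
      map_add, map_smul, norm_smul, norm_smul, Real.norm_of_nonneg ht0.le, Real.norm_eq_abs,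
      smul_eq_mul] at h1
    have h2 : |D τ + (2 * θ * ε - ε) * D σ| ≤ D τ / (2 * B) * ‖τ + (2 * θ * ε - ε) • σ‖ := by
      have : t * |D τ + (2 * θ * ε - ε) * D σ| ≤
          t * (D τ / (2 * B) * ‖τ + (2 * θ * ε - ε) • σ‖) := by linarith
      exact le_of_mul_le_mul_left this ht0
    have h3 : D τ / (2 * B) * ‖τ + (2 * θ * ε - ε) • σ‖ < D τ / 2 := by
      have := mul_lt_mul_of_pos_left (hBle _ hs) hη0
      rwa [show D τ / (2 * B) * B = D τ / 2 by field_simp] at this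
    have h4 : -((2 * θ * ε - ε) * D σ) ≤ D τ / 2 := by
      refine (neg_le_abs _).trans ?_
      rw [abs_mul]
      exact (mul_le_mul_of_nonneg_right hs (abs_nonneg _)).trans hεσ
    linarith [le_abs_self (D τ + (2 * θ * ε - ε) * D σ)]
  refine le_antisymm (key τ hτ) ?_
  have h1 := key (-τ) (by rw [map_neg, hτ, neg_zero])
  simp only [Pi.neg_apply, neg_mul, Finset.sum_neg_distrib] at h1
  linarith

/-- The boundary of a piecewise `C¹` domain contained in an algebraic hypersurface has a reduced
equation. -/
theorem exists_isReducedBoundaryEquation (hΩ : IsPiecewiseC1Domain Ω)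
    {P : MvPolynomial (Fin d) ℝ} (hP0 : P ≠ 0) (hP : ∀ x ∈ frontier Ω, eval x P = 0) :
    ∃ Q : MvPolynomial (Fin d) ℝ, IsReducedBoundaryEquation Ω Q := by
  -- `Q` is minimal for strict divisibility among the nonzero polynomials vanishing on `∂Ω`.
  obtain ⟨Q, ⟨hQ0, hQ⟩, hmin⟩ := (wellFounded_dvdNotUnit
    (α := MvPolynomial (Fin d) ℝ)).has_min
    {p : MvPolynomial (Fin d) ℝ | p ≠ 0 ∧ ∀ x ∈ frontier Ω, eval x p = 0} ⟨P, hP0, hP⟩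
  refine ⟨Q, hQ0, le_antisymm (fun F hF => ?_) ?_⟩
  · rw [mem_vanishingIdeal_frontier] at hF
    rw [Ideal.mem_span_singleton]
    obtain ⟨A, B, c, hrel, rfl, rfl⟩ :=
      UniqueFactorizationMonoid.exists_reduced_factors Q hQ0 F
    -- With `Q = cA` and `F = cB`, the common factor `c` must vanish on `∂Ω`: near a regular point
    -- with `c ≠ 0` the coprime `A` and `B` would both vanish. Minimality then makes `A` a unit.
    have hc : ∀ x ∈ frontier Ω, eval x c = 0 := by
      by_contra! hne
      obtain ⟨x, hx, hcx⟩ := hne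
      obtain ⟨x₀, hx₀c, hx₀⟩ := mem_closure_iff.1 (hΩ.boundary.frontier_subset hx)
        {y | eval y c ≠ 0} (isOpen_ne_fun (continuous_eval c) continuous_const) hcx
      obtain ⟨ν, hν0, hν⟩ := hx₀.exists_conormal hΩ.isOpen
      refine hν.false_of_isRelPrime hν0 hrel ?_
      filter_upwards [(continuous_eval c).continuousAt.eventually_ne hx₀c] with y hy hyf
      have h1 := hQ y hyf
      have h2 := hF y hyf
      rw [map_mul] at h1 h2
      exact ⟨(mul_eq_zero.1 h1).resolve_left hy, (mul_eq_zero.1 h2).resolve_left hy⟩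
    have hc0 : c ≠ 0 := left_ne_zero_of_mul hQ0
    have hA : IsUnit A := by
      by_contra hA
      exact hmin c ⟨hc0, hc⟩ ⟨hc0, A, hA, rfl⟩
    exact mul_dvd_mul_left c hA.dvd
  · rw [Ideal.span_singleton_le_iff_mem, mem_vanishingIdeal_frontier]
    exact hQ

end Normal

/-! ### The metric degenerates in the conormal direction. -/

section Boundary

variable {d : ℕ} {Ω : Set (Fin d → ℝ)}

open MvPolynomial (pderiv eval)

/-- The barrier `ν(x - x₀) + ε - K |x - x₀|²`. -/
noncomputable def barrier (x₀ : Fin d → ℝ) (ν : (Fin d → ℝ) →L[ℝ] ℝ) (ε K : ℝ) :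
    MvPolynomial (Fin d) ℝ :=
  ∑ j, MvPolynomial.C (ν (Pi.single j 1)) * (MvPolynomial.X j - MvPolynomial.C (x₀ j)) +
    MvPolynomial.C ε - MvPolynomial.C K * sqDist x₀

theorem eval_barrier (x₀ : Fin d → ℝ) (ν : (Fin d → ℝ) →L[ℝ] ℝ) (ε K : ℝ) (x : Fin d → ℝ) :
    eval x (barrier x₀ ν ε K) = ν (x - x₀) + ε - K * eval x (sqDist x₀) := by
  rw [apply_eq_sum_single ν (x - x₀)]
  simp [barrier, mul_comm]

theorem eval_pderiv_barrier (x₀ : Fin d → ℝ) (ν : (Fin d → ℝ) →L[ℝ] ℝ) (ε K : ℝ)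
    (x : Fin d → ℝ) (j : Fin d) :
    eval x (pderiv j (barrier x₀ ν ε K)) = ν (Pi.single j 1) - 2 * K * (x j - x₀ j) := by
  have h := eval_pderiv_sqDist x x₀ j
  simp only [barrier, map_sub, map_add, map_sum, Derivation.leibniz, smul_eq_mul,
    MvPolynomial.pderiv_C, MvPolynomial.pderiv_X, map_mul, h, MvPolynomial.eval_C, map_zero,
    MvPolynomial.eval_X]
  simp [Pi.single_apply, apply_ite]
  ring

theorem exists_bound_eval (hb : Bornology.IsBounded Ω) (p : MvPolynomial (Fin d) ℝ) :
    ∃ C : ℝ, 0 ≤ C ∧ ∀ x ∈ Ω, |eval x p| ≤ C := by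
  obtain ⟨C, hC⟩ := hb.isCompact_closure.exists_bound_of_continuousOn
    (continuous_eval p).continuousOn
  exact ⟨max C 0, le_max_right _ _, fun x hx => (hC x (subset_closure hx)).trans (le_max_left _ _)⟩

/-- If `∫ (γ R + V·∇R) ρ dx = 0` for all polynomials `R`, then the field `V` does not point
outwards at the boundary. -/
theorem IsConormalAt.sum_mul_apply_le_zero (hΩ : IsOpen Ω) (hb : Bornology.IsBounded Ω)
    {ρ : (Fin d → ℝ) → ℝ} (hρ : ContinuousOn ρ Ω) (hpos : ∀ x ∈ Ω, 0 < ρ x)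
    [IsProbabilityMeasure ((volume.restrict Ω).withDensity (fun x => ENNReal.ofReal (ρ x)))]
    {γ : MvPolynomial (Fin d) ℝ} {V : Fin d → MvPolynomial (Fin d) ℝ}
    (H : ∀ R, ∫ x, eval x (γ * R + ∑ j, V j * pderiv j R)
      ∂((volume.restrict Ω).withDensity (fun x => ENNReal.ofReal (ρ x))) = 0)
    {x₀ : Fin d → ℝ} (hx₀ : x₀ ∈ closure Ω) {ν : (Fin d → ℝ) →L[ℝ] ℝ}
    (hν : IsConormalAt Ω x₀ ν) : ∑ j, eval x₀ (V j) * ν (Pi.single j 1) ≤ 0 := by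
  by_contra! hc
  have hint : IntegrableOn ρ Ω :=
    (integrableOn_iff_withDensity_lt_top hΩ hρ hpos).2 (measure_lt_top _ _)
  set S : (Fin d → ℝ) → ℝ := fun x => ∑ j, eval x (V j) * ν (Pi.single j 1) with hS
  set c := S x₀ with hcdef
  have hSc : Continuous S :=
    continuous_finsetSum _ fun j _ => (continuous_eval (V j)).mul continuous_const
  obtain ⟨B, hB0, hB⟩ := exists_bound_eval hb γ
  choose A' hA'0 hA' using fun j => exists_bound_eval hb (V j)
  set A := ∑ j, A' j with hA
  have hA0 : 0 ≤ A := Finset.sum_nonneg fun j _ => hA'0 j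
  have hAle : ∀ x ∈ Ω, ∑ j, eval x (V j) * (x j - x₀ j) ≤ A * ‖x - x₀‖ := by
    intro x hx
    rw [hA, Finset.sum_mul]
    refine Finset.sum_le_sum fun j _ => (le_abs_self _).trans ?_
    rw [abs_mul]
    exact mul_le_mul (hA' j x hx) (norm_le_pi_norm (x - x₀) j) (abs_nonneg _) (hA'0 j)
  -- `16Aδ ≤ c` absorbs the quadratic part of the barrier in `V·∇h`, and `8Bδ ≤ c` absorbs the zero
  -- order term `γ h`.
  obtain ⟨δ, hδ0, hδA, hδB⟩ : ∃ δ : ℝ, 0 < δ ∧ 16 * A * δ ≤ c ∧ 8 * B * δ ≤ c := by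
    refine ⟨c / (16 * A + 8 * B + 1), by positivity, ?_, ?_⟩ <;>
    · rw [mul_div_assoc', div_le_iff₀ (by positivity)]
      nlinarith
  obtain ⟨r', hr', hball⟩ := Metric.eventually_nhds_iff_ball.1
    ((hν δ hδ0).and (hSc.continuousAt.eventually (lt_mem_nhds (half_lt_self hc))))
  set r := min r' 1 with hr
  have hr0 : 0 < r := by positivity
  -- Together with `ε ≤ r`, this `K` confines `{h > 0}` to the ball of radius `r`.
  set K := (‖ν‖ + 1) / r with hK
  have hK0 : 0 < K := by positivity
  -- In `Ω` near `x₀` one has `ν(x - x₀) ≤ δn` with `n = ‖x - x₀‖`, so `h > 0` gives `(Kn)² < δKn +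
  -- Kε ≤ δKn + 2δ²`, that is `Kn < 2δ`.
  set ε := min (min δ r) (2 * δ ^ 2 / K) with hε
  have hε0 : 0 < ε := by positivity
  have hεδ : ε ≤ δ := (min_le_left _ _).trans (min_le_left _ _)
  have hεr : ε ≤ r := (min_le_left _ _).trans (min_le_right _ _)
  have hεK : K * ε ≤ 2 * δ ^ 2 := by
    have : ε ≤ 2 * δ ^ 2 / K := min_le_right _ _
    rwa [le_div_iff₀ hK0, mul_comm] at this
  set h := barrier x₀ ν ε K with hh
  have hle : ∀ x, eval x h ≤ ν (x - x₀) + ε - K * ‖x - x₀‖ ^ 2 := by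
    intro x
    rw [hh, eval_barrier]
    have := mul_le_mul_of_nonneg_left (sq_le_eval_sqDist x x₀) hK0.le
    linarith
  have hVh : ∀ x, eval x (∑ j, V j * pderiv j h) =
      S x - 2 * K * ∑ j, eval x (V j) * (x j - x₀ j) := by
    intro x
    simp only [map_sum, map_mul, hh, eval_pderiv_barrier, hS, Finset.mul_sum,
      ← Finset.sum_sub_distrib]
    exact Finset.sum_congr rfl fun j _ => by ring
  -- On the cap `Ω ∩ {h > 0}` the barrier is small and `V·∇h ≥ c/4`, so the integrand for `posSq ∘
  -- h` is positive there, against its zero integral.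
  have hmain : ∀ x ∈ Ω, 0 < eval x h → c / 4 ≤ eval x (∑ j, V j * pderiv j h) ∧
      eval x h ≤ 2 * δ := by
    intro x hx hpos
    have h1 := hle x
    set n := ‖x - x₀‖ with hn
    have hn0 : 0 ≤ n := norm_nonneg _
    have hnr : n < r := by
      by_contra! hge
      have h2 : ν (x - x₀) ≤ ‖ν‖ * n := (le_abs_self _).trans (ν.le_opNorm _)
      have h3 : (‖ν‖ + 1) * n ≤ K * n ^ 2 := by
        rw [hK, div_mul_eq_mul_div, le_div_iff₀ hr0]
        have : 0 ≤ (‖ν‖ + 1) * n := by positivity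
        nlinarith
      linarith
    have hxb : x ∈ Metric.ball x₀ r' := by
      rw [mem_ball_iff_norm]
      exact hnr.trans_le (min_le_left _ _)
    obtain ⟨⟨-, hb1⟩, hb2⟩ := hball x hxb
    have hνx : ν (x - x₀) ≤ δ * n := not_lt.1 fun hlt => hb1 hlt hx
    have hKn : K * n ≤ 2 * δ := by
      by_contra! hgt
      have h2 : 0 < K * (δ * n + ε - K * n ^ 2) := mul_pos hK0 (by linarith)
      nlinarith
    constructor
    · rw [hVh]
      have h3 := mul_le_mul_of_nonneg_left (hAle x hx) (by positivity : 0 ≤ 2 * K)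
      have h4 := mul_le_mul_of_nonneg_left hKn hA0
      have h5 : c / 2 < S x := hb2
      linarith
    · have : r ≤ 1 := min_le_right _ _
      nlinarith [mul_nonneg hK0.le (sq_nonneg n)]
  have hI := integral_drift_comp (ae_mem_of_withDensity_restrict hΩ _) hb H h contDiff_posSq
  rw [integral_withDensity_restrict hΩ hρ hpos] at hI
  have hcF : Continuous fun x => eval x γ * posSq (eval x h) +
      eval x (∑ j, V j * pderiv j h) * deriv posSq (eval x h) :=
    ((continuous_eval _).mul (contDiff_posSq.continuous.comp (continuous_eval _))).add
      ((continuous_eval _).mul ((contDiff_posSq.continuous_deriv le_rfl).comp (continuous_eval _)))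
  have hposF : ∀ x ∈ Ω, 0 < eval x h → 0 < ρ x * (eval x γ * posSq (eval x h) +
      eval x (∑ j, V j * pderiv j h) * deriv posSq (eval x h)) := by
    intro x hx hx0
    obtain ⟨h1, h2⟩ := hmain x hx hx0
    refine mul_pos (hpos x hx) ?_
    rw [deriv_posSq]
    simp only [posSq, max_eq_left hx0.le]
    have h3 := neg_le_of_abs_le (hB x hx)
    have h4 : 0 < eval x γ * eval x h + 2 * eval x (∑ j, V j * pderiv j h) := by
      have h5 : -B * eval x h ≤ eval x γ * eval x h := mul_le_mul_of_nonneg_right h3 hx0.le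
      have h6 : B * eval x h ≤ B * (2 * δ) := mul_le_mul_of_nonneg_left h2 hB0
      linarith
    have := mul_pos hx0 h4
    linarith
  have hz := eqOn_zero_of_setIntegral_eq_zero hΩ (hρ.mul hcF.continuousOn)
    (IntegrableOn.mul_continuous hΩ hb hint hcF) (fun x hx => by
      rcases lt_or_ge 0 (eval x h) with hx0 | hx0
      · exact (hposF x hx hx0).le
      · rw [deriv_posSq]
        simp [posSq, max_eq_right hx0]) hI
  have hx0 : 0 < eval x₀ h := by
    rw [hh, eval_barrier, eval_sqDist]
    simpa using hε0
  obtain ⟨y, hy, hyΩ⟩ := mem_closure_iff.1 hx₀ {y | 0 < eval y h}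
    (isOpen_lt continuous_const (continuous_eval h)) hx0
  exact (hposF y hyΩ hy).ne' (hz y hyΩ)

/-- If `∫ (γ R + V·∇R) ρ dx = 0` for all polynomials `R`, then the field `V` is tangent to the
boundary. -/
theorem IsConormalAt.sum_mul_apply_eq_zero (hΩ : IsOpen Ω) (hb : Bornology.IsBounded Ω)
    {ρ : (Fin d → ℝ) → ℝ} (hρ : ContinuousOn ρ Ω) (hpos : ∀ x ∈ Ω, 0 < ρ x)
    [IsProbabilityMeasure ((volume.restrict Ω).withDensity (fun x => ENNReal.ofReal (ρ x)))]
    {γ : MvPolynomial (Fin d) ℝ} {V : Fin d → MvPolynomial (Fin d) ℝ}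
    (H : ∀ R, ∫ x, eval x (γ * R + ∑ j, V j * pderiv j R)
      ∂((volume.restrict Ω).withDensity (fun x => ENNReal.ofReal (ρ x))) = 0)
    {x₀ : Fin d → ℝ} (hx₀ : x₀ ∈ closure Ω) {ν : (Fin d → ℝ) →L[ℝ] ℝ}
    (hν : IsConormalAt Ω x₀ ν) : ∑ j, eval x₀ (V j) * ν (Pi.single j 1) = 0 := by
  refine le_antisymm (hν.sum_mul_apply_le_zero hΩ hb hρ hpos H hx₀) ?_
  have h1 := hν.sum_mul_apply_le_zero hΩ hb hρ hpos (γ := -γ) (V := fun j => -V j) (fun R => by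
    have : ∀ x, eval x (-γ * R + ∑ j, -V j * pderiv j R) =
        -eval x (γ * R + ∑ j, V j * pderiv j R) := fun x => by
      rw [← map_neg]
      congr 1
      simp only [neg_mul, Finset.sum_neg_distrib]
      ring
    simp only [this, integral_neg, H R, neg_zero]) hx₀
  simp only [map_neg, neg_mul, Finset.sum_neg_distrib] at h1
  linarith

variable {a : Fin d → ℕ} {g : (Fin d → ℝ) → Matrix (Fin d) (Fin d) ℝ}
  {b : (Fin d → ℝ) → Fin d → ℝ} {μ : Measure (Fin d → ℝ)}
  {G : Matrix (Fin d) (Fin d) (MvPolynomial (Fin d) ℝ)} {β : Fin d → MvPolynomial (Fin d) ℝ}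

/-- The metric of a polynomial model degenerates in the conormal direction. -/
theorem IsPolynomialModel.sum_mul_conormal_eq_zero (hm : IsPolynomialModel a Ω g b μ)
    (hΩ : IsOpen Ω) (hne : Ω.Nonempty) (hb : Bornology.IsBounded Ω) (hGs : G.IsSymm)
    (hG : ∀ x ∈ Ω, g x = evalMetric G x) (hβ : ∀ x ∈ Ω, ∀ i, b x i = eval x (β i))
    {x₀ : Fin d → ℝ} (hx₀ : x₀ ∈ closure Ω) {ν : (Fin d → ℝ) →L[ℝ] ℝ}
    (hν : IsConormalAt Ω x₀ ν) (i : Fin d) :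
    ∑ j, eval x₀ (G i j) * ν (Pi.single j 1) = 0 := by
  have H := hm.integral_drift_mul hΩ hne hb hGs hG hβ i
  have hp := hm.isProbabilityMeasure
  obtain ⟨ρ, hρ, hpos, rfl⟩ := hm.density
  exact hν.sum_mul_apply_eq_zero hΩ hb hρ.continuousOn hpos H hx₀

theorem eval_eq_zero_of_regular (hΩ : IsPiecewiseC1Domain Ω) {P : MvPolynomial (Fin d) ℝ}
    (h : ∀ x, IsRegularBoundaryPoint Ω x → eval x P = 0) : ∀ x ∈ frontier Ω, eval x P = 0 :=
  fun _ hx => closure_minimal (t := {y | eval y P = 0}) h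
    (isClosed_eq (continuous_eval P) continuous_const) (hΩ.boundary.frontier_subset hx)

/-- At a regular point the conormal is a nonzero null vector of the matrix. -/
theorem IsPolynomialModel.det_eval_eq_zero (hm : IsPolynomialModel a Ω g b μ)
    (hΩ : IsPiecewiseC1Domain Ω) (hGs : G.IsSymm)
    (hG : ∀ x ∈ Ω, g x = evalMetric G x) (hβ : ∀ x ∈ Ω, ∀ i, b x i = eval x (β i)) :
    ∀ x ∈ frontier Ω, eval x G.det = 0 := by
  refine eval_eq_zero_of_regular hΩ fun x hx => ?_
  obtain ⟨ν, hν0, hν⟩ := hx.exists_conormal hΩ.isOpen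
  rw [eval_det_eq]
  refine Matrix.exists_mulVec_eq_zero_iff.1 ⟨fun j => ν (Pi.single j 1), fun h0 => hν0 ?_, ?_⟩
  · refine ContinuousLinearMap.ext fun v => ?_
    rw [apply_eq_sum_single]
    simp [congrFun h0]
  · ext i
    exact hm.sum_mul_conormal_eq_zero hΩ.isOpen hΩ.isConnected.nonempty hΩ.isBounded hGs hG hβ
      hx.1.1 hν i

/-- The boundary equations hold for a polynomial model. -/
theorem IsPolynomialModel.exists_solvesBoundaryEquation (hm : IsPolynomialModel a Ω g b μ)
    (hΩ : IsPiecewiseC1Domain Ω) {Q : MvPolynomial (Fin d) ℝ}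
    (hQ : IsReducedBoundaryEquation Ω Q) : ∃ G L, SolvesBoundaryEquation a Ω Q G L := by
  obtain ⟨G, β, hGs, hdeg, -, hG, hβ⟩ := hm.exists_coefficients
  -- At regular points the rows of `g` annihilate the conormal, hence also the gradient of `Q`.
  have h : ∀ i, Q ∣ ∑ j, G i j * pderiv j Q := by
    intro i
    rw [hQ.dvd_iff]
    refine eval_eq_zero_of_regular hΩ fun x hx => ?_
    obtain ⟨ν, hν0, hν⟩ := hx.exists_conormal hΩ.isOpen
    have h1 := hm.sum_mul_conormal_eq_zero hΩ.isOpen hΩ.isConnected.nonempty hΩ.isBounded hGs hG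
      hβ hx.1.1 hν i
    rw [map_sum]
    simp only [map_mul]
    exact hν.sum_mul_pderiv_eq_zero hν0 hx.1 (fun y hy => hQ.eval_eq_zero hy)
      (τ := fun j => eval x (G i j)) (by rw [apply_eq_sum_single]; exact h1)
  choose L hL using h
  refine ⟨G, L, hGs, hdeg, fun i => weightedTotalDegree_le_of_mul_le a hQ.1 ?_,
    fun i => by rw [hL i, mul_comm], fun x hx => hG x hx ▸ hm.posDef x hx⟩
  rw [mul_comm, ← hL i]
  exact Submodule.sum_mem (weightedDegreeLE a (a i + Q.weightedTotalDegree a))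
    fun j _ => mul_pderiv_mem a (hdeg i j) ((mem_weightedDegreeLE a).2 le_rfl)

/-- A solution of the boundary equations makes the domain admissible. -/
theorem SolvesBoundaryEquation.isAdmissible (ha : ∀ i, 0 < a i) (hΩ : IsPiecewiseC1Domain Ω)
    {Q : MvPolynomial (Fin d) ℝ} {L : Fin d → MvPolynomial (Fin d) ℝ}
    (hQ : IsReducedBoundaryEquation Ω Q) (hS : SolvesBoundaryEquation a Ω Q G L) :
    IsAdmissible a Ω := by
  -- The uniform density is the product over an empty family, and `N = 0` for it.
  have hw : factorWeight (Fin.elim0 : Fin 0 → MvPolynomial (Fin d) ℝ) (fun _ => 0) =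
      fun _ => 1 := funext fun x => by simp [factorWeight]
  obtain ⟨hprob, c, hc, heq⟩ := normalizedMeasure_withDensity
    (factorMeasure_zero_lt_top (q := (Fin.elim0 : Fin 0 → MvPolynomial (Fin d) ℝ)) hΩ.isBounded)
    (withDensity_restrict_ne_zero hΩ.isOpen hΩ.isConnected.nonempty
      (hw ▸ continuousOn_const) (by simp [hw]))
  rw [heq] at hprob
  refine ⟨hΩ, _, _, _, isPolynomialModel_of_density (N := 0) ha hΩ.isOpen
    hΩ.isConnected.nonempty hΩ.isBounded (fun x hx => hQ.eval_eq_zero hx)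
    (fun x hx => hS.eval_ne_zero hQ hx) hS ?_ ?_ hprob (fun i => Submodule.zero_mem _) ?_⟩
  · simpa [hw] using contDiffOn_const
  · simpa [hw] using fun _ _ => hc
  · intro i x _
    simp [hw, partialD]

end Boundary

/-! ### Closed rational forms with simple poles. -/

section LogarithmicForm

variable {d : ℕ} {Ω : Set (Fin d → ℝ)} {m : ℕ} {q : Fin m → MvPolynomial (Fin d) ℝ}
  {A : Fin d → MvPolynomial (Fin d) ℝ} {Q : MvPolynomial (Fin d) ℝ}

open MvPolynomial (pderiv eval)

theorem pderiv_pderiv_comm (i j : Fin d) (p : MvPolynomial (Fin d) ℝ) :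
    pderiv i (pderiv j p) = pderiv j (pderiv i p) := by
  have h : ⁅(pderiv i : Derivation ℝ (MvPolynomial (Fin d) ℝ) (MvPolynomial (Fin d) ℝ)),
      (pderiv j : Derivation ℝ (MvPolynomial (Fin d) ℝ) (MvPolynomial (Fin d) ℝ))⁆ = 0 := by
    apply MvPolynomial.derivation_ext
    intro k
    rw [Derivation.commutator_apply, MvPolynomial.pderiv_X, MvPolynomial.pderiv_X]
    simp only [Pi.single_apply]
    split_ifs <;> simp
  have := congrArg (fun D => D p) h
  simpa [Derivation.commutator_apply, sub_eq_zero] using this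

/-- A polynomial all of whose derivatives vanish at a point is zero. -/
theorem eq_zero_of_forall_pderiv_mem {x₀ : Fin d → ℝ} {S : Set (MvPolynomial (Fin d) ℝ)}
    (hS : ∀ p ∈ S, ∀ i, pderiv i p ∈ S) (h0 : ∀ p ∈ S, eval x₀ p = 0)
    {p : MvPolynomial (Fin d) ℝ} (hp : p ∈ S) : p = 0 := by
  induction hn : p.weightedTotalDegree (fun _ => 1) using Nat.strong_induction_on
    generalizing p with
  | _ n ih =>
    have h1 : ∀ i, pderiv i p = 0 := by
      intro i
      by_contra hne
      have h2 := weightedTotalDegree_pderiv (fun _ => 1) i hne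
      exact hne (ih _ (by omega) (hS p hp i) rfl)
    obtain ⟨c, rfl⟩ := exists_eq_C_of_pderiv_eq_zero h1
    have := h0 _ hp
    rw [MvPolynomial.eval_C] at this
    rw [this, map_zero]

/-- The derivation `∂_jQ ∂_i - ∂_iQ ∂_j` along the level sets of `Q`. -/
noncomputable def tangentDerivation (Q : MvPolynomial (Fin d) ℝ) (i j : Fin d) :
    Derivation ℝ (MvPolynomial (Fin d) ℝ) (MvPolynomial (Fin d) ℝ) :=
  pderiv j Q • pderiv i - pderiv i Q • pderiv j

theorem tangentDerivation_apply (i j : Fin d) (p : MvPolynomial (Fin d) ℝ) :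
    tangentDerivation Q i j p = pderiv j Q * pderiv i p - pderiv i Q * pderiv j p := by
  simp [tangentDerivation]

theorem tangentDerivation_self (i j : Fin d) : tangentDerivation Q i j Q = 0 := by
  rw [tangentDerivation_apply]; ring

/-- If `A / Q` is a closed form, then `Q` divides `∂_jQ · T A_j - A_j · T(∂_jQ)` for the
derivations `T` along the level sets of `Q`. -/
theorem dvd_tangentDerivation_sub
    (hA : ∀ i j, Q * (pderiv i (A j) - pderiv j (A i)) = A j * pderiv i Q - A i * pderiv j Q)
    (i j : Fin d) : Q ∣ pderiv j Q * tangentDerivation Q i j (A j) -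
      A j * tangentDerivation Q i j (pderiv j Q) := by
  have h1 := hA i j
  have h2 := congrArg (pderiv j) h1
  simp only [Derivation.leibniz, smul_eq_mul, map_sub] at h2
  rw [pderiv_pderiv_comm j i Q] at h2
  simp only [tangentDerivation_apply]
  refine ⟨-pderiv j Q * (pderiv j (pderiv i (A j)) - pderiv j (pderiv j (A i))) +
    pderiv j (pderiv j Q) * (pderiv i (A j) - pderiv j (A i)), ?_⟩
  linear_combination (-pderiv j (pderiv j Q)) * h1 + pderiv j Q * h2

/-- The polynomials that belong, near `x₀`, to the ideal `I`. -/
def localContraction (x₀ : Fin d → ℝ) (I : Ideal (MvPolynomial (Fin d) ℝ)) :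
    Ideal (MvPolynomial (Fin d) ℝ) where
  carrier := {f | ∃ h, eval x₀ h ≠ 0 ∧ h * f ∈ I}
  zero_mem' := ⟨1, by simp, by simp⟩
  add_mem' := by
    rintro f g ⟨h, hh, hf⟩ ⟨k, hk, hg⟩
    refine ⟨h * k, by rw [map_mul]; exact mul_ne_zero hh hk, ?_⟩
    have : h * k * (f + g) = k * (h * f) + h * (k * g) := by ring
    rw [this]
    exact I.add_mem (I.mul_mem_left _ hf) (I.mul_mem_left _ hg)
  smul_mem' := by
    rintro c f ⟨h, hh, hf⟩
    refine ⟨h, hh, ?_⟩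
    rw [smul_eq_mul, mul_left_comm]
    exact I.mul_mem_left _ hf

/-- `D` is invertible near `x₀`, so by the Leibniz rule it suffices that `T` sends both generators
into the ideal locally. -/
theorem derivation_mem_localContraction {x₀ : Fin d → ℝ} {F Q D : MvPolynomial (Fin d) ℝ}
    (T : Derivation ℝ (MvPolynomial (Fin d) ℝ) (MvPolynomial (Fin d) ℝ)) (hD : eval x₀ D ≠ 0)
    (hF : D * T F ∈ Ideal.span {F, Q}) (hQ : T Q = 0) {f : MvPolynomial (Fin d) ℝ}
    (hf : f ∈ localContraction x₀ (Ideal.span {F, Q})) :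
    T f ∈ localContraction x₀ (Ideal.span {F, Q}) := by
  obtain ⟨h, hh, hmem⟩ := hf
  -- The second factor `h` turns the Leibniz term `f T(h)` into a multiple of `hf`.
  refine ⟨D * h * h, by simp only [map_mul]; exact mul_ne_zero (mul_ne_zero hD hh) hh, ?_⟩
  obtain ⟨u, w, huw⟩ := Ideal.mem_span_pair.1 hmem
  have h1 := congrArg T huw
  simp only [map_add, Derivation.leibniz, smul_eq_mul, hQ] at h1
  have h2 : D * h * h * T f = h * u * (D * T F) + h * D * T u * F + h * D * T w * Q -
      D * T h * (h * f) := by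
    linear_combination (-(h * D)) * h1
  rw [h2]
  have hFm : F ∈ Ideal.span {F, Q} := Ideal.subset_span (by simp)
  have hQm : Q ∈ Ideal.span {F, Q} := Ideal.subset_span (by simp)
  exact Ideal.sub_mem _ (Ideal.add_mem _ (Ideal.add_mem _ (Ideal.mul_mem_left _ _ hF)
    (Ideal.mul_mem_left _ _ hFm)) (Ideal.mul_mem_left _ _ hQm)) (Ideal.mul_mem_left _ _ hmem)

/-- A closed form `A / Q` has a constant residue along each component of the boundary. -/
theorem IsReducedBoundaryEquation.exists_residue
    (hQ : IsReducedBoundaryEquation Ω (∏ k, q k)) (hq : ∀ k, Irreducible (q k))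
    (hA : ∀ i j, (∏ k, q k) * (pderiv i (A j) - pderiv j (A i)) =
      A j * pderiv i (∏ k, q k) - A i * pderiv j (∏ k, q k)) (k : Fin m) :
    ∃ r : ℝ, ∀ i, q k ∣ A i - r • pderiv i (∏ k, q k) := by
  obtain ⟨j, hj⟩ := exists_not_dvd_pderiv (hq k)
  have hkQ : q k ∣ ∏ l, q l := Finset.dvd_prod_of_mem q (Finset.mem_univ k)
  -- A boundary point that lies on `{q_k = 0}` alone among the factors, with `∂_j q_k ≠ 0`;
  -- otherwise `q_k` would divide the cofactor or `∂_j q_k`.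
  obtain ⟨x₀, hx₀, hne⟩ : ∃ x₀ ∈ frontier Ω, eval x₀ (cofactor q k * pderiv j (q k)) ≠ 0 := by
    by_contra! h
    rcases (hq k).prime.dvd_or_dvd (hkQ.trans (hQ.dvd_iff.2 h)) with h1 | h1
    · exact hQ.not_dvd_cofactor hq k h1
    · exact hj h1
  have hprod : ∀ i, pderiv i (∏ l, q l) =
      cofactor q k * pderiv i (q k) + q k * pderiv i (cofactor q k) := pderiv_prod_eq q k
  have hc0 : eval x₀ (cofactor q k) ≠ 0 := fun h => hne (by rw [map_mul, h, zero_mul])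
  have hQ0 := hQ.eval_eq_zero hx₀
  have hk0 : eval x₀ (q k) = 0 := by
    have h := hQ0
    rw [← mul_cofactor q k, map_mul] at h
    exact (mul_eq_zero.1 h).resolve_right hc0
  have hD0 : eval x₀ (pderiv j (∏ l, q l)) ≠ 0 := by
    rw [hprod, map_add, map_mul (eval x₀) (q k), hk0, zero_mul, add_zero]
    exact hne
  have hqc : cofactor q k * q k = ∏ l, q l := by rw [mul_comm, mul_cofactor]
  generalize ∏ l, q l = Q at *
  -- The residue is read off at `x₀`. Subtracting `r dQ` keeps `A/Q` closed and makes the `j`-th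
  -- component vanish at `x₀`.
  set r := eval x₀ (A j) / eval x₀ (pderiv j Q) with hr
  set B : Fin d → MvPolynomial (Fin d) ℝ := fun i => A i - r • pderiv i Q with hBdef
  have hB : ∀ i j, Q * (pderiv i (B j) - pderiv j (B i)) = B j * pderiv i Q - B i * pderiv j Q := by
    intro i j
    have h := pderiv_pderiv_comm i j Q
    simp only [hBdef, map_sub, Derivation.map_smul]
    simp only [MvPolynomial.smul_eq_C_mul]
    linear_combination hA i j - MvPolynomial.C r * Q * h
  have hBj : eval x₀ (B j) = 0 := by
    simp only [hBdef, map_sub, MvPolynomial.smul_eval, hr]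
    field_simp
    ring
  -- Otherwise let `N` be the eliminant of `q_k` and `B_j`. It lies locally in `(B_j, Q)`, which the
  -- derivations along the level sets of `Q` preserve, and on polynomials free of `x_j` these act as
  -- `∂_jQ ∂_i`. So all derivatives of `N` vanish at `x₀`, and `N = 0`.
  have hdvd : q k ∣ B j := by
    by_contra hnd
    obtain ⟨N, hN0, hNj, -, hNmem⟩ :=
      exists_eliminant ((hq k).isRelPrime_iff_not_dvd.2 hnd) j
    refine hN0 (eq_zero_of_forall_pderiv_mem (x₀ := x₀)
      (S := {f | f ∈ localContraction x₀ (Ideal.span {B j, Q}) ∧ pderiv j f = 0})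
      (fun f hf i => ⟨?_, ?_⟩) (fun f hf => ?_) ⟨?_, hNj⟩)
    · have h1 := derivation_mem_localContraction (tangentDerivation Q i j) hD0 (F := B j) (Q := Q)
        (by
          obtain ⟨c, hc⟩ := dvd_tangentDerivation_sub hB i j
          rw [Ideal.mem_span_pair]
          exact ⟨tangentDerivation Q i j (pderiv j Q), c, by linear_combination -hc⟩)
        (tangentDerivation_self i j) hf.1
      rw [tangentDerivation_apply, hf.2, mul_zero, sub_zero] at h1
      obtain ⟨h, hh, hmem⟩ := h1
      exact ⟨h * pderiv j Q, by rw [map_mul]; exact mul_ne_zero hh hD0, by rwa [mul_assoc]⟩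
    · rw [pderiv_pderiv_comm, hf.2, map_zero]
    · obtain ⟨⟨h, hh, hmem⟩, -⟩ := hf
      obtain ⟨u, w, huw⟩ := Ideal.mem_span_pair.1 hmem
      have h1 := congrArg (eval x₀) huw
      rw [map_add, map_mul, map_mul, map_mul, hBj, hQ0, mul_zero, mul_zero, add_zero] at h1
      exact (mul_eq_zero.1 h1.symm).resolve_left hh
    · refine (Ideal.span_le.2 ?_ : Ideal.span {q k, B j} ≤ _) hNmem
      rintro f (rfl | rfl)
      · exact ⟨cofactor q k, hc0, by rw [hqc]; exact Ideal.subset_span (by simp)⟩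
      · exact ⟨1, by simp, by rw [one_mul]; exact Ideal.subset_span (by simp)⟩
  refine ⟨r, fun i => ?_⟩
  -- Closedness gives `B_i ∂_jQ = B_j ∂_iQ` modulo `Q`, and `q_k` does not divide `∂_jQ`, which is
  -- nonzero at `x₀`.
  have h1 : q k ∣ B i * pderiv j Q := by
    have h2 : B i * pderiv j Q = B j * pderiv i Q - Q * (pderiv i (B j) - pderiv j (B i)) := by
      linear_combination hB i j
    rw [h2]
    exact dvd_sub (hdvd.mul_right _) (hkQ.mul_right _)
  refine ((hq k).prime.dvd_or_dvd h1).resolve_right fun ⟨c, hc⟩ => hD0 ?_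
  rw [hc, map_mul, hk0, zero_mul]

theorem pderiv_prod_eq_sum (q : Fin m → MvPolynomial (Fin d) ℝ) (i : Fin d) :
    pderiv i (∏ l, q l) = ∑ l, cofactor q l * pderiv i (q l) := by
  have h : ∀ s : Finset (Fin m), pderiv i (∏ l ∈ s, q l) =
      ∑ l ∈ s, (∏ k ∈ s.erase l, q k) * pderiv i (q l) := by
    intro s
    induction s using Finset.induction_on with
    | empty => simp
    | insert k s hk ih =>
      rw [Finset.prod_insert hk, Derivation.leibniz, ih, Finset.sum_insert hk,
        Finset.erase_insert hk, smul_eq_mul, smul_eq_mul, Finset.mul_sum, add_comm]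
      refine congrArg₂ _ rfl (Finset.sum_congr rfl fun l hl => ?_)
      have hkl : k ≠ l := fun h => hk (h ▸ hl)
      rw [Finset.erase_insert_of_ne hkl, Finset.prod_insert (fun h => hk (Finset.mem_of_mem_erase h)),
        mul_assoc]
  exact h Finset.univ

/-- A closed form `A / Q` is the sum of logarithmic forms of the factors of `Q` and of a
polynomial form. -/
theorem IsReducedBoundaryEquation.exists_logarithmic_decomposition
    (hQ : IsReducedBoundaryEquation Ω (∏ k, q k)) (hq : ∀ k, Irreducible (q k))
    (hA : ∀ i j, (∏ k, q k) * (pderiv i (A j) - pderiv j (A i)) =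
      A j * pderiv i (∏ k, q k) - A i * pderiv j (∏ k, q k)) :
    ∃ (r : Fin m → ℝ) (B : Fin d → MvPolynomial (Fin d) ℝ), ∀ i,
      A i = ∑ k, r k • (cofactor q k * pderiv i (q k)) + (∏ k, q k) * B i := by
  choose r hr using hQ.exists_residue hq hA
  have h : ∀ i, ∏ k, q k ∣ A i - ∑ k, r k • (cofactor q k * pderiv i (q k)) := by
    intro i
    refine hQ.prod_dvd_of_forall_dvd hq fun k => ?_
    have h1 : A i - ∑ l, r l • (cofactor q l * pderiv i (q l)) =
        (A i - r k • pderiv i (∏ l, q l)) +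
          ∑ l, (r k - r l) • (cofactor q l * pderiv i (q l)) := by
      simp only [pderiv_prod_eq_sum, sub_smul, Finset.sum_sub_distrib, Finset.smul_sum]
      ring
    rw [h1]
    refine dvd_add (hr k i) (Finset.dvd_sum fun l _ => ?_)
    by_cases hkl : k = l
    · rw [hkl, sub_self, zero_smul]; exact dvd_zero _
    · rw [MvPolynomial.smul_eq_C_mul]
      exact ((Finset.dvd_prod_of_mem q
        (Finset.mem_erase.2 ⟨hkl, Finset.mem_univ k⟩)).mul_right _).mul_left _
  choose B hB using h
  exact ⟨r, B, fun i => by rw [← hB i]; ring⟩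

end LogarithmicForm

/-! ### Uniqueness of the density on a maximal domain. -/

section Uniqueness

variable {d : ℕ} {a : Fin d → ℕ} {Ω : Set (Fin d → ℝ)} {m : ℕ}
  {q : Fin m → MvPolynomial (Fin d) ℝ} {Q : MvPolynomial (Fin d) ℝ}
  {G : Matrix (Fin d) (Fin d) (MvPolynomial (Fin d) ℝ)} {L : Fin d → MvPolynomial (Fin d) ℝ}

open MvPolynomial (pderiv eval)

theorem partialD_comm {f : (Fin d → ℝ) → ℝ} {x : Fin d → ℝ} (hf : ContDiffAt ℝ 2 f x)
    (i j : Fin d) : partialD i (partialD j f) x = partialD j (partialD i f) x := by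
  have hd : DifferentiableAt ℝ (fderiv ℝ f) x :=
    (hf.fderiv_right (m := 1) (by norm_num)).differentiableAt (by norm_num)
  have h : ∀ i j : Fin d, partialD i (partialD j f) x =
      fderiv ℝ (fderiv ℝ f) x (Pi.single i 1) (Pi.single j 1) := by
    intro i j
    have h1 : partialD j f = fun y => fderiv ℝ f y (Pi.single j 1) := rfl
    rw [partialD, h1, fderiv_clm_apply hd (differentiableAt_const _)]
    simp
  rw [h, h]
  exact (hf.isSymmSndFDerivAt (by simp)) _ _

/-- If `dU = A / Q`, then the form `A / Q` is closed. -/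
theorem closed_of_partialD_eq (hΩ : IsOpen Ω) (hne : Ω.Nonempty) {U : (Fin d → ℝ) → ℝ}
    (hU : ContDiffOn ℝ 2 U Ω) {A : Fin d → MvPolynomial (Fin d) ℝ}
    (hA : ∀ x ∈ Ω, ∀ j, eval x Q * partialD j U x = eval x (A j)) (i j : Fin d) :
    Q * (pderiv i (A j) - pderiv j (A i)) = A j * pderiv i Q - A i * pderiv j Q := by
  refine eq_of_eval_eq_of_isOpen hΩ hne fun x hx => ?_
  have hUx := hU.contDiffAt (hΩ.mem_nhds hx)
  have hd : ∀ j, DifferentiableAt ℝ (partialD j U) x := fun j =>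
    ((hUx.fderiv_right (m := 1) (by norm_num)).clm_apply contDiffAt_const).differentiableAt
      (by norm_num)
  have h : ∀ i j, eval x (pderiv i (A j)) =
      eval x Q * partialD i (partialD j U) x + eval x (pderiv i Q) * partialD j U x := by
    intro i j
    have h1 : (fun y => eval y (A j)) =ᶠ[𝓝 x] fun y => eval y Q * partialD j U y := by
      filter_upwards [hΩ.mem_nhds hx] with y hy using (hA y hy j).symm
    have h2 := h1.partialD_eq (i := i)
    rwa [partialD_mul (hasFDerivAt_eval Q x).differentiableAt (hd j), partialD_eval,
      partialD_eval] at h2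
  simp only [map_mul, map_sub, h, ← hA x hx, partialD_comm hUx i j]
  ring

theorem evalMetric_mulVec {x : Fin d → ℝ}
    (B : Fin d → MvPolynomial (Fin d) ℝ) (i : Fin d) :
    ((evalMetric G x).mulVec fun j => eval x (B j)) i = eval x (∑ j, G i j * B j) := by
  simp [evalMetric, Matrix.mulVec, dotProduct]

/-- A field tangent to the boundary, with components of weighted degree at most `a i`, is
divergence free. -/
theorem sum_pderiv_eq_zero_of_tangent (ha : ∀ i, 0 < a i) (hΩ : IsOpen Ω) (hne : Ω.Nonempty)
    (hb : Bornology.IsBounded Ω) (hQ0 : ∀ x ∈ frontier Ω, eval x Q = 0)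
    (hQ1 : ∀ x ∈ Ω, eval x Q ≠ 0) {S : Fin d → MvPolynomial (Fin d) ℝ}
    (hS : ∀ i, S i ∈ weightedDegreeLE a (a i)) {M : MvPolynomial (Fin d) ℝ}
    (hM : ∑ i, S i * pderiv i Q = M * Q) : ∑ i, pderiv i (S i) = 0 := by
  -- A polynomial of weighted degree `0` is constant since the weights are positive, and the
  -- divergence theorem makes its integral over `Ω` zero.
  have hdeg : ∑ i, pderiv i (S i) ∈ weightedDegreeLE a 0 :=
    Submodule.sum_mem _ fun i _ => pderiv_mem a (by rw [zero_add]; exact hS i)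
  obtain ⟨c, hc⟩ : ∃ c : ℝ, ∑ i, pderiv i (S i) = MvPolynomial.C c := by
    refine exists_eq_C_of_pderiv_eq_zero fun j => ?_
    by_contra hne
    have h1 := weightedTotalDegree_pderiv a j hne
    have h2 := (mem_weightedDegreeLE a).1 hdeg
    have := ha j
    omega
  have h := integral_mul_divergence_eq_zero hΩ hb hQ0 hQ1 (ρ := fun _ => 1) contDiffOn_const
    (integrableOn_const hb.measure_lt_top.ne) (K := 0) hM (by simp [partialD])
  rw [hc] at h ⊢
  simp only [add_zero, MvPolynomial.eval_C, one_mul, setIntegral_const, smul_eq_mul] at h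
  have hv : (volume : Measure (Fin d → ℝ)).real Ω ≠ 0 :=
    (ENNReal.toReal_pos (hΩ.measure_pos volume hne).ne' hb.measure_lt_top.ne).ne'
  rw [(mul_eq_zero.1 h).resolve_left hv, map_zero]

/-- A function whose gradient is a polynomial field `B` with `G B` of weighted degree at most `a`
is constant. -/
theorem SolvesBoundaryEquation.exists_eq_const (hS : SolvesBoundaryEquation a Ω Q G L)
    (ha : ∀ i, 0 < a i) (hΩ : IsPiecewiseC1Domain Ω) (hQ : IsReducedBoundaryEquation Ω Q)
    {V : (Fin d → ℝ) → ℝ} (hV : ContDiffOn ℝ 1 V Ω) {B : Fin d → MvPolynomial (Fin d) ℝ}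
    (hB : ∀ x ∈ Ω, ∀ i, partialD i V x = eval x (B i))
    (hdeg : ∀ i, ∑ j, G i j * B j ∈ weightedDegreeLE a (a i)) :
    ∃ c, ∀ x ∈ Ω, V x = c := by
  have hne := hΩ.isConnected.nonempty
  have hQ0 : ∀ x ∈ frontier Ω, eval x Q = 0 := fun x hx => hQ.eval_eq_zero hx
  have hQ1 : ∀ x ∈ Ω, eval x Q ≠ 0 := fun x hx => hS.eval_ne_zero hQ hx
  set S : Fin d → MvPolynomial (Fin d) ℝ := fun i => ∑ j, G i j * B j with hSdef
  set M := ∑ j, B j * L j with hMdef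
  have hM : ∑ i, S i * pderiv i Q = M * Q := by
    simp only [hSdef, hMdef, Finset.sum_mul, mul_assoc, ← hS.equation, Finset.mul_sum]
    rw [Finset.sum_comm]
    refine Finset.sum_congr rfl fun i _ => Finset.sum_congr rfl fun j _ => ?_
    rw [hS.isSymm.apply i j]
    ring
  have hdiv := sum_pderiv_eq_zero_of_tangent ha hΩ.isOpen hne hΩ.isBounded hQ0 hQ1 hdeg hM
  -- `arctan` keeps the field bounded without any bound on `V`; as `S` is divergence free, the
  -- divergence is `(B·gB)/(1+V²) ≥ 0`.
  set W : Fin d → (Fin d → ℝ) → ℝ := fun i x => Real.arctan (V x) * eval x (S i) with hW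
  have hVd : ∀ x ∈ Ω, DifferentiableAt ℝ V x := fun x hx =>
    (hV.contDiffAt (hΩ.isOpen.mem_nhds hx)).differentiableAt (by norm_num)
  have hWd : ∀ x ∈ Ω, ∑ i, partialD i (W i) x =
      (1 + V x ^ 2)⁻¹ * eval x (∑ i, B i * S i) := by
    intro x hx
    have hat : DifferentiableAt ℝ (fun y => Real.arctan (V y)) x := (hVd x hx).arctan
    simp only [hW, fun i => partialD_mul hat (hasFDerivAt_eval (S i) x).differentiableAt i,
      partialD_eval, partialD_comp Real.differentiable_arctan.differentiableAt (hVd x hx), hB x hx,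
      Real.deriv_arctan, Finset.sum_add_distrib, ← Finset.mul_sum]
    rw [← map_sum, hdiv, map_zero, mul_zero, zero_add, map_sum, Finset.mul_sum]
    exact Finset.sum_congr rfl fun i _ => by rw [map_mul, one_div, mul_assoc]
  have hnn : ∀ x ∈ Ω, 0 ≤ eval x (∑ i, B i * S i) ∧
      (eval x (∑ i, B i * S i) = 0 → ∀ i, eval x (B i) = 0) := by
    intro x hx
    have h1 : eval x (∑ i, B i * S i) = dotProduct (fun i => eval x (B i))
        ((evalMetric G x).mulVec fun j => eval x (B j)) := by
      simp only [dotProduct, evalMetric_mulVec, map_sum, map_mul, hSdef]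
    have hpd := hS.posDef x hx
    rw [h1]
    refine ⟨by simpa using hpd.posSemidef.dotProduct_mulVec_nonneg fun i => eval x (B i), ?_⟩
    intro h0
    by_contra! hne
    have h2 := hpd.dotProduct_mulVec_pos (x := fun i => eval x (B i)) (by
      obtain ⟨i, hi⟩ := hne
      exact fun h => hi (congrFun h i))
    simp only [star_trivial, h0] at h2
    exact lt_irrefl _ h2
  have hcont : ContinuousOn (fun x => (1 + V x ^ 2)⁻¹ * eval x (∑ i, B i * S i)) Ω :=
    ((continuousOn_const.add (hV.continuousOn.pow 2)).inv₀ fun x _ =>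
      (add_pos_of_pos_of_nonneg one_pos (sq_nonneg (V x))).ne').mul
      (continuous_eval _).continuousOn
  have hconst : IntegrableOn (fun _ : Fin d → ℝ => (1 : ℝ)) Ω :=
    integrableOn_const hΩ.isBounded.measure_lt_top.ne
  have hpoly : ∀ p, IntegrableOn (fun x => eval x p) Ω := fun p => by
    simpa using IntegrableOn.mul_continuous hΩ.isOpen hΩ.isBounded hconst (continuous_eval p)
  have hint : IntegrableOn (fun x => (1 + V x ^ 2)⁻¹ * eval x (∑ i, B i * S i)) Ω := by
    refine Integrable.mono (hpoly (∑ i, B i * S i)) (hcont.aestronglyMeasurable hΩ.isOpen.measurableSet)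
      (Filter.Eventually.of_forall fun x => ?_)
    rw [norm_mul]
    refine mul_le_of_le_one_left (norm_nonneg _) ?_
    rw [Real.norm_of_nonneg (by positivity)]
    exact inv_le_one_of_one_le₀ (by nlinarith [sq_nonneg (V x)])
  have hzero := integral_divergence_eq_zero hΩ.isOpen hΩ.isBounded hQ0 hQ1 (W := W)
    (fun i => (Real.contDiff_arctan.comp_contDiffOn hV).mul (contDiff_eval (S i)).contDiffOn)
    (hint.congr_fun (fun x hx => (hWd x hx).symm) hΩ.isOpen.measurableSet)
    (h := fun x => Real.pi / 2 * |eval x M|) ((hpoly M).abs.const_mul _) (fun x _ => by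
      have h1 : ∑ i, W i x * eval x (pderiv i Q) = Real.arctan (V x) * (eval x M * eval x Q) := by
        rw [← map_mul, ← hM, map_sum, Finset.mul_sum]
        exact Finset.sum_congr rfl fun i _ => by rw [hW, map_mul, mul_assoc]
      rw [h1, abs_mul, abs_mul, ← mul_assoc]
      gcongr
      exact abs_le.2 ⟨(Real.neg_pi_div_two_lt_arctan _).le, (Real.arctan_lt_pi_div_two _).le⟩)
  rw [setIntegral_congr_fun hΩ.isOpen.measurableSet hWd] at hzero
  have h0 := eqOn_zero_of_setIntegral_eq_zero hΩ.isOpen hcont hint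
    (fun x hx => mul_nonneg (by positivity) (hnn x hx).1) hzero
  refine hΩ.isOpen.exists_is_const_of_fderiv_eq_zero hΩ.isConnected.isPreconnected
    (hV.differentiableOn (by norm_num)) fun x hx => ?_
  have h1 : eval x (∑ i, B i * S i) = 0 :=
    (mul_eq_zero.1 (h0 x hx)).resolve_left (by positivity)
  refine ContinuousLinearMap.ext fun v => ?_
  rw [apply_eq_sum_single (fderiv ℝ V x) v]
  refine Finset.sum_eq_zero fun i _ => ?_
  have h2 := hB x hx i
  rw [(hnn x hx).2 h1 i, partialD] at h2
  rw [h2, mul_zero]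

theorem eq_normalizedMeasure_of_eq_const_mul (hΩ : IsOpen Ω) {ρ w : (Fin d → ℝ) → ℝ} {c : ℝ}
    (hc : 0 < c) (hρ : ∀ x ∈ Ω, ρ x = c * w x)
    [IsProbabilityMeasure ((volume.restrict Ω).withDensity fun x => ENNReal.ofReal (ρ x))] :
    (volume.restrict Ω).withDensity (fun x => ENNReal.ofReal (w x)) Set.univ < ⊤ ∧
      (volume.restrict Ω).withDensity (fun x => ENNReal.ofReal (ρ x)) = normalizedMeasure
        ((volume.restrict Ω).withDensity (fun x => ENNReal.ofReal (w x))) := by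
  set ν := (volume.restrict Ω).withDensity (fun x => ENNReal.ofReal (w x)) with hν
  have hc0 : ENNReal.ofReal c ≠ 0 := by simpa using hc
  have h : (volume.restrict Ω).withDensity (fun x => ENNReal.ofReal (ρ x)) =
      ENNReal.ofReal c • ν := by
    rw [hν, ← withDensity_smul' _ _ ENNReal.ofReal_ne_top]
    refine withDensity_congr_ae ((ae_restrict_iff' hΩ.measurableSet).2
      (Filter.Eventually.of_forall fun x hx => ?_))
    simp only [hρ x hx, ENNReal.ofReal_mul hc.le, Pi.smul_apply, smul_eq_mul]
  have h1 : ENNReal.ofReal c * ν Set.univ = 1 := by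
    have := measure_univ (μ := (volume.restrict Ω).withDensity fun x => ENNReal.ofReal (ρ x))
    rwa [h, Measure.smul_apply, smul_eq_mul] at this
  have h2 : (ν Set.univ)⁻¹ = ENNReal.ofReal c := (ENNReal.eq_inv_of_mul_eq_one_left h1).symm
  refine ⟨?_, by rw [h, normalizedMeasure, h2]⟩
  rw [lt_top_iff_ne_top]
  intro htop
  rw [htop, ENNReal.mul_top hc0] at h1
  exact ENNReal.top_ne_one h1

/-- On a maximal domain, the density of a polynomial model is a product of powers of the factors
of the boundary equation. -/
theorem IsPolynomialModel.eq_normalizedMeasure (ha : ∀ i, 0 < a i) (hΩ : IsPiecewiseC1Domain Ω)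
    (hQ : IsReducedBoundaryEquation Ω (∏ k, q k))
    (hS : SolvesBoundaryEquation a Ω (∏ k, q k) G L) (hq : ∀ k, Irreducible (q k))
    (hdet : Associated (∏ k, q k) G.det) {b : (Fin d → ℝ) → Fin d → ℝ}
    {μ : Measure (Fin d → ℝ)} (hm : IsPolynomialModel a Ω (evalMetric G) b μ) :
    ∃ r : Fin m → ℝ, factorMeasure Ω q r Set.univ < ⊤ ∧
      μ = normalizedMeasure (factorMeasure Ω q r) := by
  have hne := hΩ.isConnected.nonempty
  obtain ⟨β, hβ⟩ := hm.exists_drift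
  have H := hm.integral_drift_mul hΩ.isOpen hne hΩ.isBounded hS.isSymm (fun x _ => rfl)
    (fun x hx i => (hβ i).2 x hx)
  have hprob := hm.isProbabilityMeasure
  obtain ⟨ρ, hρ, hpos, rfl⟩ := hm.density
  have hq0 : ∀ x ∈ Ω, ∀ k, eval x (q k) ≠ 0 := fun x hx k =>
    eval_factor_ne_zero (hS.eval_ne_zero hQ hx) k
  have hρd : ∀ x ∈ Ω, DifferentiableAt ℝ ρ x := fun x hx =>
    (hρ.contDiffAt (hΩ.isOpen.mem_nhds hx)).differentiableAt (by simp)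
  -- `N` is `g∇ log ρ`, because symmetry determines the drift from `g` and `ρ`.
  set N : Fin d → MvPolynomial (Fin d) ℝ := fun i => β i - ∑ j, pderiv j (G i j) with hN
  have hNdeg : ∀ i, N i ∈ weightedDegreeLE a (a i) := fun i =>
    Submodule.sub_mem _ (hβ i).1
      (Submodule.sum_mem _ fun j _ => pderiv_mem a (hS.degree_metric i j))
  set U : (Fin d → ℝ) → ℝ := fun x => Real.log (ρ x) with hU
  have hUs : ContDiffOn ℝ ∞ U Ω := hρ.log fun x hx => (hpos x hx).ne'
  have hGU : ∀ x ∈ Ω, ∀ i, ∑ j, eval x (G i j) * partialD j U x = eval x (N i) := by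
    intro x hx i
    have h1 := drift_eq_of_integral_eq_zero hΩ.isOpen hΩ.isBounded (hρ.of_le (by simp)) hpos
      (H i) hx
    simp only [fun j => partialD_mul (hρd x hx) (hasFDerivAt_eval (G i j) x).differentiableAt j,
      partialD_eval, Finset.sum_add_distrib, ← Finset.mul_sum] at h1
    have hρ0 := (hpos x hx).ne'
    simp only [hU, partialD_comp (Real.differentiableAt_log hρ0) (hρd x hx), Real.deriv_log, hN,
      map_sub, map_sum]
    apply mul_left_cancel₀ hρ0
    rw [mul_sub, ← h1, Finset.mul_sum, add_sub_cancel_left]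
    exact Finset.sum_congr rfl fun j _ => by field_simp
  obtain ⟨u, hu⟩ := hdet.symm
  -- `g∇U = N` is inverted by the adjugate. As `Q = u det g` for a unit `u`, the only denominator of
  -- `dU` is `Q`; here maximality enters.
  set A : Fin d → MvPolynomial (Fin d) ℝ := fun j => ∑ i, (G.adjugate j i * u) * N i with hAdef
  have hA : ∀ x ∈ Ω, ∀ j, eval x (∏ k, q k) * partialD j U x = eval x (A j) := by
    intro x hx j
    have h1 : (evalMetric G x).mulVec (fun j => partialD j U x) = fun i => eval x (N i) :=
      funext fun i => hGU x hx i
    have h2 := congrFun (congrArg (evalMetric G x).adjugate.mulVec h1) j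
    rw [Matrix.mulVec_mulVec, Matrix.adjugate_mul, Matrix.smul_mulVec, Matrix.one_mulVec] at h2
    have h3 : (evalMetric G x).adjugate = (G.adjugate).map (eval x) :=
      ((eval x).map_adjugate G).symm
    rw [h3] at h2
    simp only [Pi.smul_apply, smul_eq_mul, Matrix.mulVec, dotProduct, Matrix.map_apply] at h2
    rw [← hu, map_mul, eval_det_eq, mul_right_comm, h2, hAdef, map_sum, Finset.sum_mul]
    exact Finset.sum_congr rfl fun i _ => by rw [map_mul, map_mul]; ring
  obtain ⟨r, B, hB⟩ := hQ.exists_logarithmic_decomposition hq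
    (closed_of_partialD_eq hΩ.isOpen hne (contDiffOn_infty.1 hUs 2) hA)
  have hlogs : ContDiffOn ℝ 1 (logWeight q r) Ω := fun x hx =>
    (contDiffAt_logWeight (hq0 x hx)).contDiffWithinAt
  have hVB : ∀ x ∈ Ω, ∀ i, partialD i (fun y => U y - logWeight q r y) x = eval x (B i) := by
    intro x hx i
    have hQx := hS.eval_ne_zero hQ hx
    rw [partialD_sub ((hUs.contDiffAt (hΩ.isOpen.mem_nhds hx)).differentiableAt (by simp))
      ((contDiffAt_logWeight (hq0 x hx) (n := 1)).differentiableAt (by norm_num)),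
      partialD_logWeight (hq0 x hx)]
    apply mul_left_cancel₀ hQx
    rw [mul_sub, hA x hx i, hB i, map_add, map_mul (eval x) (∏ k, q k), map_sum, Finset.mul_sum,
      sub_eq_iff_eq_add, add_comm]
    refine congrArg₂ _ rfl (Finset.sum_congr rfl fun k _ => ?_)
    have hk := hq0 x hx k
    rw [← mul_cofactor q k, MvPolynomial.smul_eval, map_mul, map_mul]
    field_simp
  obtain ⟨M, hM⟩ := hS.exists_factor hQ hq
  -- The degree of `B` is not controlled directly, but `gB` is a difference of logarithmic
  -- gradients, with components of degrees at most `a_i`.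
  have hGB : ∀ i, ∑ j, G i j * B j = N i - ∑ k, r k • M i k := by
    intro i
    refine eq_of_eval_eq_of_isOpen hΩ.isOpen hne fun x hx => ?_
    have h1 : ∀ k, eval x (M i k) =
        ∑ j, eval x (G i j) * (eval x (pderiv j (q k)) / eval x (q k)) := by
      intro k
      have h2 := congrArg (eval x) (hM i k).2
      rw [map_mul, map_sum] at h2
      rw [eq_comm, ← mul_div_cancel_right₀ (eval x (M i k)) (hq0 x hx k), ← h2, Finset.sum_div]
      exact Finset.sum_congr rfl fun j _ => by rw [map_mul, mul_div_assoc]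
    have h2 : ∀ j, eval x (B j) = partialD j U x -
        ∑ k, r k * (eval x (pderiv j (q k)) / eval x (q k)) := by
      intro j
      rw [← hVB x hx j, partialD_sub
        ((hUs.contDiffAt (hΩ.isOpen.mem_nhds hx)).differentiableAt (by simp))
        ((contDiffAt_logWeight (hq0 x hx) (n := 1)).differentiableAt (by norm_num)),
        partialD_logWeight (hq0 x hx)]
    simp only [map_sum, map_mul, map_sub, MvPolynomial.smul_eval, h1, h2, ← hGU x hx i, mul_sub,
      Finset.sum_sub_distrib, Finset.mul_sum]
    refine congrArg₂ _ rfl ?_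
    rw [Finset.sum_comm]
    exact Finset.sum_congr rfl fun k _ => Finset.sum_congr rfl fun j _ => by ring
  obtain ⟨c, hc⟩ := hS.exists_eq_const ha hΩ hQ ((hUs.of_le (by simp)).sub hlogs) hVB fun i => by
    rw [hGB i]
    exact Submodule.sub_mem _ (hNdeg i)
      (Submodule.sum_mem _ fun k _ => Submodule.smul_mem _ _ (hM i k).1)
  refine ⟨r, eq_normalizedMeasure_of_eq_const_mul hΩ.isOpen (Real.exp_pos c) fun x hx => ?_⟩
  rw [factorWeight_eq_exp (hq0 x hx), ← Real.exp_add, ← Real.exp_log (hpos x hx)]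
  congr 1
  linarith [hc x hx]

end Uniqueness

/-! ### Assembly of the theorem. -/

theorem mainTheorem1 {d : ℕ} (a : Fin d → ℕ) (ha : ∀ i, 0 < a i)
    (Ω : Set (Fin d → ℝ)) (hΩ : IsPiecewiseC1Domain Ω) :
    (IsAdmissible a Ω →
      (∃ P : MvPolynomial (Fin d) ℝ, P ≠ 0 ∧ P.weightedTotalDegree a ≤ 2 * ∑ i, a i ∧
        ∀ x ∈ frontier Ω, MvPolynomial.eval x P = 0) ∧
      (∃ Q : MvPolynomial (Fin d) ℝ, IsReducedBoundaryEquation Ω Q)) ∧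
    (∀ Q : MvPolynomial (Fin d) ℝ, IsReducedBoundaryEquation Ω Q →
      (IsAdmissible a Ω ↔ ∃ G L, SolvesBoundaryEquation a Ω Q G L) ∧
      (∀ G L, SolvesBoundaryEquation a Ω Q G L →
        Q ∣ G.det ∧
        (∀ (m : ℕ) (q : Fin m → MvPolynomial (Fin d) ℝ),
          (∀ k, Irreducible (q k)) → Q = ∏ k, q k →
          (∀ r : Fin m → ℝ, factorMeasure Ω q r Set.univ < ⊤ →
            IsAdmissibleMeasure a Ω (normalizedMeasure (factorMeasure Ω q r)) ∧
            IsPolynomialModel a Ω (evalMetric G)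
              (symmetricDrift (evalMetric G) (factorWeight q r))
              (normalizedMeasure (factorMeasure Ω q r))) ∧
          (Associated Q G.det →
            ∀ (b : (Fin d → ℝ) → Fin d → ℝ) (μ : MeasureTheory.Measure (Fin d → ℝ)),
              IsPolynomialModel a Ω (evalMetric G) b μ →
              ∃ r : Fin m → ℝ, factorMeasure Ω q r Set.univ < ⊤ ∧
                μ = normalizedMeasure (factorMeasure Ω q r))))) := by
  refine ⟨fun ⟨_, μ, g, b, hm⟩ => ?_, fun Q hQ => ⟨⟨fun ⟨_, μ, g, b, hm⟩ =>
    hm.exists_solvesBoundaryEquation hΩ hQ, fun ⟨G, L, hS⟩ => hS.isAdmissible ha hΩ hQ⟩,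
    fun G L hS => ⟨hS.dvd_det hQ, ?_⟩⟩⟩
  · obtain ⟨G, β, hGs, hdeg, -, hG, hβ⟩ := hm.exists_coefficients
    have h0 := hm.det_eval_eq_zero hΩ hGs hG hβ
    have hne : G.det ≠ 0 := by
      obtain ⟨x, hx⟩ := hΩ.isConnected.nonempty
      intro h
      have h1 := (hm.posDef x hx).det_pos
      rw [hG x hx, ← eval_det_eq, h, map_zero] at h1
      exact lt_irrefl _ h1
    exact ⟨⟨G.det, hne, det_mem_weightedDegreeLE a G hdeg, h0⟩,
      exists_isReducedBoundaryEquation hΩ hne h0⟩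
  · rintro m q hq rfl
    refine ⟨fun r hr => ?_, fun hdet b μ hm => hm.eq_normalizedMeasure ha hΩ hQ hS hq hdet⟩
    have h := isPolynomialModel_factorMeasure ha hΩ hQ hS hq hr
    exact ⟨⟨_, _, h⟩, h⟩
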